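/- Let $\mathbf C$ be an infinitary pretopos (an exact category with small coproducts that are disjoint and universal) and let $K$ be a commutative ring object of $\mathbf C$, not necessarily with a unit, which is weakly unital. The latter means that there is a subobject $\mathcal E \subseteq K$ (a weak unit) closed under multiplication such that the multiplication morphisms $\mathcal E \times \mathcal E \to \mathcal E$ and $K \times \mathcal E \to K$ are epimorphisms and, in the internal language of $\mathbf C$, any two elements of $\mathcal E$ have a common divisor (for $a, b \in \mathcal E$ there are $a', b', d \in \mathcal E$ with $a = a' d$ and $b = b' d$), and if $m e = 0$ for $m \in K$ and $e \in \mathcal E$, then $e = e' e''$ and $m e' = 0$ for some $e', e'' \in \mathcal E$. Let $\mathsf D_4 = \{\pm \mathrm e_i \pm \mathrm e_j \mid 1 \le i < j \le 4\}$, and let $\mathrm{St}(\mathsf D_4, K)$ be the group object with generators $x_\alpha(p)$ for $\alpha \in \mathsf D_4$ and $p \in K$, and with the relations $x_\alpha(p)\, x_\alpha(q) = x_\alpha(p + q)$, $[x_\alpha(p), x_\beta(q)] = x_{\alpha + \beta}(N_{\alpha\beta}\, p q)$ if $\alpha + \beta \in \mathsf D_4$, and $[x_\alpha(p), x_\beta(q)]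 = 1$ if $\alpha + \beta \notin \mathsf D_4 \cup \{0\}$. Here $[g, h] = g h g^{-1} h^{-1}$ and $N_{\alpha\beta} \in \{\pm 1\}$ are the structure constants of the split Lie algebra of type $\mathsf D_4$ over $\mathbb Z$ with respect to any choice of generators of the root spaces. Let $\kappa \colon \widetilde{\mathrm{St}} \to \mathrm{St}(\mathsf D_4, K)$ be the universal central extension, let $\mathrm M = \operatorname{Ker} \kappa$ be the Schur multiplier, and let $\langle g, h \rangle \in \widetilde{\mathrm{St}}$ be the commutator of arbitrary preimages of $g$ and $h$ under $\kappa$. Put $$K_{2\varepsilon} = K / \langle 2p,\ (p^2 - p)(q^2 - q) \rangle, \qquad I = \langle p^2 - p \rangle \trianglelefteq K_{2\varepsilon}, \qquad K_2 = K_{2\varepsilon} / I,$$ where $\langle X \rangle$ is the ideal generated by $X$, so $K_2$ is the universal Boolean quotient of $K$. The following three sets are the orbits of $\mathrm W(\mathsf D_4)$ on the short roots of $\mathsf F_4$: $$O_0 = \{\pm \mathrm e_i\}, \qquad O_\pm = \bigl\{ \tfrac12 \textstyle\sum_i s_i \mathrm e_i \bigm| s_i \in \{-1, 1\},\ \prod_i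 s_i = \pm 1 \bigr\}.$$ Then for every $o \in \{0, +, -\}$ there is a unique homomorphism $c_o \colon K_{2\varepsilon} \to \mathrm M$ from the additive group such that $\langle x_\alpha(p), x_\beta(q) \rangle = c_o(p q)$ for all $p, q \in K$ and all orthogonal roots $\alpha, \beta \in \mathsf D_4$ with $\frac12(\alpha + \beta) \in O_o$. The Schur multiplier $\mathrm M$ is the product of the images of $c_0$, $c_+$, $c_-$. Moreover, the projection $K_{2\varepsilon} \to K_2$ has a section which is a ring homomorphism and which sends the class of $p$ to $p^2$, so $K_{2\varepsilon} = I \rtimes K_2$, and $$c_0(p) = c_+(p) = c_-(p) \quad \text{for } p \in I, \qquad c_0(q)\, c_+(q)\, c_-(q) = 1 \quad \text{for } q \in K_2.$$ -/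

import Mathlib

open CategoryTheory Limits MonoidalCategory CartesianMonoidalCategory
open scoped MonObj AddMonObj commutatorElement

universe v u

namespace SteinbergD4

/-! ## Infinitary pretopoi -/

/-- An infinitary pretopos: a regular category (finite limits, coequalizers of kernel pairs,
pullback-stable regular epimorphisms) in which all internal equivalence relations are effective
and which has all small coproducts, these being disjoint and universal (van Kampen).

In such a category every epimorphism is regular, so below epimorphisms, which also interpret the
existential quantifier of the internal language, are spelled as regular epimorphisms. -/
class InfinitaryPretopos (C : Type u) [Category.{v} C] : Prop extends Regular C where
  hasCoproducts : HasCoproducts.{v} C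
  isVanKampen_coproduct : ∀ {J : Type v} (X : J → C) (c : Cofan X),
    Nonempty (IsColimit c) → IsVanKampenColimit c
  isEffective : ∀ {R X : C} (p₁ p₂ : R ⟶ X), IsEquivalenceRelation p₁ p₂ →
    IsEffectiveEquivalenceRelation p₁ p₂

variable {C : Type u} [Category.{v} C] [CartesianMonoidalCategory C]

/-! ## Non-unital commutative ring objects

Identities between terms are stated for generalized elements `T ⟶ R`. -/

/-- A commutative ring object, not necessarily with a unit. -/
class NonUnitalCommRingObj (R : C) extends AddGrpObj R where
  /-- the multiplication morphism -/
  mulHom : R ⊗ R ⟶ R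
  add_comm' : ∀ {T : C} (a b : T ⟶ R), a + b = b + a
  mul_assoc' : ∀ {T : C} (a b c : T ⟶ R),
    lift (lift a b ≫ mulHom) c ≫ mulHom = lift a (lift b c ≫ mulHom) ≫ mulHom
  mul_comm' : ∀ {T : C} (a b : T ⟶ R), lift a b ≫ mulHom = lift b a ≫ mulHom
  mul_add' : ∀ {T : C} (a b c : T ⟶ R),
    lift a (b + c) ≫ mulHom = lift a b ≫ mulHom + lift a c ≫ mulHom

/-- The generalized elements of a non-unital commutative ring object form such a ring. -/
instance homNonUnitalCommRing {T R : C} [NonUnitalCommRingObj R] :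
    NonUnitalCommRing (T ⟶ R) :=
  have hr : ∀ a b c : T ⟶ R,
      lift (a + b) c ≫ NonUnitalCommRingObj.mulHom =
        lift a c ≫ NonUnitalCommRingObj.mulHom + lift b c ≫ NonUnitalCommRingObj.mulHom := by
    intro a b c
    rw [NonUnitalCommRingObj.mul_comm', NonUnitalCommRingObj.mul_add',
      NonUnitalCommRingObj.mul_comm' c a, NonUnitalCommRingObj.mul_comm' c b]
  { (inferInstance : AddGroup (T ⟶ R)) with
    add_comm := NonUnitalCommRingObj.add_comm'
    mul := fun a b => lift a b ≫ NonUnitalCommRingObj.mulHom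
    left_distrib := NonUnitalCommRingObj.mul_add'
    right_distrib := hr
    zero_mul := fun a => by
      have h := hr 0 0 a
      rw [add_zero] at h
      exact left_eq_add.mp h
    mul_zero := fun a => by
      have h := NonUnitalCommRingObj.mul_add' a 0 0
      rw [add_zero] at h
      exact left_eq_add.mp h
    mul_assoc := NonUnitalCommRingObj.mul_assoc'
    mul_comm := NonUnitalCommRingObj.mul_comm' }

theorem hom_mul_def {T R : C} [NonUnitalCommRingObj R] (a b : T ⟶ R) :
    a * b = lift a b ≫ NonUnitalCommRingObj.mulHom := rfl

theorem comp_mul_hom {S T R : C} [NonUnitalCommRingObj R] (f : S ⟶ T) (a b : T ⟶ R) :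
    f ≫ (a * b) = (f ≫ a) * (f ≫ b) := by
  simp only [hom_mul_def, ← Category.assoc, comp_lift]

/-- Homomorphisms of non-unital commutative ring objects. -/
structure IsRingObjHom {R S : C} [NonUnitalCommRingObj R] [NonUnitalCommRingObj S]
    (f : R ⟶ S) : Prop where
  map_add : ∀ {T : C} (a b : T ⟶ R), (a + b) ≫ f = a ≫ f + b ≫ f
  map_mul : ∀ {T : C} (a b : T ⟶ R), (a * b) ≫ f = (a ≫ f) * (b ≫ f)

/-- The monomorphism `j : E ⟶ K` is a weak unit of the commutative ring object `K`: a
multiplicative subsemigroup in which any two elements locally have a common divisor, with epic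
multiplication morphisms `E × E ⟶ E` and `K × E ⟶ K`, and such that `m e = 0` for `e` in `E`
implies that locally `e = e' e''` with `e', e''` in `E` and `m e' = 0`. -/
structure IsWeakUnit {E K : C} [NonUnitalCommRingObj K] (j : E ⟶ K) : Prop where
  mono : Mono j
  mul_epi : ∃ m : E ⊗ E ⟶ E, m ≫ j = (fst E E ≫ j) * (snd E E ≫ j) ∧ IsRegularEpi m
  smul_epi : IsRegularEpi (fst K E * (snd K E ≫ j))
  common_divisor : ∀ {T : C} (a b : T ⟶ E),
    ∃ (T' : C) (f : T' ⟶ T) (a' b' d : T' ⟶ E), IsRegularEpi f ∧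
      f ≫ a ≫ j = (a' ≫ j) * (d ≫ j) ∧ f ≫ b ≫ j = (b' ≫ j) * (d ≫ j)
  annihilator : ∀ {T : C} (m : T ⟶ K) (e : T ⟶ E), m * (e ≫ j) = 0 →
    ∃ (T' : C) (f : T' ⟶ T) (e' e'' : T' ⟶ E), IsRegularEpi f ∧
      f ≫ e ≫ j = (e' ≫ j) * (e'' ≫ j) ∧ (f ≫ m) * (e' ≫ j) = 0

/-- A commutative ring object is weakly unital if it has a weak unit. -/
def IsWeaklyUnital (K : C) [NonUnitalCommRingObj K] : Prop :=
  ∃ (E : C) (j : E ⟶ K), IsWeakUnit j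

/-- `J` is an ideal of `R`. -/
structure IsIdeal {R : C} [NonUnitalCommRingObj R] (J : Subobject R) : Prop where
  zero_mem : ∀ {T : C}, J.Factors (0 : T ⟶ R)
  add_mem : ∀ {T : C} (a b : T ⟶ R), J.Factors a → J.Factors b → J.Factors (a + b)
  neg_mem : ∀ {T : C} (a : T ⟶ R), J.Factors a → J.Factors (-a)
  mul_mem : ∀ {T : C} (r a : T ⟶ R), J.Factors a → J.Factors (r * a)

/-- `π : R ⟶ S` is the quotient of `R` by the ideal generated by the elements satisfying `P`. -/
structure IsQuotientBySpan {R S : C} [NonUnitalCommRingObj R] [NonUnitalCommRingObj S]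
    (P : ∀ T : C, (T ⟶ R) → Prop) (π : R ⟶ S) : Prop where
  isHom : IsRingObjHom π
  isRegularEpi : IsRegularEpi π
  relation : ∀ {T : C} (a : T ⟶ R), P T a → a ≫ π = 0
  ker_le : ∀ J : Subobject R, IsIdeal J → (∀ (T : C) (a : T ⟶ R), P T a → J.Factors a) →
    ∀ {T : C} (a : T ⟶ R), a ≫ π = 0 → J.Factors a

/-- The relators `2 p` and `(p ^ 2 - p) (q ^ 2 - q)`. -/
def TwoEpsRelator {R : C} [NonUnitalCommRingObj R] (T : C) (a : T ⟶ R) : Prop :=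
  (∃ p : T ⟶ R, a = p + p) ∨ ∃ p q : T ⟶ R, a = (p * p - p) * (q * q - q)

/-- The relators `2 p` and `p ^ 2 - p`. -/
def BooleanRelator {R : C} [NonUnitalCommRingObj R] (T : C) (a : T ⟶ R) : Prop :=
  (∃ p : T ⟶ R, a = p + p) ∨ ∃ p : T ⟶ R, a = p * p - p

/-! ## The root system of type D4 and the short roots of F4 -/

/-- The root system `D4`, consisting of the vectors `±e_i ± e_j` with `i < j`. -/
def rootsD4 : Set (Fin 4 → ℤ) :=
  {w | ∃ i j : Fin 4, i < j ∧ ∃ s t : ℤˣ, w = Pi.single i (s : ℤ) + Pi.single j (t : ℤ)}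

/-- Labels for the three orbits of the Weyl group of `D4` on the short roots of `F4`. -/
inductive Orbit
  | zero
  | plus
  | minus

/-- The orbits: `±e_i`, and the vectors with all coordinates `±1/2` with an even, respectively
odd, number of negative coordinates. -/
def Orbit.roots : Orbit → Set (Fin 4 → ℚ)
  | .zero => {g | ∃ (i : Fin 4) (s : ℤˣ), g = Pi.single i ((s : ℤ) : ℚ)}
  | .plus => {g | ∃ s : Fin 4 → ℤˣ, ∏ i, s i = 1 ∧ g = fun i => ((s i : ℤ) : ℚ) / 2}
  | .minus => {g | ∃ s : Fin 4 → ℤˣ, ∏ i, s i = -1 ∧ g = fun i => ((s i : ℤ) : ℚ) / 2}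

/-- The vector `(a + b) / 2`. -/
def halfSum (a b : Fin 4 → ℤ) : Fin 4 → ℚ := fun i => ((a i + b i : ℤ) : ℚ) / 2

/-- The weights `±e_i` of the natural representation of the orthogonal Lie algebra of rank 4. -/
def weight (k : Fin 4 × ℤˣ) : Fin 4 → ℤ := Pi.single k.1 (k.2 : ℤ)

/-- `X` is a generator of the root space with root `a` in the split orthogonal Lie algebra
over `ℤ`. With `i` and `j` the basis vectors of the natural representation such that
`weight i - weight j = a`, this says that `X` is one of the matrices `±(E_{i, j} - E_{-j, -i})`. -/
structure IsRootVector (a : Fin 4 → ℤ) (X : Matrix (Fin 4 × ℤˣ) (Fin 4 × ℤˣ) ℤ) : Prop where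
  eq_zero : ∀ i j, weight i - weight j ≠ a → X i j = 0
  eq_unit : ∀ i j, weight i - weight j = a → X i j = 1 ∨ X i j = -1
  skew : ∀ i j, X (j.1, -j.2) (i.1, -i.2) = -X i j

/-- `N` is the family of structure constants of type `D4` for some choice of
the generators of the root spaces. Only the values `N a b` for which `a + b` is a root matter. -/
def IsStructureConstants (N : rootsD4 → rootsD4 → ℤ) : Prop :=
  ∃ X : rootsD4 → Matrix (Fin 4 × ℤˣ) (Fin 4 × ℤˣ) ℤ,
    (∀ a, IsRootVector a.1 (X a)) ∧
      ∀ a b c : rootsD4, c.1 = a.1 + b.1 → X a * X b - X b * X a = N a b • X c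

/-! ## The Steinberg group object -/

/-- A morphism from an additive group object to a multiplicative one is a homomorphism. -/
def IsAddMulHom {A G : C} [AddGrpObj A] [GrpObj G] (f : A ⟶ G) : Prop :=
  ∀ {T : C} (p q : T ⟶ A), (p + q) ≫ f = (p ≫ f) * (q ≫ f)

/-- The Steinberg relations of type `D4` for a family of morphisms to a group object. -/
structure SteinbergRelations {K G : C} [NonUnitalCommRingObj K] [GrpObj G]
    (N : rootsD4 → rootsD4 → ℤ) (x : rootsD4 → (K ⟶ G)) : Prop where
  map_add : ∀ a, IsAddMulHom (x a)
  commutator_root : ∀ a b c : rootsD4, c.1 = a.1 + b.1 → ∀ {T : C} (p q : T ⟶ K),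
    ⁅p ≫ x a, q ≫ x b⁆ = (N a b • (p * q)) ≫ x c
  commutator_one : ∀ a b : rootsD4, a.1 + b.1 ∉ rootsD4 → a.1 + b.1 ≠ 0 →
    ∀ {T : C} (p q : T ⟶ K), ⁅p ≫ x a, q ≫ x b⁆ = 1

/-- The group object `St` with root morphisms `x` is the Steinberg group `St(D4, K)`: the group
object with generators `x a` and only the Steinberg relations. -/
structure IsSteinbergGroup {K St : C} [NonUnitalCommRingObj K] [GrpObj St]
    (N : rootsD4 → rootsD4 → ℤ) (x : rootsD4 → (K ⟶ St)) : Prop where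
  relations : SteinbergRelations N x
  existsUnique_hom : ∀ {G : C} [GrpObj G] (y : rootsD4 → (K ⟶ G)), SteinbergRelations N y →
    ∃! f : St ⟶ G, IsMonHom f ∧ ∀ a, x a ≫ f = y a

/-! ## Central extensions and the Schur multiplier -/

/-- A central extension: an epimorphism of group objects with central kernel. -/
structure IsCentralExtension {H G : C} [GrpObj H] [GrpObj G] (f : H ⟶ G) : Prop where
  isMonHom : IsMonHom f
  isRegularEpi : IsRegularEpi f
  central : ∀ {T : C} (z h : T ⟶ H), z ≫ f = 1 → z * h = h * z

/-- A universal central extension: it maps uniquely to every central extension. -/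
structure IsUniversalCentralExtension {H G : C} [GrpObj H] [GrpObj G] (k : H ⟶ G) : Prop where
  isCentralExtension : IsCentralExtension k
  existsUnique_hom : ∀ {X : C} [GrpObj X] (d : X ⟶ G), IsCentralExtension d →
    ∃! f : H ⟶ X, IsMonHom f ∧ f ≫ d = k

/-- `M`, embedded by `i`, is the Schur multiplier of `G`: the kernel of the universal central
extension `k` of `G`. -/
structure IsSchurMultiplier {M H G : C} [GrpObj M] [GrpObj H] [GrpObj G]
    (i : M ⟶ H) (k : H ⟶ G) : Prop where
  isUniversalCentralExtension : IsUniversalCentralExtension k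
  isMonHom : IsMonHom i
  isPullback : IsPullback i (toUnit M) k η[G]

/-- `c` is the homomorphism from `K2e` to the Schur multiplier attached to an orbit `o`:
`⟨x_a(p), x_b(q)⟩ = c(p q)` for all orthogonal roots `a, b` with `(a + b) / 2` in `o`.
Here `⟨g, h⟩` is the commutator of arbitrary preimages of `g` and `h`. -/
structure IsOrbitHom {K St H M K2e : C} [NonUnitalCommRingObj K] [GrpObj St] [GrpObj H]
    [GrpObj M] [NonUnitalCommRingObj K2e] (x : rootsD4 → (K ⟶ St)) (k : H ⟶ St) (i : M ⟶ H)
    (π : K ⟶ K2e) (o : Orbit) (c : K2e ⟶ M) : Prop where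
  map_add : IsAddMulHom c
  commutator_eq : ∀ a b : rootsD4, a.1 ⬝ᵥ b.1 = 0 → halfSum a.1 b.1 ∈ o.roots →
    ∀ {T : C} (p q : T ⟶ K) (g h : T ⟶ H), g ≫ k = p ≫ x a → h ≫ k = q ≫ x b →
      ⁅g, h⁆ = (p * q) ≫ π ≫ c ≫ i

end SteinbergD4

open SteinbergD4

/-!
Lifts to `H` of the relations of the Steinberg group are governed by the commutators
`⟨x_a(p), x_b(q)⟩`. For orthogonal roots these *symbols* are central and bimultiplicative. The
central ambiguity of a lift disappears in a commutator, so the Hall-Witt identity can be applied to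
three root elements: for a chain of type `A₃`, that is for roots `r`, `s`, `d` with `r + s` and
`s + d` roots and `r ⊥ d`, it says that moving a factor `s` from one argument to the other in
`⟨x_{r+s}(·), x_d(·)⟩` has as its defect the symbol of `r + s ⊥ s + d`. Since the same move can be
made in several ways, the symbols of different pairs can be compared. They depend only on the orbit
of `(α + β) / 2` and, by the weak unit, on the product `pq`; they have order two and kill
`(p² - p)(q² - q)`; they agree on `p² - p`; and the product over the three orbits is trivial on
squares.

If the images of the three homomorphisms are divided out, the resulting central extension of the
Steinberg group has trivial symbols. Commutators then give canonical lifts of the root elements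
which satisfy the Steinberg relations, so this extension splits, and universality forces the
Schur multiplier to be the product of the images.

In `K₂ε` an element of the form `p² - p` has square zero, hence `p ↦ p²` factors through the
Boolean quotient and gives the section.
-/

namespace SteinbergD4

section Covers

variable {C : Type u} [Category.{v} C]

theorem exists_lift_of_cover {T' T A B : C} (e : T' ⟶ T) [IsRegularEpi e] (m : A ⟶ B) [Mono m]
    (t : T ⟶ B) (s : T' ⟶ A) (h : s ≫ m = e ≫ t) : ∃ t' : T ⟶ A, t' ≫ m = t :=
  have sq : CommSq s e m t := ⟨h⟩
  ⟨sq.lift, sq.fac_right⟩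

theorem exists_desc_of_cover {X Y Z : C} (f : X ⟶ Y) [IsRegularEpi f] (g : X ⟶ Z)
    (h : ∀ {T : C} (u v : T ⟶ X), u ≫ f = v ≫ f → u ≫ g = v ≫ g) : ∃ d : Y ⟶ Z, f ≫ d = g :=
  ⟨IsRegularEpi.desc f g (h _ _ (IsRegularEpi.w f)), IsRegularEpi.fac f g _⟩

theorem factors_of_cover {T' T X : C} (e : T' ⟶ T) [IsRegularEpi e] {J : Subobject X}
    {a : T ⟶ X} (h : J.Factors (e ≫ a)) : J.Factors a := by
  obtain ⟨t, rfl⟩ := exists_lift_of_cover e J.arrow a (J.factorThru _ h) (by simp)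
  exact Subobject.factors_comp_arrow t

variable [Regular C]

instance isRegularEpi_comp {X Y Z : C} (f : X ⟶ Y) (g : Y ⟶ Z) [IsRegularEpi f]
    [IsRegularEpi g] : IsRegularEpi (f ≫ g) := by
  have : StrongEpi (f ≫ g) := strongEpi_comp f g
  infer_instance

theorem isRegularEpi_of_comp {X Y Z : C} (f : X ⟶ Y) (g : Y ⟶ Z) [IsRegularEpi (f ≫ g)] :
    IsRegularEpi g := by
  have : StrongEpi g := strongEpi_of_strongEpi f g
  infer_instance

theorem exists_local_lift {X Y T : C} (f : X ⟶ Y) [IsRegularEpi f] (y : T ⟶ Y) :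
    ∃ (T' : C) (e : T' ⟶ T) (x : T' ⟶ X), IsRegularEpi e ∧ x ≫ f = e ≫ y :=
  ⟨pullback f y, pullback.snd f y, pullback.fst f y, inferInstance, pullback.condition⟩

theorem isRegularEpi_factorThruImageSubobject {X Y : C} (f : X ⟶ Y) :
    IsRegularEpi (factorThruImageSubobject f) := by
  have : StrongEpi (factorThruImage f ≫ (imageSubobjectIso f).inv) := strongEpi_comp _ _
  rw [factorThruImageSubobject]
  infer_instance

theorem exists_local_lift_of_imageSubobject_factors {X Y T : C} {f : X ⟶ Y} {y : T ⟶ Y}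
    (h : (imageSubobject f).Factors y) :
    ∃ (T' : C) (e : T' ⟶ T) (x : T' ⟶ X), IsRegularEpi e ∧ x ≫ f = e ≫ y := by
  have := isRegularEpi_factorThruImageSubobject f
  obtain ⟨T', e, x, he, hx⟩ :=
    exists_local_lift (factorThruImageSubobject f) (Subobject.factorThru _ y h)
  refine ⟨T', e, x, he, ?_⟩
  simpa only [Category.assoc, imageSubobject_arrow_comp, Subobject.factorThru_arrow] using
    congrArg (· ≫ (imageSubobject f).arrow) hx

theorem exists_local_lift₂ {X Y X' Y' T : C} (f : X ⟶ Y) (g : X' ⟶ Y') [IsRegularEpi f]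
    [IsRegularEpi g] (y : T ⟶ Y) (z : T ⟶ Y') :
    ∃ (T' : C) (e : T' ⟶ T) (a : T' ⟶ X) (b : T' ⟶ X'), IsRegularEpi e ∧
      a ≫ f = e ≫ y ∧ b ≫ g = e ≫ z := by
  obtain ⟨T₁, e₁, a, he₁, ha⟩ := exists_local_lift f y
  obtain ⟨T₂, e₂, b, he₂, hb⟩ := exists_local_lift g (e₁ ≫ z)
  exact ⟨T₂, e₂ ≫ e₁, e₂ ≫ a, b, inferInstance, by simp only [Category.assoc, ha],
    by simp only [Category.assoc, hb]⟩

theorem isRegularEpi_tensorHom [CartesianMonoidalCategory C] {X Y X' Y' : C} (f : X ⟶ Y)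
    (g : X' ⟶ Y') [IsRegularEpi f] [IsRegularEpi g] : IsRegularEpi (f ⊗ₘ g) := by
  obtain ⟨T, e, a, b, he, ha, hb⟩ := exists_local_lift₂ f g (fst Y Y') (snd Y Y')
  have hab : lift a b ≫ (f ⊗ₘ g) = e := by
    apply CartesianMonoidalCategory.hom_ext <;> simp [ha, hb]
  have : IsRegularEpi (lift a b ≫ (f ⊗ₘ g)) := hab ▸ he
  exact isRegularEpi_of_comp (lift a b) _

end Covers

section ExactCategories

/-- Every internal equivalence relation is the kernel pair of its quotient. A regular category with
this property is an exact category. -/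
class HasEffectiveEquivalenceRelations (C : Type u) [Category.{v} C] : Prop where
  isEffective {R X : C} (p₁ p₂ : R ⟶ X) :
    IsEquivalenceRelation p₁ p₂ → IsEffectiveEquivalenceRelation p₁ p₂

/-- Countable coproducts exist and are stable under pullback. -/
class HasUniversalCountableCoproducts (C : Type u) [Category.{v} C] : Prop where
  hasCoproductsOfShape : HasCoproductsOfShape ℕ C
  isUniversalColimit (X : ℕ → C) : IsUniversalColimit (Cofan.mk (∐ X) (Sigma.ι X))

attribute [instance] HasUniversalCountableCoproducts.hasCoproductsOfShape

variable {C : Type u} [Category.{v} C]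

theorem InfinitaryPretopos.hasCoproductsOfShape_nat [InfinitaryPretopos C] :
    HasCoproductsOfShape ℕ C :=
  have := InfinitaryPretopos.hasCoproducts (C := C) (ULift ℕ)
  hasColimitsOfShape_of_equivalence (Discrete.equivalence Equiv.ulift.{v})

instance [InfinitaryPretopos C] : HasUniversalCountableCoproducts C where
  hasCoproductsOfShape := InfinitaryPretopos.hasCoproductsOfShape_nat
  isUniversalColimit X := by
    have := InfinitaryPretopos.hasCoproductsOfShape_nat (C := C)
    let e := Discrete.equivalence (Equiv.ulift.{v} : ULift ℕ ≃ ℕ)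
    let c : Cofan fun n : ULift.{v} ℕ => X n.down := Cofan.mk (∐ X) fun n => Sigma.ι X n.down
    have hc : IsColimit c := (coproductIsCoproduct X).whiskerEquivalence e
    exact (IsUniversalColimit.whiskerEquivalence_iff e).mp
      (InfinitaryPretopos.isVanKampen_coproduct _ c ⟨hc⟩).isUniversal

instance [InfinitaryPretopos C] : HasEffectiveEquivalenceRelations C :=
  ⟨InfinitaryPretopos.isEffective⟩

variable [HasUniversalCountableCoproducts C]

theorem factors_of_forall_pullback_ι [HasPullbacks C] {D : ℕ → C} {T Y : C} (y : T ⟶ ∐ D)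
    {J : Subobject Y} {b : T ⟶ Y} (h : ∀ n, J.Factors (pullback.fst y (Sigma.ι D n) ≫ b)) :
    J.Factors b := by
  let c : Cofan fun n => pullback y (Sigma.ι D n) := Cofan.mk T fun n => pullback.fst y _
  obtain ⟨hc⟩ : Nonempty (IsColimit c) :=
    HasUniversalCountableCoproducts.isUniversalColimit D c
      (Discrete.natTrans fun n => pullback.snd y (Sigma.ι D n.as)) y
      (by ext ⟨n⟩; exact pullback.condition.symm) (NatTrans.Equifibered.of_discrete _)
      fun n => IsPullback.of_hasPullback y (Sigma.ι D n.as)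
  have hb : b = hc.desc (Cofan.mk _ fun n => J.factorThru _ (h n)) ≫ J.arrow :=
    hc.hom_ext fun ⟨n⟩ => by
      rw [hc.fac_assoc]
      exact (J.factorThru_arrow _ (h n)).symm
  rw [hb]
  exact Subobject.factors_comp_arrow _

theorem factors_of_imageSubobject_sigmaDesc_factors [Regular C] {D : ℕ → C} {X Y T : C}
    (φ : ∀ n, D n ⟶ X) {a : T ⟶ X} (ha : (imageSubobject (Sigma.desc φ)).Factors a)
    {J : Subobject Y} {b : T ⟶ Y}
    (h : ∀ {T' : C} (f : T' ⟶ T) (n : ℕ) (y : T' ⟶ D n), y ≫ φ n = f ≫ a → J.Factors (f ≫ b)) :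
    J.Factors b := by
  obtain ⟨T', e, y, he, hy⟩ := exists_local_lift_of_imageSubobject_factors ha
  refine factors_of_cover e (factors_of_forall_pullback_ι y fun n => ?_)
  rw [← Category.assoc]
  refine h _ n (pullback.snd y (Sigma.ι D n)) ?_
  rw [Category.assoc, ← hy, pullback.condition_assoc, Sigma.ι_desc]

end ExactCategories

section WeakUnit

variable {C : Type u} [Category.{v} C] [CartesianMonoidalCategory C] [Regular C]
variable {K : C} [NonUnitalCommRingObj K]

theorem IsWeakUnit.exists_mul {E : C} {j : E ⟶ K} (hj : IsWeakUnit j) {T : C} (p : T ⟶ K) :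
    ∃ (T' : C) (f : T' ⟶ T) (a : T' ⟶ K) (e : T' ⟶ E), IsRegularEpi f ∧
      f ≫ p = a * (e ≫ j) := by
  have := hj.smul_epi
  obtain ⟨T', f, y, hf, hy⟩ := exists_local_lift (fst K E * (snd K E ≫ j)) p
  exact ⟨T', f, y ≫ fst _ _, y ≫ snd _ _, hf, by simp only [← hy, comp_mul_hom, Category.assoc]⟩

theorem IsWeakUnit.exists_common_divisor {E : C} {j : E ⟶ K} (hj : IsWeakUnit j) {T : C}
    (p q : T ⟶ K) : ∃ (T' : C) (f : T' ⟶ T) (a b : T' ⟶ K) (d : T' ⟶ E), IsRegularEpi f ∧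
      f ≫ p = a * (d ≫ j) ∧ f ≫ q = b * (d ≫ j) := by
  obtain ⟨T₁, f₁, a, e, _, hp⟩ := hj.exists_mul p
  obtain ⟨T₂, f₂, b, e', _, hq⟩ := hj.exists_mul (f₁ ≫ q)
  obtain ⟨T₃, f₃, c, c', d, _, hc, hc'⟩ := hj.common_divisor (f₂ ≫ e) e'
  simp only [Category.assoc] at hc
  refine ⟨T₃, f₃ ≫ f₂ ≫ f₁, (f₃ ≫ f₂ ≫ a) * (c ≫ j), (f₃ ≫ b) * (c' ≫ j), d, inferInstance,
    ?_, ?_⟩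
  · simp only [mul_assoc, ← hc, Category.assoc, hp, comp_mul_hom]
  · simp only [mul_assoc, ← hc', Category.assoc, hq, comp_mul_hom]

theorem IsWeakUnit.exists_mul_sq {E : C} {j : E ⟶ K} (hj : IsWeakUnit j) {T : C} (e : T ⟶ E) :
    ∃ (T' : C) (f : T' ⟶ T) (c d : T' ⟶ E), IsRegularEpi f ∧
      f ≫ e ≫ j = (c ≫ j) * ((d ≫ j) * (d ≫ j)) := by
  obtain ⟨m, hm, _⟩ := hj.mul_epi
  obtain ⟨T₁, f₁, y, _, hy⟩ := exists_local_lift m e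
  obtain ⟨T₂, f₂, a, b, d, _, ha, hb⟩ := hj.common_divisor (y ≫ fst _ _) (y ≫ snd _ _)
  simp only [Category.assoc] at ha hb
  refine ⟨T₂, f₂ ≫ f₁, lift a b ≫ m, d, inferInstance, ?_⟩
  have he : (f₂ ≫ f₁) ≫ e ≫ j = f₂ ≫ y ≫ m ≫ j := by
    simp only [Category.assoc, reassoc_of% hy]
  have hab : (lift a b ≫ m) ≫ j = (a ≫ j) * (b ≫ j) := by
    rw [Category.assoc, hm, comp_mul_hom, lift_fst_assoc, lift_snd_assoc]
  rw [he, hab, hm, comp_mul_hom, comp_mul_hom, ha, hb, mul_mul_mul_comm]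

theorem IsWeaklyUnital.exists_pow_eight (hK : IsWeaklyUnital K) {T : C} (p : T ⟶ K) :
    ∃ (T' : C) (f : T' ⟶ T) (a d : T' ⟶ K), IsRegularEpi f ∧
      f ≫ p = a * (((d * d) * (d * d)) * ((d * d) * (d * d))) := by
  obtain ⟨E, j, hj⟩ := hK
  obtain ⟨T₁, f₁, a, d₁, _, hp⟩ := hj.exists_mul p
  obtain ⟨T₂, f₂, c₂, d₂, _, hd₁⟩ := hj.exists_mul_sq d₁
  obtain ⟨T₃, f₃, c₃, d₃, _, hd₂⟩ := hj.exists_mul_sq d₂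
  obtain ⟨T₄, f₄, c₄, d₄, _, hd₃⟩ := hj.exists_mul_sq d₃
  refine ⟨T₄, f₄ ≫ f₃ ≫ f₂ ≫ f₁,
    (f₄ ≫ f₃ ≫ f₂ ≫ a) * (f₄ ≫ f₃ ≫ c₂ ≫ j) * ((f₄ ≫ c₃ ≫ j) * (f₄ ≫ c₃ ≫ j)) *
      (((c₄ ≫ j) * (c₄ ≫ j)) * ((c₄ ≫ j) * (c₄ ≫ j))), d₄ ≫ j, inferInstance, ?_⟩
  simp only [Category.assoc, hp, comp_mul_hom, hd₁, hd₂, hd₃]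
  ac_rfl

theorem IsWeaklyUnital.isRegularEpi_mul (hK : IsWeaklyUnital K) :
    IsRegularEpi (fst K K * snd K K) := by
  obtain ⟨E, j, hj⟩ := hK
  have : IsRegularEpi (lift (fst K E) (snd K E ≫ j) ≫ (fst K K * snd K K)) := by
    simpa only [comp_mul_hom, lift_fst, lift_snd] using hj.smul_epi
  exact isRegularEpi_of_comp (lift (fst K E) (snd K E ≫ j)) _

theorem IsWeaklyUnital.exists_mul (hK : IsWeaklyUnital K) {T : C} (p : T ⟶ K) :
    ∃ (T' : C) (f : T' ⟶ T) (a b : T' ⟶ K), IsRegularEpi f ∧ f ≫ p = a * b := by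
  obtain ⟨T', f, a, d, hf, h⟩ := hK.exists_pow_eight p
  exact ⟨T', f, a, _, hf, h⟩

theorem IsWeaklyUnital.balanced_eq_of_mul_eq (hK : IsWeaklyUnital K) {H : C} {y : K ⊗ K ⟶ H}
    (hy : ∀ {T : C} (a b c : T ⟶ K), lift (a * b) c ≫ y = lift a (b * c) ≫ y) {T : C}
    {a b a' b' : T ⟶ K} (h : a * b = a' * b') : lift a b ≫ y = lift a' b' ≫ y := by
  obtain ⟨E, j, hj⟩ := hK
  obtain ⟨T₁, f, c, c', d, _, hb, hb'⟩ := hj.exists_common_divisor b b'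
  have hd : ((f ≫ a) * c - (f ≫ a') * c') * (d ≫ j) = 0 := by
    rw [sub_mul, mul_assoc, mul_assoc, ← hb, ← hb', ← comp_mul_hom, ← comp_mul_hom, h, sub_self]
  obtain ⟨T₂, g, d', d'', _, hdd, hd'⟩ := hj.annihilator _ d hd
  have move {a b : T ⟶ K} {c : T₁ ⟶ K} (hb : f ≫ b = c * (d ≫ j)) :
      (g ≫ f) ≫ lift a b ≫ y = lift (g ≫ ((f ≫ a) * c) * (d' ≫ j)) (d'' ≫ j) ≫ y := by
    rw [comp_lift_assoc, Category.assoc g f b, hb, comp_mul_hom, hdd, comp_mul_hom, hy, hy,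
      Category.assoc]
  refine (cancel_epi (g ≫ f)).mp ?_
  rw [move hb, move hb']
  congr 2
  rw [← sub_eq_zero, ← sub_mul, ← hd', AddGrpObj.comp_sub]

theorem IsWeaklyUnital.exists_factor_mul (hK : IsWeaklyUnital K) {H : C} (y : K ⊗ K ⟶ H)
    (hy : ∀ {T : C} (a b c : T ⟶ K), lift (a * b) c ≫ y = lift a (b * c) ≫ y) :
    ∃ z : K ⟶ H, ∀ {T : C} (a b : T ⟶ K), (a * b) ≫ z = lift a b ≫ y := by
  have := hK.isRegularEpi_mul
  obtain ⟨z, hz⟩ := exists_desc_of_cover (fst K K * snd K K) y fun u v huv => by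
    have huv' := hK.balanced_eq_of_mul_eq hy (by simpa only [comp_mul_hom] using huv)
    simpa only [← comp_lift_assoc, lift_fst_snd, Category.id_comp] using huv'
  refine ⟨z, fun a b => ?_⟩
  rw [← hz, ← Category.assoc, comp_mul_hom, lift_fst, lift_snd]

theorem IsWeaklyUnital.isAddMulHom_of_factor_mul (hK : IsWeaklyUnital K) {H : C} [GrpObj H]
    {y : K ⊗ K ⟶ H} {z : K ⟶ H} (hz : ∀ {T : C} (a b : T ⟶ K), (a * b) ≫ z = lift a b ≫ y)
    (hy : ∀ {T : C} (a a' b : T ⟶ K), lift (a + a') b ≫ y = (lift a b ≫ y) * (lift a' b ≫ y)) :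
    IsAddMulHom z := by
  intro T p q
  obtain ⟨E, j, hj⟩ := hK
  obtain ⟨T', f, a, b, d, _, hp, hq⟩ := hj.exists_common_divisor p q
  refine (cancel_epi f).mp ?_
  rw [MonObj.comp_mul, ← Category.assoc, ← Category.assoc, ← Category.assoc, AddMonObj.comp_add,
    hp, hq, ← add_mul, hz, hz, hz, hy]

end WeakUnit

section Roots

/-- An enumeration of the roots of type `D4`, by which statements about finitely many roots become
decidable. -/
def rootList : List (Fin 4 → ℤ) :=
  [![1, 1, 0, 0], ![1, -1, 0, 0], ![-1, 1, 0, 0], ![-1, -1, 0, 0],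
   ![1, 0, 1, 0], ![1, 0, -1, 0], ![-1, 0, 1, 0], ![-1, 0, -1, 0],
   ![1, 0, 0, 1], ![1, 0, 0, -1], ![-1, 0, 0, 1], ![-1, 0, 0, -1],
   ![0, 1, 1, 0], ![0, 1, -1, 0], ![0, -1, 1, 0], ![0, -1, -1, 0],
   ![0, 1, 0, 1], ![0, 1, 0, -1], ![0, -1, 0, 1], ![0, -1, 0, -1],
   ![0, 0, 1, 1], ![0, 0, 1, -1], ![0, 0, -1, 1], ![0, 0, -1, -1]]

theorem mem_rootList_iff {w : Fin 4 → ℤ} : w ∈ rootList ↔ w ∈ rootsD4 := by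
  constructor
  · revert w
    change ∀ w ∈ rootList,
      ∃ i j : Fin 4, i < j ∧ ∃ s t : ℤˣ, w = Pi.single i (s : ℤ) + Pi.single j (t : ℤ)
    decide
  · rintro ⟨i, j, hij, s, t, rfl⟩
    revert i j s t
    decide

instance : Fintype rootsD4 :=
  Fintype.subtype ⟨rootList, by decide⟩ fun _ => mem_rootList_iff

theorem mem_rootsD4_iff {w : Fin 4 → ℤ} : w ∈ rootsD4 ↔ w ⬝ᵥ w = 2 := by
  constructor
  · rintro ⟨i, j, hij, s, t, rfl⟩
    revert i j s t
    decide
  · intro h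
    have coord_mem : w ∈ Fintype.piFinset fun _ => Finset.Icc (-1 : ℤ) 1 := by
      refine Fintype.mem_piFinset.mpr fun i => Finset.mem_Icc.mpr ?_
      have : w i * w i ≤ w ⬝ᵥ w :=
        Finset.single_le_sum (fun j _ => mul_self_nonneg (w j)) (Finset.mem_univ i)
      constructor <;> nlinarith
    have key : ∀ w ∈ Fintype.piFinset fun _ : Fin 4 => Finset.Icc (-1 : ℤ) 1,
        w ⬝ᵥ w = 2 → w ∈ rootList := by decide
    exact mem_rootList_iff.mp (key w coord_mem h)

theorem root_norm (a : rootsD4) : a.1 ⬝ᵥ a.1 = 2 := mem_rootsD4_iff.mp a.2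

theorem root_add_norm (a b : rootsD4) : (a.1 + b.1) ⬝ᵥ (a.1 + b.1) = 4 + 2 * (a.1 ⬝ᵥ b.1) := by
  simp only [dotProduct_add, add_dotProduct, root_norm, dotProduct_comm b.1 a.1]
  ring

theorem root_sub_norm (a b : rootsD4) : (a.1 - b.1) ⬝ᵥ (a.1 - b.1) = 4 - 2 * (a.1 ⬝ᵥ b.1) := by
  simp only [dotProduct_sub, sub_dotProduct, root_norm, dotProduct_comm b.1 a.1]
  ring

theorem root_add_mem {a b : rootsD4} (h : a.1 ⬝ᵥ b.1 = -1) : a.1 + b.1 ∈ rootsD4 := by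
  rw [mem_rootsD4_iff, root_add_norm, h]
  rfl

theorem root_sub_mem {a b : rootsD4} (h : a.1 ⬝ᵥ b.1 = 1) : a.1 - b.1 ∈ rootsD4 := by
  rw [mem_rootsD4_iff, root_sub_norm, h]
  rfl

theorem root_dot_of_add {a b c : rootsD4} (h : c.1 = a.1 + b.1) : a.1 ⬝ᵥ b.1 = -1 := by
  have := root_add_norm a b
  rw [← h, root_norm] at this
  omega

theorem root_add_not_mem {a b : rootsD4} (h : 0 ≤ a.1 ⬝ᵥ b.1) : a.1 + b.1 ∉ rootsD4 := by
  rw [mem_rootsD4_iff, root_add_norm]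
  omega

theorem root_add_ne_zero {a b : rootsD4} (h : 0 ≤ a.1 ⬝ᵥ b.1) : a.1 + b.1 ≠ 0 := fun hab => by
  have := root_add_norm a b
  rw [hab, dotProduct_zero] at this
  omega

theorem root_neg_mem (a : rootsD4) : -a.1 ∈ rootsD4 := by
  rw [mem_rootsD4_iff, neg_dotProduct_neg, root_norm]

/-- The opposite of a root. -/
def rootNeg (a : rootsD4) : rootsD4 := ⟨-a.1, root_neg_mem a⟩

theorem root_dot_rootNeg (a b : rootsD4) : a.1 ⬝ᵥ (rootNeg b).1 = -(a.1 ⬝ᵥ b.1) :=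
  dotProduct_neg _ _

theorem root_eq_of_dot {a b : rootsD4} (h : a.1 ⬝ᵥ b.1 = 2) : a = b := by
  have : (a.1 - b.1) ⬝ᵥ (a.1 - b.1) = 0 := by rw [root_sub_norm, h]; rfl
  exact Subtype.ext (sub_eq_zero.mp (dotProduct_self_eq_zero.mp this))

theorem root_add_eq_zero {a b : rootsD4} (h : a.1 ⬝ᵥ b.1 = -2) : a.1 + b.1 = 0 := by
  have : a = rootNeg b := root_eq_of_dot (by rw [root_dot_rootNeg, h, neg_neg])
  rw [this]
  exact neg_add_cancel _

theorem root_dot_le (a b : rootsD4) : a.1 ⬝ᵥ b.1 ≤ 2 := by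
  have := root_sub_norm a b
  have : 0 ≤ (a.1 - b.1) ⬝ᵥ (a.1 - b.1) := Finset.sum_nonneg fun i _ => mul_self_nonneg _
  omega

theorem neg_two_le_root_dot (a b : rootsD4) : -2 ≤ a.1 ⬝ᵥ b.1 := by
  have := root_dot_le a (rootNeg b)
  rw [root_dot_rootNeg] at this
  omega

set_option maxRecDepth 10000 in
theorem exists_root_dot_one_one :
    ∀ {a b : rootsD4}, a.1 ⬝ᵥ b.1 = 0 → ∃ c : rootsD4, c.1 ⬝ᵥ a.1 = 1 ∧ c.1 ⬝ᵥ b.1 = 1 := by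
  decide

set_option maxRecDepth 10000 in
theorem exists_root_dot_zero_one :
    ∀ {a b : rootsD4}, a.1 ⬝ᵥ b.1 = -1 → ∃ c : rootsD4, a.1 ⬝ᵥ c.1 = 0 ∧ b.1 ⬝ᵥ c.1 = 1 := by
  decide

/-- The positive roots of a subsystem of type `A3` with simple roots `r`, `s`, `d`, except the
highest one: `r` and `d` are orthogonal, `g = r + s` and `t = s + d`. -/
structure IsA3Chain (r s d g t : rootsD4) : Prop where
  dot_eq_zero : r.1 ⬝ᵥ d.1 = 0
  left_eq : g.1 = r.1 + s.1
  right_eq : t.1 = s.1 + d.1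

namespace IsA3Chain

variable {r s d g t : rootsD4}

theorem dot_rs (hc : IsA3Chain r s d g t) : r.1 ⬝ᵥ s.1 = -1 := root_dot_of_add hc.left_eq

theorem dot_sd (hc : IsA3Chain r s d g t) : s.1 ⬝ᵥ d.1 = -1 := root_dot_of_add hc.right_eq

theorem dot_rt (hc : IsA3Chain r s d g t) : r.1 ⬝ᵥ t.1 = -1 := by
  rw [hc.right_eq, dotProduct_add, hc.dot_rs, hc.dot_eq_zero, add_zero]

theorem dot_gd (hc : IsA3Chain r s d g t) : g.1 ⬝ᵥ d.1 = -1 := by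
  rw [hc.left_eq, add_dotProduct, hc.dot_eq_zero, hc.dot_sd, zero_add]

theorem dot_gt (hc : IsA3Chain r s d g t) : g.1 ⬝ᵥ t.1 = 0 := by
  rw [hc.left_eq, add_dotProduct, hc.dot_rt, hc.right_eq, dotProduct_add, root_norm, hc.dot_sd]
  rfl

theorem reverse (hc : IsA3Chain r s d g t) : IsA3Chain g (rootNeg s) t r d where
  dot_eq_zero := hc.dot_gt
  left_eq := by rw [hc.left_eq, rootNeg, add_neg_cancel_right]
  right_eq := by rw [hc.right_eq, rootNeg, neg_add_cancel_left]

end IsA3Chain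

theorem exists_isA3Chain_of_dot_eq_zero {g t : rootsD4} (h : g.1 ⬝ᵥ t.1 = 0) :
    ∃ r s d, IsA3Chain r s d g t := by
  obtain ⟨s, hsg, hst⟩ := exists_root_dot_one_one h
  rw [dotProduct_comm] at hsg hst
  refine ⟨⟨_, root_sub_mem hsg⟩, s, ⟨_, root_sub_mem hst⟩, ?_, by simp, by simp⟩
  simp only [dotProduct_sub, sub_dotProduct, h, hsg, dotProduct_comm s.1 t.1, hst, root_norm]
  rfl

theorem exists_isA3Chain_add_eq {a b : rootsD4} (h : a.1 ⬝ᵥ b.1 = 0) :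
    ∃ r d g t, IsA3Chain r b d g t ∧ g.1 + t.1 = a.1 + b.1 ∧ r.1 + d.1 = a.1 + (rootNeg b).1 := by
  obtain ⟨r, hra, hrb⟩ := exists_root_dot_one_one (a := a) (b := rootNeg b)
    (by rw [root_dot_rootNeg, h, neg_zero])
  rw [root_dot_rootNeg, neg_eq_iff_eq_neg] at hrb
  let t : rootsD4 := ⟨_, root_sub_mem (a := a) (b := r) (by rw [dotProduct_comm, hra])⟩
  have htb : t.1 ⬝ᵥ b.1 = 1 := by
    rw [sub_dotProduct, h, hrb]
    rfl
  refine ⟨r, ⟨_, root_sub_mem htb⟩, ⟨_, root_add_mem hrb⟩, t, ⟨?_, rfl, ?_⟩, ?_, ?_⟩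
  · simp only [t, dotProduct_sub, hra, root_norm, hrb]
    rfl
  · exact (add_sub_cancel _ _).symm
  · simp only [t]
    abel
  · simp only [t, rootNeg]
    abel

theorem exists_isA3Chain_of_dot_eq_neg_one {r t : rootsD4} (h : r.1 ⬝ᵥ t.1 = -1) :
    ∃ s d g, IsA3Chain r s d g t := by
  obtain ⟨d, hrd, htd⟩ := exists_root_dot_zero_one h
  let s : rootsD4 := ⟨_, root_sub_mem htd⟩
  have hrs : r.1 ⬝ᵥ s.1 = -1 := by rw [dotProduct_sub, h, hrd, sub_zero]
  exact ⟨s, d, ⟨_, root_add_mem hrs⟩, hrd, rfl, (sub_add_cancel _ _).symm⟩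

theorem exists_root_decomposition {a b : rootsD4} (h : 0 < a.1 ⬝ᵥ b.1) :
    ∃ c d : rootsD4, a.1 = c.1 + d.1 ∧ 0 ≤ c.1 ⬝ᵥ b.1 ∧ 0 ≤ d.1 ⬝ᵥ b.1 := by
  have key : ∀ a b : rootsD4, 0 < a.1 ⬝ᵥ b.1 →
      ∃ c : rootsD4, a.1 ⬝ᵥ c.1 = 1 ∧ 0 ≤ c.1 ⬝ᵥ b.1 ∧ 0 ≤ (a.1 - c.1) ⬝ᵥ b.1 := by
    set_option maxRecDepth 10000 in decide
  obtain ⟨c, hac, hc, hd⟩ := key a b h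
  exact ⟨c, ⟨_, root_sub_mem hac⟩, (add_sub_cancel _ _).symm, hc, hd⟩

end Roots

section Orbits

theorem halfSum_mem_zero_iff {a b : Fin 4 → ℤ} :
    halfSum a b ∈ Orbit.zero.roots ↔ ∃ (i : Fin 4) (s : ℤˣ), a + b = Pi.single i (2 * (s : ℤ)) := by
  refine exists₂_congr fun i s => ?_
  simp only [funext_iff, halfSum, Pi.add_apply]
  refine forall_congr' fun k => ?_
  rcases eq_or_ne k i with rfl | hk
  · rw [Pi.single_eq_same, Pi.single_eq_same, div_eq_iff two_ne_zero, mul_comm]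
    norm_cast
  · rw [Pi.single_eq_of_ne hk, Pi.single_eq_of_ne hk, div_eq_zero_iff, or_iff_left two_ne_zero]
    norm_cast

theorem halfSum_eq_iff {a b s : Fin 4 → ℤ} :
    (halfSum a b = fun i => (s i : ℚ) / 2) ↔ a + b = s := by
  simp only [funext_iff, halfSum, Pi.add_apply, div_left_inj' (two_ne_zero' ℚ), Int.cast_inj]

theorem halfSum_mem_plus_iff {a b : Fin 4 → ℤ} :
    halfSum a b ∈ Orbit.plus.roots ↔
      ∃ s : Fin 4 → ℤˣ, ∏ i, s i = 1 ∧ a + b = fun i => (s i : ℤ) :=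
  exists_congr fun _ => and_congr_right' halfSum_eq_iff

theorem halfSum_mem_minus_iff {a b : Fin 4 → ℤ} :
    halfSum a b ∈ Orbit.minus.roots ↔
      ∃ s : Fin 4 → ℤˣ, ∏ i, s i = -1 ∧ a + b = fun i => (s i : ℤ) :=
  exists_congr fun _ => and_congr_right' halfSum_eq_iff

instance (o : Orbit) (a b : Fin 4 → ℤ) : Decidable (halfSum a b ∈ o.roots) :=
  match o with
  | .zero => decidable_of_iff _ halfSum_mem_zero_iff.symm
  | .plus => decidable_of_iff _ halfSum_mem_plus_iff.symm
  | .minus => decidable_of_iff _ halfSum_mem_minus_iff.symm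

theorem exists_orbit {a b : rootsD4} (h : a.1 ⬝ᵥ b.1 = 0) :
    ∃ o : Orbit, halfSum a.1 b.1 ∈ o.roots := by
  have key : ∀ a b : rootsD4, a.1 ⬝ᵥ b.1 = 0 → halfSum a.1 b.1 ∈ Orbit.zero.roots ∨
      halfSum a.1 b.1 ∈ Orbit.plus.roots ∨ halfSum a.1 b.1 ∈ Orbit.minus.roots := by
    set_option maxRecDepth 10000 in decide
  rcases key a b h with h | h | h
  exacts [⟨_, h⟩, ⟨_, h⟩, ⟨_, h⟩]

theorem sum_eq_or_neg_or_orthogonal_of_mem_orbit {o : Orbit} {a b a' b' : Fin 4 → ℤ}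
    (h : halfSum a b ∈ o.roots) (h' : halfSum a' b' ∈ o.roots) :
    a + b = a' + b' ∨ a + b = -(a' + b') ∨
      (a + b) ⬝ᵥ (a' + b') = 0 ∧ ∀ i, 2 ∣ (a + b) i + (a' + b') i := by
  cases o with
  | zero =>
    obtain ⟨i, s, hs⟩ := halfSum_mem_zero_iff.mp h
    obtain ⟨j, t, ht⟩ := halfSum_mem_zero_iff.mp h'
    rw [hs, ht]
    clear hs ht
    revert i j s t
    decide
  | plus =>
    obtain ⟨s, hs, hab⟩ := halfSum_mem_plus_iff.mp h
    obtain ⟨t, ht, hab'⟩ := halfSum_mem_plus_iff.mp h'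
    rw [hab, hab']
    clear hab hab'
    revert s t
    decide
  | minus =>
    obtain ⟨s, hs, hab⟩ := halfSum_mem_minus_iff.mp h
    obtain ⟨t, ht, hab'⟩ := halfSum_mem_minus_iff.mp h'
    rw [hab, hab']
    clear hab hab'
    revert s t
    decide

variable {X : Type*} {F : rootsD4 → rootsD4 → X}

theorem eq_of_sum_orthogonal
    (of_sum_eq : ∀ {a b a' b' : rootsD4}, a.1 ⬝ᵥ b.1 = 0 → a'.1 ⬝ᵥ b'.1 = 0 →
      a.1 + b.1 = a'.1 + b'.1 → F a b = F a' b')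
    (neg_right : ∀ {a b : rootsD4}, a.1 ⬝ᵥ b.1 = 0 → F a b = F a (rootNeg b))
    {a b a' b' : rootsD4} (h : a.1 ⬝ᵥ b.1 = 0) (h' : a'.1 ⬝ᵥ b'.1 = 0)
    (horth : (a.1 + b.1) ⬝ᵥ (a'.1 + b'.1) = 0)
    (hdvd : ∀ i, 2 ∣ (a.1 + b.1) i + (a'.1 + b'.1) i) : F a b = F a' b' := by
  -- The half sum `g` and the half difference `d` of `a + b` and `a' + b'` are orthogonal roots with
  -- `g + d = a + b` and `g - d = a' + b'`.
  choose g hg using hdvd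
  have hv := root_add_norm a b
  have hv' := root_add_norm a' b'
  rw [h, mul_zero, add_zero] at hv
  rw [h', mul_zero, add_zero] at hv'
  generalize hab : a.1 + b.1 = v at *
  generalize hab' : a'.1 + b'.1 = v' at *
  obtain rfl : v' = (2 : ℤ) • g - v := eq_sub_of_add_eq' (funext hg)
  simp only [dotProduct_sub, sub_dotProduct, smul_dotProduct, dotProduct_smul, smul_eq_mul,
    dotProduct_comm g v, hv] at horth hv'
  have hgg : g ⬝ᵥ g = 2 := by omega
  have hvg : v ⬝ᵥ g = 2 := by omega
  have hdd : (v - g) ⬝ᵥ (v - g) = 2 := by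
    rw [sub_dotProduct, dotProduct_sub, dotProduct_sub, dotProduct_comm g v, hv, hvg, hgg]
    norm_num
  have hgd : g ⬝ᵥ (v - g) = 0 := by rw [dotProduct_sub, dotProduct_comm, hvg, hgg, sub_self]
  let r : rootsD4 := ⟨g, mem_rootsD4_iff.mpr hgg⟩
  let s : rootsD4 := ⟨v - g, mem_rootsD4_iff.mpr hdd⟩
  calc F a b = F r s := of_sum_eq h hgd (hab.trans (add_sub_cancel g v).symm)
    _ = F r (rootNeg s) := neg_right hgd
    _ = F a' b' := of_sum_eq (by rw [root_dot_rootNeg, hgd, neg_zero]) h' <| by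
      rw [hab', two_smul]
      simp only [r, s, rootNeg]
      abel

theorem eq_of_mem_orbit
    (of_sum_eq : ∀ {a b a' b' : rootsD4}, a.1 ⬝ᵥ b.1 = 0 → a'.1 ⬝ᵥ b'.1 = 0 →
      a.1 + b.1 = a'.1 + b'.1 → F a b = F a' b')
    (neg_right : ∀ {a b : rootsD4}, a.1 ⬝ᵥ b.1 = 0 → F a b = F a (rootNeg b))
    {o : Orbit} {a b a' b' : rootsD4} (h : a.1 ⬝ᵥ b.1 = 0) (h' : a'.1 ⬝ᵥ b'.1 = 0)
    (ho : halfSum a.1 b.1 ∈ o.roots) (ho' : halfSum a'.1 b'.1 ∈ o.roots) : F a b = F a' b' := by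
  rcases sum_eq_or_neg_or_orthogonal_of_mem_orbit ho ho' with heq | hneg | ⟨horth, hdvd⟩
  · exact of_sum_eq h h' heq
  · have hab : a.1 ⬝ᵥ (rootNeg b).1 = 0 := by rw [root_dot_rootNeg, h, neg_zero]
    rw [neg_right h]
    refine eq_of_sum_orthogonal of_sum_eq neg_right hab h' ?_ fun i => ?_
    · rw [← neg_eq_iff_eq_neg.mpr hneg]
      simp only [rootNeg, dotProduct_neg, dotProduct_add, add_dotProduct, neg_dotProduct,
        root_norm, dotProduct_comm b.1 a.1, h]
      rfl
    · have := congrFun hneg i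
      simp only [rootNeg, Pi.add_apply, Pi.neg_apply] at this ⊢
      omega
  · exact eq_of_sum_orthogonal of_sum_eq neg_right h h' horth hdvd

theorem eq_of_sum_eq
    (symm : ∀ {a b : rootsD4}, a.1 ⬝ᵥ b.1 = 0 → F a b = F b a)
    (move : ∀ {a b a' b' c : rootsD4}, a.1 ⬝ᵥ b.1 = 0 → a.1 = a'.1 + c.1 → b'.1 = c.1 + b.1 →
      a'.1 ⬝ᵥ b.1 = 1 → F a b = F a' b')
    {a b a' b' : rootsD4} (h : a.1 ⬝ᵥ b.1 = 0) (h' : a'.1 ⬝ᵥ b'.1 = 0)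
    (hsum : a.1 + b.1 = a'.1 + b'.1) : F a b = F a' b' := by
  have hdot : a.1 ⬝ᵥ a'.1 + a'.1 ⬝ᵥ b.1 = 2 := by
    rw [dotProduct_comm, ← dotProduct_add, hsum, dotProduct_add, root_norm, h', add_zero]
  have := root_dot_le a a'
  have := root_dot_le a' b
  obtain haa' | haa' | haa' : a.1 ⬝ᵥ a'.1 = 0 ∨ a.1 ⬝ᵥ a'.1 = 1 ∨ a.1 ⬝ᵥ a'.1 = 2 := by omega
  · obtain rfl : a' = b := root_eq_of_dot (by omega)
    obtain rfl : a = b' := Subtype.ext (add_right_cancel (hsum.trans (add_comm _ _)))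
    exact symm h
  · have hb' : b'.1 = a.1 - a'.1 + b.1 := by rw [sub_add_eq_add_sub, hsum, add_sub_cancel_left]
    exact move (c := ⟨_, root_sub_mem haa'⟩) h (by simp) hb' (by omega)
  · obtain rfl : a = a' := root_eq_of_dot haa'
    obtain rfl : b = b' := Subtype.ext (add_left_cancel hsum)
    rfl

end Orbits

section Decompositions

theorem eq_of_decomposition_of_dot_eq_one {X : Type*} {F : rootsD4 → rootsD4 → X}
    (hF : ∀ {r s d g t : rootsD4}, IsA3Chain r s d g t → F r t = F g d)
    {a b a' b' : rootsD4} (h : a.1 + b.1 = a'.1 + b'.1) (hab : a.1 ⬝ᵥ b.1 = -1)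
    (ha : a'.1 ⬝ᵥ a.1 = 1) : F a b = F a' b' := by
  have ha' : a'.1 = a.1 + (a'.1 - a.1) := (add_sub_cancel _ _).symm
  have hb : b.1 = a'.1 - a.1 + b'.1 := by rw [sub_add_eq_add_sub, ← h, add_sub_cancel_left]
  refine hF (s := ⟨_, root_sub_mem ha⟩) ⟨?_, ha', hb⟩
  have hb' : b'.1 = a.1 + b.1 - a'.1 := by rw [h, add_sub_cancel_left]
  rw [hb', dotProduct_sub, dotProduct_add, root_norm, hab, dotProduct_comm, ha]
  rfl

/-- Two decompositions of a root are linked by moving a root from one summand to the other one,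
possibly after exchanging the summands. -/
theorem eq_of_decomposition {X : Type*} {F : rootsD4 → rootsD4 → X}
    (hswap : ∀ {a b : rootsD4}, a.1 ⬝ᵥ b.1 = -1 → F a b = F b a)
    (hF : ∀ {r s d g t : rootsD4}, IsA3Chain r s d g t → F r t = F g d)
    {a b a' b' c : rootsD4} (h : c.1 = a.1 + b.1) (h' : c.1 = a'.1 + b'.1) :
    F a b = F a' b' := by
  have hab := root_dot_of_add h
  have hsum : a.1 + b.1 = a'.1 + b'.1 := h.symm.trans h'
  have hdot : a'.1 ⬝ᵥ a.1 + a'.1 ⬝ᵥ b.1 = 1 := by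
    rw [← dotProduct_add, hsum, dotProduct_add, root_norm, root_dot_of_add h']
    rfl
  have ha := root_dot_le a' a
  have hb := root_dot_le a' b
  obtain ha | ha | hb | hb : a'.1 ⬝ᵥ a.1 = 2 ∨ a'.1 ⬝ᵥ a.1 = 1 ∨ a'.1 ⬝ᵥ b.1 = 1 ∨
      a'.1 ⬝ᵥ b.1 = 2 := by omega
  · obtain rfl := root_eq_of_dot ha
    rw [Subtype.ext (add_left_cancel hsum)]
  · exact eq_of_decomposition_of_dot_eq_one hF hsum hab ha
  · rw [hswap hab]
    exact eq_of_decomposition_of_dot_eq_one hF (by rw [add_comm, hsum])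
      (by rw [dotProduct_comm, hab]) hb
  · obtain rfl := root_eq_of_dot hb
    rw [hswap hab, Subtype.ext (add_left_cancel ((add_comm _ _).trans hsum))]

theorem exists_eq_root_add (c : rootsD4) : ∃ a b : rootsD4, c.1 = a.1 + b.1 := by
  obtain ⟨a, b, h, -⟩ := exists_root_decomposition (a := c) (b := c) (by rw [root_norm]; norm_num)
  exact ⟨a, b, h⟩

end Decompositions

section StructureConstants

theorem weight_dot_self : ∀ i : Fin 4 × ℤˣ, weight i ⬝ᵥ weight i = 1 := by decide

theorem eq_of_weight_dot_eq_one :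
    ∀ {i j : Fin 4 × ℤˣ}, weight i ⬝ᵥ weight j = 1 → i = j := by
  decide

theorem eq_neg_of_weight_dot_eq_neg_one :
    ∀ {i j : Fin 4 × ℤˣ}, weight i ⬝ᵥ weight j = -1 → j = (i.1, -i.2) := by
  decide

theorem weight_injective : Function.Injective weight := fun i j h =>
  eq_of_weight_dot_eq_one (by rw [← h, weight_dot_self])

theorem weight_sub_norm (i j : Fin 4 × ℤˣ) :
    (weight i - weight j) ⬝ᵥ (weight i - weight j) = 2 - 2 * (weight i ⬝ᵥ weight j) := by
  simp only [dotProduct_sub, sub_dotProduct, weight_dot_self, dotProduct_comm (weight j)]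
  ring

theorem exists_weight_sub (a : rootsD4) : ∃ i j, weight i - weight j = a.1 := by
  obtain ⟨i, j, -, s, t, h⟩ := a.2
  refine ⟨(i, s), (j, -t), ?_⟩
  rw [h]
  simp [weight, Pi.single_neg]

theorem weight_dot_root_le : ∀ (i : Fin 4 × ℤˣ) (a : rootsD4), weight i ⬝ᵥ a.1 ≤ 1 := by
  decide

theorem exists_weight_sub_of_dot_eq_one :
    ∀ {i : Fin 4 × ℤˣ} {a : rootsD4}, weight i ⬝ᵥ a.1 = 1 → ∃ k, weight i - weight k = a.1 := by
  decide

theorem weight_dot_of_sub {i k : Fin 4 × ℤˣ} {a : rootsD4} (h : weight i - weight k = a.1) :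
    weight i ⬝ᵥ a.1 = 1 := by
  have hnorm := weight_sub_norm i k
  rw [h, root_norm] at hnorm
  rw [← h, dotProduct_sub, weight_dot_self]
  omega

variable {X Y : Matrix (Fin 4 × ℤˣ) (Fin 4 × ℤˣ) ℤ}

theorem IsRootVector.isUnit_apply {a : Fin 4 → ℤ} (hX : IsRootVector a X) {i j : Fin 4 × ℤˣ}
    (h : weight i - weight j = a) : IsUnit (X i j) :=
  Int.isUnit_iff.mpr (hX.eq_unit i j h)

theorem IsRootVector.smul_injective {a : rootsD4} (hX : IsRootVector a.1 X) {m n : ℤ}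
    (h : m • X = n • X) : m = n := by
  obtain ⟨i, j, hij⟩ := exists_weight_sub a
  exact (hX.isUnit_apply hij).mul_right_cancel (congrFun (congrFun h i) j)

theorem IsRootVector.isUnit_mul_apply {a b : Fin 4 → ℤ} (hX : IsRootVector a X)
    (hY : IsRootVector b Y) {i j k : Fin 4 × ℤˣ} (hik : weight i - weight k = a)
    (hkj : weight k - weight j = b) : IsUnit ((X * Y) i j) := by
  have : (X * Y) i j = X i k * Y k j := by
    refine (Matrix.mul_apply).trans (Fintype.sum_eq_single k fun l hl => ?_)
    have hil : weight i - weight l ≠ a := fun h =>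
      hl (weight_injective (sub_right_injective (h.trans hik.symm)))
    rw [hX.eq_zero i l hil, zero_mul]
  rw [this]
  exact (hX.isUnit_apply hik).mul (hY.isUnit_apply hkj)

theorem IsRootVector.mul_apply_eq_zero {a : rootsD4} (hX : IsRootVector a.1 X)
    {i j : Fin 4 × ℤˣ} (h : weight i ⬝ᵥ a.1 ≠ 1) : (X * Y) i j = 0 := by
  rw [Matrix.mul_apply]
  refine Finset.sum_eq_zero fun k _ => ?_
  rw [hX.eq_zero i k fun hk => h (weight_dot_of_sub hk), zero_mul]

theorem IsRootVector.isUnit_commutator_apply {a b : rootsD4} (hX : IsRootVector a.1 X)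
    (hY : IsRootVector b.1 Y) {i j : Fin 4 × ℤˣ} (hab : a.1 ⬝ᵥ b.1 = -1)
    (hij : weight i - weight j = a.1 + b.1) : IsUnit ((X * Y - Y * X) i j) := by
  have hsum := weight_dot_of_sub (a := ⟨_, root_add_mem hab⟩) hij
  rw [dotProduct_add] at hsum
  have hia := weight_dot_root_le i a
  have hib := weight_dot_root_le i b
  rw [Matrix.sub_apply]
  by_cases h : weight i ⬝ᵥ a.1 = 1
  · obtain ⟨k, hk⟩ := exists_weight_sub_of_dot_eq_one h
    have hkj : weight k - weight j = b.1 := by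
      rw [← sub_sub_sub_cancel_left _ _ (weight i), hij, hk, add_sub_cancel_left]
    rw [hY.mul_apply_eq_zero (by omega), sub_zero]
    exact hX.isUnit_mul_apply hY hk hkj
  · obtain ⟨k, hk⟩ := exists_weight_sub_of_dot_eq_one (i := i) (a := b) (by omega)
    have hkj : weight k - weight j = a.1 := by
      rw [← sub_sub_sub_cancel_left _ _ (weight i), hij, hk, add_sub_cancel_right]
    rw [hX.mul_apply_eq_zero h, zero_sub]
    exact (hY.isUnit_mul_apply hX hk hkj).neg

theorem IsRootVector.eq_neg_of_mul_apply_ne_zero {a b : rootsD4} (hX : IsRootVector a.1 X)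
    (hY : IsRootVector b.1 Y) (hab : a.1 ⬝ᵥ b.1 = 0) {i j : Fin 4 × ℤˣ}
    (h : (X * Y) i j ≠ 0) : j = (i.1, -i.2) := by
  rw [Matrix.mul_apply] at h
  obtain ⟨k, -, hk⟩ := Finset.exists_ne_zero_of_sum_ne_zero h
  have hik : weight i - weight k = a.1 := of_not_not (hk <| by rw [hX.eq_zero i k ·, zero_mul])
  have hkj : weight k - weight j = b.1 := of_not_not (hk <| by rw [hY.eq_zero k j ·, mul_zero])
  have hnorm := root_add_norm a b
  rw [← hik, ← hkj, sub_add_sub_cancel, weight_sub_norm, hik, hkj, hab] at hnorm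
  exact eq_neg_of_weight_dot_eq_neg_one (by omega)

theorem IsRootVector.mul_apply_neg_comm {a b : Fin 4 → ℤ} (hX : IsRootVector a X)
    (hY : IsRootVector b Y) (i : Fin 4 × ℤˣ) :
    (X * Y) i (i.1, -i.2) = (Y * X) i (i.1, -i.2) := by
  rw [Matrix.mul_apply, Matrix.mul_apply]
  refine Fintype.sum_equiv (Equiv.prodCongr (Equiv.refl _) (Equiv.neg ℤˣ)) _ _ fun k => ?_
  have hY' := hY.skew k (i.1, -i.2)
  rw [neg_neg] at hY'
  change X i k * Y k (i.1, -i.2) = Y (i.1, i.2) (k.1, -k.2) * X (k.1, -k.2) (i.1, -i.2)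
  rw [hX.skew i k, hY']
  ring

theorem IsRootVector.commute {a b : rootsD4} (hX : IsRootVector a.1 X) (hY : IsRootVector b.1 Y)
    (hab : a.1 ⬝ᵥ b.1 = 0) : X * Y = Y * X := by
  ext i j
  by_cases hj : j = (i.1, -i.2)
  · rw [hj, hX.mul_apply_neg_comm hY]
  · rw [of_not_not (mt (hX.eq_neg_of_mul_apply_ne_zero hY hab) hj),
      of_not_not (mt (hY.eq_neg_of_mul_apply_ne_zero hX (by rw [dotProduct_comm, hab])) hj)]

/-- The identities between structure constants on which the computations in Steinberg groups
rest. -/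
structure IsSignSystem (N : rootsD4 → rootsD4 → ℤ) : Prop where
  sq : ∀ {a b : rootsD4}, a.1 ⬝ᵥ b.1 = -1 → N a b * N a b = 1
  antisymm : ∀ {a b : rootsD4}, a.1 ⬝ᵥ b.1 = -1 → N b a = -N a b
  jacobi : ∀ {r s d g t : rootsD4}, IsA3Chain r s d g t → N r s * N g d = N s d * N r t

theorem IsStructureConstants.isSignSystem {N : rootsD4 → rootsD4 → ℤ}
    (hN : IsStructureConstants N) : IsSignSystem N := by
  obtain ⟨X, hX, hcomm⟩ := hN
  refine ⟨fun {a b} hab => ?_, fun {a b} hab => ?_, fun {r s d g t} hc => ?_⟩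
  · let c : rootsD4 := ⟨_, root_add_mem hab⟩
    obtain ⟨i, j, hij⟩ := exists_weight_sub c
    have hunit := (hX a).isUnit_commutator_apply (hX b) hab hij
    rw [hcomm a b c rfl, Matrix.smul_apply, smul_eq_mul] at hunit
    exact Int.isUnit_mul_self (isUnit_of_mul_isUnit_left hunit)
  · let c : rootsD4 := ⟨_, root_add_mem hab⟩
    refine (hX c).smul_injective ?_
    rw [neg_smul, ← hcomm a b c rfl, ← hcomm b a c (add_comm _ _), neg_sub]
  · let a : rootsD4 := ⟨_, root_add_mem hc.dot_gd⟩
    have ha : a.1 = r.1 + t.1 := by simp only [a, hc.left_eq, hc.right_eq, add_assoc]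
    refine (hX a).smul_injective ?_
    have hrd := (hX r).commute (hX d) hc.dot_eq_zero
    calc (N r s * N g d) • X a = (N r s • X g) * X d - X d * (N r s • X g) := by
          rw [mul_smul, ← hcomm g d a rfl, smul_sub, smul_mul_assoc, mul_smul_comm]
      _ = X r * (N s d • X t) - (N s d • X t) * X r := by
          rw [← hcomm r s g hc.left_eq, ← hcomm s d t hc.right_eq]
          simp only [sub_mul, mul_sub, mul_assoc, hrd]
          simp only [← mul_assoc, hrd]
          abel
      _ = (N s d * N r t) • X a := by
          rw [mul_smul, ← hcomm r t a ha, smul_sub, smul_mul_assoc, mul_smul_comm]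

end StructureConstants

section Defect

variable {R H : Type*} [NonUnitalCommRing R] [Group H]

/-- The homomorphisms `P` from an additive group to the subgroup of the central elements of order
at most two. -/
structure IsCentralInvolutive {A : Type*} [AddGroup A] (P : A → H) : Prop where
  map_add : ∀ p q, P (p + q) = P p * P q
  mul_self : ∀ p, P p * P p = 1
  central : ∀ p z, Commute (P p) z

/-- The functions `f` and `f'` on pairs agree, up to the correction `P`, after a factor is moved
from the second argument to the first one. -/
def HasDefect (f f' : R → R → H) (P : R → H) : Prop :=
  ∀ a b c, f a (b * c) = f' (a * b) c * P (a * b * (b * c))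

namespace IsCentralInvolutive

variable {A : Type*} [AddGroup A] {P Q : A → H}

theorem map_neg (hP : IsCentralInvolutive P) (p : A) : P (-p) = P p := by
  have hzero : P 0 = 1 := by rw [← mul_eq_left (a := P 0), ← hP.map_add, add_zero]
  refine mul_right_cancel (b := P p) ?_
  rw [← hP.map_add, neg_add_cancel, hzero, hP.mul_self]

theorem map_sub (hP : IsCentralInvolutive P) (p q : A) : P (p - q) = P p * P q := by
  rw [sub_eq_add_neg, hP.map_add, hP.map_neg]

theorem map_sub_eq_one (hP : IsCentralInvolutive P) {p q : A} (h : P p = P q) :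
    P (p - q) = 1 := by
  rw [hP.map_sub, h, hP.mul_self]

theorem map_zsmul (hP : IsCentralInvolutive P) {n : ℤ} (hn : n * n = 1) (p : A) :
    P (n • p) = P p := by
  rcases mul_self_eq_one_iff.mp hn with rfl | rfl
  · rw [one_zsmul]
  · rw [neg_one_zsmul, hP.map_neg]

theorem eq_of_mul_eq_one (hP : IsCentralInvolutive P) {p : A} {z : H} (h : P p * z = 1) :
    P p = z :=
  mul_left_cancel ((hP.mul_self p).trans h.symm)

theorem mul_mul_self (hP : IsCentralInvolutive P) (hQ : IsCentralInvolutive Q) (p q : A) :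
    P p * Q q * (P p * Q q) = 1 := by
  rw [(hQ.central q _).mul_mul_mul_comm, hP.mul_self, hQ.mul_self, one_mul]

end IsCentralInvolutive

namespace HasDefect

variable {f f' : R → R → H} {P Q : R → H}

theorem comp (hQ : HasDefect f f' Q) (hP : HasDefect f' f P) (a x y c : R) :
    f a (x * (y * c)) =
      f (a * x * y) c * (P (a * x * y * (y * c)) * Q (a * x * (x * (y * c)))) := by
  rw [hQ, hP, mul_assoc]

/-- Moving `d ^ 4` by two steps of size `d ^ 2`, or by four steps of size `d`. -/
theorem defect_eq (hQ : HasDefect f f' Q) (hP : HasDefect f' f P) (hP' : IsCentralInvolutive P)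
    (hQ' : IsCentralInvolutive Q) (a d : R) :
    P (a * (((d * d) * (d * d)) * ((d * d) * (d * d)))) =
      Q (a * (((d * d) * (d * d)) * ((d * d) * (d * d)))) := by
  set D := a * (((d * d) * (d * d)) * ((d * d) * (d * d))) with hD
  set D' := a * (d * ((d * d) * ((d * d) * (d * d)))) with hD'
  have two_steps : f a (d * d * (d * d * (d * d))) =
      f (a * (d * d) * (d * d)) (d * d) * (P D * Q D) := by
    simpa only [hD, mul_assoc, mul_comm, mul_left_comm] using
      hQ.comp hP a (d * d) (d * d) (d * d)
  have first_steps : f a (d * d * (d * d * (d * d))) =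
      f (a * (d * d)) (d * d * (d * d)) * (P D' * Q D') := by
    simpa only [hD', mul_assoc, mul_comm, mul_left_comm] using
      hQ.comp hP a d d ((d * d) * (d * d))
  have last_steps : f (a * (d * d)) (d * d * (d * d)) =
      f (a * (d * d) * (d * d)) (d * d) * (P D' * Q D') := by
    simpa only [hD', mul_assoc, mul_comm, mul_left_comm] using
      hQ.comp hP (a * (d * d)) d d (d * d)
  rw [last_steps, mul_assoc (f _ _) (P D' * Q D'), hP'.mul_mul_self hQ'] at first_steps
  exact hP'.eq_of_mul_eq_one (mul_left_cancel (two_steps.symm.trans first_steps))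

end HasDefect

variable {f : R → R → H} {P Q : R → H}

/-- Moving `p q d ^ 2` by the steps `p d` and `q d`, or by the steps `p q d` and `d`. -/
theorem map_eps_eq_one (hP' : IsCentralInvolutive P)
    (hP : ∀ a x y c, f a (x * (y * c)) =
      f (a * x * y) c * (P (a * x * y * (y * c)) * P (a * x * (x * (y * c))))) (a d p q : R) :
    P (a * (((d * d) * (d * d)) * ((d * d) * (d * d))) * ((p * p - p) * (q * q - q))) = 1 := by
  set D := a * (((d * d) * (d * d)) * ((d * d) * (d * d))) with hD
  have steps : f a (p * d * (q * d * ((d * d) * ((d * d) * d)))) =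
      f (a * (p * d) * (q * d)) ((d * d) * ((d * d) * d)) *
        (P (D * (p * (q * q))) * P (D * (p * p * q))) := by
    simpa only [hD, mul_assoc, mul_comm, mul_left_comm] using
      hP a (p * d) (q * d) ((d * d) * ((d * d) * d))
  have steps' : f a (p * d * (q * d * ((d * d) * ((d * d) * d)))) =
      f (a * (p * d) * (q * d)) ((d * d) * ((d * d) * d)) *
        (P (D * (p * q)) * P (D * (p * p * (q * q)))) := by
    simpa only [hD, mul_assoc, mul_comm, mul_left_comm] using
      hP a (p * d * q) d ((d * d) * ((d * d) * d))
  rw [steps] at steps'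
  have heq := mul_left_cancel steps'
  rw [← hP'.map_add, ← hP'.map_add] at heq
  rw [← hP'.map_sub_eq_one heq.symm]
  congr 1
  simp only [mul_sub, sub_mul]
  abel

/-- Moving `p d ^ 2` by the steps `p d` and `d`. -/
theorem map_ideal_eq (hP' : IsCentralInvolutive P) (hQ' : IsCentralInvolutive Q)
    (hP : ∀ a x y c, f a (x * (y * c)) =
      f (a * x * y) c * (P (a * x * y * (y * c)) * P (a * x * (x * (y * c)))))
    (hQ : ∀ a x y c, f a (x * (y * c)) =
      f (a * x * y) c * (Q (a * x * y * (y * c)) * Q (a * x * (x * (y * c))))) (a d p : R) :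
    P (a * (((d * d) * (d * d)) * ((d * d) * (d * d))) * (p * p - p)) =
      Q (a * (((d * d) * (d * d)) * ((d * d) * (d * d))) * (p * p - p)) := by
  set D := a * (((d * d) * (d * d)) * ((d * d) * (d * d))) with hD
  have heq := (hP a (p * d) d ((d * d) * ((d * d) * d))).symm.trans
    (hQ a (p * d) d ((d * d) * ((d * d) * d)))
  have hp : a * (p * d) * d * (d * ((d * d) * ((d * d) * d))) = D * p := by rw [hD]; ac_rfl
  have hpp : a * (p * d) * (p * d * (d * ((d * d) * ((d * d) * d)))) = D * (p * p) := by
    rw [hD]; ac_rfl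
  rw [hp, hpp] at heq
  rw [mul_sub, hP'.map_sub, hQ'.map_sub, (hP'.central _ _).eq, (hQ'.central _ _).eq]
  exact mul_left_cancel heq

theorem map_triangle {f₀ f₁ f₂ : R → R → H} {P₀ P₁ P₂ : R → H}
    (hP₀ : IsCentralInvolutive P₀) (hP₁ : IsCentralInvolutive P₁) (hf₂ : HasDefect f₀ f₁ P₂)
    (hf₁ : HasDefect f₀ f₂ P₁) (hf₀ : HasDefect f₂ (fun a b => f₁ b a) P₀)
    (hideal : ∀ r p, P₀ (r * (p * p - p)) = P₁ (r * (p * p - p))) (a d : R) :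
    P₀ ((a * (d * (d * d))) * (a * (d * (d * d)))) *
        P₁ ((a * (d * (d * d))) * (a * (d * (d * d)))) *
      P₂ ((a * (d * (d * d))) * (a * (d * (d * d)))) = 1 := by
  set v := a * a * ((d * d) * (d * d)) with hv
  have hvdd : (a * (d * (d * d))) * (a * (d * (d * d))) = v * (d * d) := by rw [hv]; ac_rfl
  have hdirect : f₀ a (d * d * (a * (d * d))) =
      f₁ (a * (d * d)) (a * (d * d)) * P₂ (v * (d * d)) := by
    simpa only [hv, mul_assoc, mul_comm, mul_left_comm] using hf₂ a (d * d) (a * (d * d))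
  have hfirst : f₀ a (d * d * (a * (d * d))) = f₂ (a * d) (d * (a * (d * d))) * P₁ (v * d) := by
    simpa only [hv, mul_assoc, mul_comm, mul_left_comm] using hf₁ a d (d * (a * (d * d)))
  have hsecond : f₂ (a * d) (d * (a * (d * d))) =
      f₁ (a * (d * d)) (a * (d * d)) * P₀ (v * d) := by
    simpa only [hv, mul_assoc, mul_comm, mul_left_comm] using hf₀ (a * d) d (a * (d * d))
  rw [hdirect, hsecond, mul_assoc (f₁ _ _)] at hfirst
  have hsplit : P₂ (v * (d * d)) = P₀ (v * d) * P₁ (v * d) := mul_left_cancel hfirst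
  have hmul := hideal v d
  rw [mul_sub, hP₀.map_sub, hP₁.map_sub] at hmul
  rw [hvdd, hsplit, (hP₁.central _ _).mul_mul_mul_comm, hmul,
    (hP₁.central _ _).mul_mul_mul_comm, hP₁.mul_self, hP₁.mul_self, one_mul]

end Defect

section LiftedSteinberg

/-- The elements `x a p` of a group `G` satisfy the Steinberg relations, and `br` has the properties
of the commutator of preimages under a central extension `H` of `G`. -/
structure IsLiftedSteinberg {R G H : Type*} [NonUnitalCommRing R] [Group G] [Group H]
    (N : rootsD4 → rootsD4 → ℤ) (x : rootsD4 → R → G) (br : G → G → H) : Prop where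
  signs : IsSignSystem N
  map_add : ∀ a p q, x a (p + q) = x a p * x a q
  commutator_root : ∀ a b c : rootsD4, c.1 = a.1 + b.1 → ∀ p q,
    ⁅x a p, x b q⁆ = x c (N a b • (p * q))
  commutator_one : ∀ a b : rootsD4, 0 ≤ a.1 ⬝ᵥ b.1 → ∀ p q, ⁅x a p, x b q⁆ = 1
  br_mul_left : ∀ g g' h : G, br (g * g') h = br g ⁅g', h⁆ * br g' h * br g h
  br_swap : ∀ g h : G, br h g = (br g h)⁻¹
  br_hallWitt : ∀ r s d : G, ⁅r, d⁆ = 1 →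
    br r ⁅s, d⁆ * br s d = br ⁅r, s⁆ ⁅s, d⁆ * br s d * br ⁅r, s⁆ d
  br_comm : ∀ g h g' h' : G, ⁅br g h, br g' h'⁆ = br ⁅g, h⁆ ⁅g', h'⁆
  br_central : ∀ g h : G, ⁅g, h⁆ = 1 → ∀ z : H, Commute (br g h) z
  br_commutator_eq_one : ∀ g h z : G, ⁅z, g⁆ = 1 → ⁅z, h⁆ = 1 → br ⁅g, h⁆ z = 1
  nonorth : ∀ a b : rootsD4, 0 < a.1 ⬝ᵥ b.1 → ∀ p q, br (x a p) (x b q) = 1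

theorem mul_swap_eq_one_of_diagonal {R H : Type*} [Add R] [Group H] {S : R → R → H}
    {B T : R → H} (hcentral : ∀ a b z, Commute (S a b) z)
    (hleft : ∀ a a' b, S (a + a') b = S a b * S a' b)
    (hright : ∀ a b b', S a (b + b') = S a b * S a b')
    (hB : ∀ a b, B (a + b) = B a * B b) (hT : ∀ a b, T (a + b) = T a * T b)
    (hdiag : ∀ a, T a = S a a * B a) (a b : R) : S a b * S b a = 1 := by
  have hsum := hT a b
  rw [hdiag, hdiag a, hdiag b, hleft, hright, hright, hB] at hsum
  have hcross : S a a * B a * (S b b * B b) = S a a * S b b * (B a * B b) := by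
    rw [mul_assoc, ← mul_assoc (B a), ← (hcentral b b (B a)).eq, mul_assoc, ← mul_assoc]
  rw [hcross] at hsum
  have hdiag' := mul_right_cancel hsum
  rw [mul_assoc, ← mul_assoc (S a b)] at hdiag'
  exact mul_eq_right.mp (mul_left_cancel hdiag')

namespace IsLiftedSteinberg

variable {R G H : Type*} [NonUnitalCommRing R] [Group G] [Group H]
variable {N : rootsD4 → rootsD4 → ℤ} {x : rootsD4 → R → G} {br : G → G → H}

theorem br_one_left (h : IsLiftedSteinberg N x br) (z : G) : br 1 z = 1 := by
  have := h.br_commutator_eq_one 1 1 z (commutatorElement_one_right z)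
    (commutatorElement_one_right z)
  rwa [commutatorElement_self] at this

theorem br_one_right (h : IsLiftedSteinberg N x br) (z : G) : br z 1 = 1 := by
  rw [h.br_swap, h.br_one_left, inv_one]

theorem commute_br (h : IsLiftedSteinberg N x br) {a b a' b' : rootsD4}
    (hab : -1 ≤ a.1 ⬝ᵥ b.1) (hab' : -1 ≤ a'.1 ⬝ᵥ b'.1)
    (hs : 0 < (a.1 + b.1) ⬝ᵥ (a'.1 + b'.1)) (p q p' q' : R) :
    Commute (br (x a p) (x b q)) (br (x a' p') (x b' q')) := by
  rw [← commutatorElement_eq_one_iff_commute, h.br_comm]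
  rcases hab.eq_or_lt with hroot | hnonneg
  · rcases hab'.eq_or_lt with hroot' | hnonneg'
    · rw [h.commutator_root a b ⟨_, root_add_mem hroot.symm⟩ rfl,
        h.commutator_root a' b' ⟨_, root_add_mem hroot'.symm⟩ rfl]
      exact h.nonorth _ _ hs _ _
    · rw [h.commutator_one a' b' (by omega), h.br_one_right]
  · rw [h.commutator_one a b (by omega), h.br_one_left]

theorem commute_br_self (h : IsLiftedSteinberg N x br) {a b : rootsD4}
    (hab : -1 ≤ a.1 ⬝ᵥ b.1) (p q p' q' : R) :
    Commute (br (x a p) (x b q)) (br (x a p') (x b q')) :=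
  h.commute_br hab hab (by rw [root_add_norm]; omega) p q p' q'

theorem add_left (h : IsLiftedSteinberg N x br) {a b : rootsD4} (hab : -1 ≤ a.1 ⬝ᵥ b.1)
    (p p' q : R) : br (x a (p + p')) (x b q) = br (x a p) (x b q) * br (x a p') (x b q) := by
  have hcommutator : br (x a p) ⁅x a p', x b q⁆ = 1 := by
    rcases hab.eq_or_lt with hroot | hnonneg
    · rw [h.commutator_root a b ⟨_, root_add_mem hroot.symm⟩ rfl]
      refine h.nonorth _ _ ?_ _ _
      rw [dotProduct_add, root_norm]
      omega
    · rw [h.commutator_one a b (by omega), h.br_one_right]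
  rw [h.map_add, h.br_mul_left, hcommutator, one_mul]
  exact h.commute_br_self hab _ _ _ _

/-- The lifted commutators as homomorphisms in the first argument. -/
def homLeft (h : IsLiftedSteinberg N x br) {a b : rootsD4} (hab : -1 ≤ a.1 ⬝ᵥ b.1) (q : R) :
    R →+ Additive H :=
  AddMonoidHom.mk' (fun p => Additive.ofMul (br (x a p) (x b q))) fun p p' => h.add_left hab p p' q

theorem zsmul_left (h : IsLiftedSteinberg N x br) {a b : rootsD4} (hab : -1 ≤ a.1 ⬝ᵥ b.1)
    (n : ℤ) (p q : R) : br (x a (n • p)) (x b q) = br (x a p) (x b q) ^ n :=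
  map_zsmul (h.homLeft hab q) n p

theorem add_right (h : IsLiftedSteinberg N x br) {a b : rootsD4} (hab : -1 ≤ a.1 ⬝ᵥ b.1)
    (p q q' : R) : br (x a p) (x b (q + q')) = br (x a p) (x b q) * br (x a p) (x b q') := by
  rw [h.br_swap, h.add_left (by rwa [dotProduct_comm]), mul_inv_rev, ← h.br_swap, ← h.br_swap]
  exact h.commute_br_self hab _ _ _ _

theorem br_triple (h : IsLiftedSteinberg N x br) {r s d g t : rootsD4}
    (hc : IsA3Chain r s d g t) (a b c : R) :
    br (x r a) (x t (N s d • (b * c))) =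
      br (x g (N r s • (a * b))) (x t (N s d • (b * c))) *
        br (x g (N r s • (a * b))) (x d c) := by
  have hallWitt := h.br_hallWitt (x r a) (x s b) (x d c)
    (h.commutator_one r d hc.dot_eq_zero.ge _ _)
  rw [h.commutator_root s d t hc.right_eq, h.commutator_root r s g hc.left_eq] at hallWitt
  have hcomm : Commute (br (x s b) (x d c)) (br (x g (N r s • (a * b))) (x d c)) := by
    refine h.commute_br hc.dot_sd.ge hc.dot_gd.ge ?_ _ _ _ _
    rw [← hc.right_eq, dotProduct_add, dotProduct_comm, hc.dot_gt, hc.right_eq, add_dotProduct,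
      hc.dot_sd, root_norm]
    norm_num
  rw [mul_assoc, hcomm.eq, ← mul_assoc] at hallWitt
  exact mul_right_cancel hallWitt

theorem br_polarize (h : IsLiftedSteinberg N x br) {g t : rootsD4} (hgt : g.1 ⬝ᵥ t.1 = 0)
    (a b b' c : R) :
    br (x g (a * b)) (x t (b' * c)) * br (x g (a * b')) (x t (b * c)) = 1 := by
  obtain ⟨r, s, d, hc⟩ := exists_isA3Chain_of_dot_eq_zero hgt
  have hgt' : -1 ≤ g.1 ⬝ᵥ t.1 := by omega
  have polarize (a c : R) := mul_swap_eq_one_of_diagonal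
    (S := fun b b' => br (x g (N r s • (a * b))) (x t (N s d • (b' * c))))
    (fun _ _ => h.br_central _ _ (h.commutator_one g t hgt.ge _ _))
    (fun _ _ _ => by simp only [mul_add, smul_add, h.add_left hgt'])
    (fun _ _ _ => by simp only [add_mul, smul_add, h.add_right hgt'])
    (fun _ _ => by rw [mul_add, smul_add, h.add_left hc.dot_gd.ge])
    (fun _ _ => by rw [add_mul, smul_add, h.add_right hc.dot_rt.ge])
    (fun b => h.br_triple hc a b c) b b'
  have := polarize (N r s • a) (N s d • c)
  simpa only [smul_mul_assoc, mul_smul_comm, smul_smul, h.signs.sq hc.dot_rs,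
    h.signs.sq hc.dot_sd, one_smul] using this

theorem br_move (h : IsLiftedSteinberg N x br) {a b a' b' c : rootsD4}
    (hab : a.1 ⬝ᵥ b.1 = 0) (ha : a.1 = a'.1 + c.1) (hb : b'.1 = c.1 + b.1)
    (ha'b : a'.1 ⬝ᵥ b.1 = 1) (p q r : R) :
    br (x a (N a' c • (p * q))) (x b r) = br (x a' p) (x b' (N c b • (q * r))) := by
  have hallWitt := h.br_hallWitt (x a' p) (x c q) (x b r) (h.commutator_one a' b (by omega) _ _)
  have hab' : 0 < a.1 ⬝ᵥ b'.1 := by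
    rw [hb, dotProduct_add, hab, ha, add_dotProduct, root_dot_of_add ha, root_norm]
    norm_num
  rw [h.commutator_root c b b' hb, h.commutator_root a' c a ha, h.nonorth a b' hab', one_mul,
    ← (h.br_central _ _ (h.commutator_one a b hab.ge _ _) _).eq] at hallWitt
  exact (mul_right_cancel hallWitt).symm

/-- The lifted commutator normalized to lift the root element with parameter `p * q`. -/
def rootLift (N : rootsD4 → rootsD4 → ℤ) (x : rootsD4 → R → G) (br : G → G → H)
    (a b : rootsD4) (p q : R) : H :=
  br (x a (N a b • p)) (x b q)

theorem rootLift_swap (h : IsLiftedSteinberg N x br) {a b : rootsD4} (hab : a.1 ⬝ᵥ b.1 = -1)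
    (p q : R) : rootLift N x br b a q p = rootLift N x br a b p q := by
  have hba : b.1 ⬝ᵥ a.1 = -1 := by rw [dotProduct_comm, hab]
  rw [rootLift, rootLift, h.zsmul_left hba.ge, h.zsmul_left hab.ge, h.br_swap, h.signs.antisymm hab,
    inv_zpow, zpow_neg, inv_inv]

theorem rootLift_triple (h : IsLiftedSteinberg N x br) {r s d g t : rootsD4}
    (hc : IsA3Chain r s d g t) {P : R → H} (hP : ∀ p q, br (x g p) (x t q) = P (p * q))
    (hP' : IsCentralInvolutive P) :
    HasDefect (rootLift N x br r t) (rootLift N x br g d) P := by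
  intro a b c
  have htriple := h.br_triple hc (N r t • a) (N s d • b) c
  have hsign : N r s * (N r t * N s d) = N g d := by
    linear_combination N g d * h.signs.sq hc.dot_rs - N r s * h.signs.jacobi hc
  rw [smul_mul_assoc (N s d), smul_smul (N s d), h.signs.sq hc.dot_sd, one_smul,
    smul_mul_smul_comm, smul_smul, hsign, hP (N g d • _), smul_mul_assoc,
    hP'.map_zsmul (h.signs.sq hc.dot_gd)] at htriple
  rw [rootLift, htriple]
  exact hP'.central _ _

theorem rootLift_add_left (h : IsLiftedSteinberg N x br) {a b : rootsD4} (hab : a.1 ⬝ᵥ b.1 = -1)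
    (p p' q : R) :
    rootLift N x br a b (p + p') q = rootLift N x br a b p q * rootLift N x br a b p' q := by
  rw [rootLift, smul_add, h.add_left hab.ge, rootLift, rootLift]

end IsLiftedSteinberg

end LiftedSteinberg

section Pairing

variable {C : Type u} [Category.{v} C] [CartesianMonoidalCategory C]

theorem comp_commutator {S T G : C} [GrpObj G] (f : S ⟶ T) (g h : T ⟶ G) :
    f ≫ ⁅g, h⁆ = ⁅f ≫ g, f ≫ h⁆ := by
  simp only [commutatorElement_def, MonObj.comp_mul, GrpObj.comp_inv]

variable {G H : C} [GrpObj G] [GrpObj H] {k : H ⟶ G}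

theorem commutator_comp_hom [IsMonHom k] {T : C} (g h : T ⟶ H) :
    ⁅g, h⁆ ≫ k = ⁅g ≫ k, h ≫ k⁆ := by
  simp only [commutatorElement_def, MonObj.mul_comp, GrpObj.inv_comp]

theorem conj_comp_hom_of_commutator_eq_one [IsMonHom k] {T : C} {g h : T ⟶ H}
    (hgh : ⁅g ≫ k, h ≫ k⁆ = 1) : (g * h * g⁻¹) ≫ k = h ≫ k := by
  rw [MonObj.mul_comp, MonObj.mul_comp, GrpObj.inv_comp,
    commutatorElement_eq_one_iff_mul_comm.mp hgh, mul_inv_cancel_right]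

namespace IsCentralExtension

theorem commutator_eq (hk : IsCentralExtension k) {T : C} {g h g' h' : T ⟶ H}
    (hg : g ≫ k = g' ≫ k) (hh : h ≫ k = h' ≫ k) : ⁅g, h⁆ = ⁅g', h'⁆ := by
  have := hk.isMonHom
  obtain ⟨z, rfl⟩ : ∃ z, g = g' * z := ⟨g'⁻¹ * g, by simp⟩
  obtain ⟨w, rfl⟩ : ∃ w, h = h' * w := ⟨h'⁻¹ * h, by simp⟩
  rw [MonObj.mul_comp, mul_eq_left] at hg hh
  have hz := fun y => hk.central z y hg
  have hw := fun y => hk.central w y hh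
  simp only [commutatorElement_def, mul_inv_rev]
  calc g' * z * (h' * w) * (z⁻¹ * g'⁻¹) * (w⁻¹ * h'⁻¹)
      = g' * (z * (h' * w)) * z⁻¹ * g'⁻¹ * w⁻¹ * h'⁻¹ := by simp only [mul_assoc]
    _ = g' * h' * (w * g'⁻¹) * w⁻¹ * h'⁻¹ := by rw [hz]; simp only [mul_assoc, mul_inv_cancel_left]
    _ = g' * h' * g'⁻¹ * h'⁻¹ := by rw [hw]; simp only [mul_assoc, mul_inv_cancel_left]

variable [Regular C]

theorem exists_pairing (hk : IsCentralExtension k) :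
    ∃ br : G ⊗ G ⟶ H, ∀ {T : C} (g h : T ⟶ H), lift (g ≫ k) (h ≫ k) ≫ br = ⁅g, h⁆ := by
  have := hk.isRegularEpi
  have := isRegularEpi_tensorHom k k
  obtain ⟨br, hbr⟩ := exists_desc_of_cover (k ⊗ₘ k) ⁅fst H H, snd H H⁆ fun u v huv => by
    rw [comp_commutator, comp_commutator]
    refine hk.commutator_eq ?_ ?_
    · simpa using congrArg (· ≫ fst G G) huv
    · simpa using congrArg (· ≫ snd G G) huv
  refine ⟨br, fun g h => ?_⟩
  simpa [comp_commutator] using congrArg (lift g h ≫ ·) hbr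

/-- The commutator `⟨g, h⟩` of arbitrary preimages under a central extension. -/
noncomputable def liftedComm (hk : IsCentralExtension k) {T : C} (g h : T ⟶ G) : T ⟶ H :=
  lift g h ≫ hk.exists_pairing.choose

theorem liftedComm_comp (hk : IsCentralExtension k) {T : C} (g h : T ⟶ H) :
    hk.liftedComm (g ≫ k) (h ≫ k) = ⁅g, h⁆ :=
  hk.exists_pairing.choose_spec g h

theorem comp_liftedComm (hk : IsCentralExtension k) {S T : C} (f : S ⟶ T) (g h : T ⟶ G) :
    f ≫ hk.liftedComm g h = hk.liftedComm (f ≫ g) (f ≫ h) := by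
  rw [liftedComm, liftedComm, ← Category.assoc, comp_lift]

theorem exists_lift₂ (hk : IsCentralExtension k) {T : C} (g h : T ⟶ G) :
    ∃ (T' : C) (e : T' ⟶ T) (g' h' : T' ⟶ H), IsRegularEpi e ∧ g' ≫ k = e ≫ g ∧
      h' ≫ k = e ≫ h :=
  have := hk.isRegularEpi
  exists_local_lift₂ k k g h

theorem exists_lift₃ (hk : IsCentralExtension k) {T : C} (g h l : T ⟶ G) :
    ∃ (T' : C) (e : T' ⟶ T) (g' h' l' : T' ⟶ H), IsRegularEpi e ∧ g' ≫ k = e ≫ g ∧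
      h' ≫ k = e ≫ h ∧ l' ≫ k = e ≫ l := by
  have := hk.isRegularEpi
  obtain ⟨T₁, e₁, g', h', _, hg, hh⟩ := hk.exists_lift₂ g h
  obtain ⟨T₂, e₂, l', _, hl⟩ := exists_local_lift k (e₁ ≫ l)
  exact ⟨T₂, e₂ ≫ e₁, e₂ ≫ g', e₂ ≫ h', l', inferInstance, by simp only [Category.assoc, hg],
    by simp only [Category.assoc, hh], by simp only [Category.assoc, hl]⟩

theorem liftedComm_comp_hom (hk : IsCentralExtension k) {T : C} (g h : T ⟶ G) :
    hk.liftedComm g h ≫ k = ⁅g, h⁆ := by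
  have := hk.isMonHom
  obtain ⟨T', e, g', h', _, hg, hh⟩ := hk.exists_lift₂ g h
  refine (cancel_epi e).mp ?_
  rw [comp_commutator, ← Category.assoc, comp_liftedComm, ← hg, ← hh, liftedComm_comp,
    commutator_comp_hom]

theorem liftedComm_mul_left (hk : IsCentralExtension k) {T : C} (g g' h : T ⟶ G) :
    hk.liftedComm (g * g') h =
      hk.liftedComm g ⁅g', h⁆ * hk.liftedComm g' h * hk.liftedComm g h := by
  have := hk.isMonHom
  obtain ⟨T', e, l, l', m, _, hl, hl', hm⟩ := hk.exists_lift₃ g g' h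
  refine (cancel_epi e).mp ?_
  simp only [MonObj.comp_mul, comp_liftedComm, comp_commutator, ← hl, ← hl', ← hm,
    ← MonObj.mul_comp, ← commutator_comp_hom, liftedComm_comp]
  simp only [commutatorElement_def]
  group

theorem liftedComm_swap (hk : IsCentralExtension k) {T : C} (g h : T ⟶ G) :
    hk.liftedComm h g = (hk.liftedComm g h)⁻¹ := by
  obtain ⟨T', e, l, m, _, hl, hm⟩ := hk.exists_lift₂ g h
  refine (cancel_epi e).mp ?_
  simp only [GrpObj.comp_inv, comp_liftedComm, ← hl, ← hm, liftedComm_comp,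
    commutatorElement_inv]

theorem liftedComm_central (hk : IsCentralExtension k) {T : C} {g h : T ⟶ G} (hgh : ⁅g, h⁆ = 1)
    (z : T ⟶ H) : Commute (hk.liftedComm g h) z :=
  hk.central _ _ (by rw [liftedComm_comp_hom, hgh])

theorem commutator_liftedComm (hk : IsCentralExtension k) {T : C} (g h g' h' : T ⟶ G) :
    ⁅hk.liftedComm g h, hk.liftedComm g' h'⁆ = hk.liftedComm ⁅g, h⁆ ⁅g', h'⁆ := by
  rw [← liftedComm_comp hk, liftedComm_comp_hom, liftedComm_comp_hom]

theorem liftedComm_commutator_eq_one (hk : IsCentralExtension k) {T : C} {g h z : T ⟶ G}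
    (hg : ⁅z, g⁆ = 1) (hh : ⁅z, h⁆ = 1) : hk.liftedComm ⁅g, h⁆ z = 1 := by
  have := hk.isMonHom
  obtain ⟨T', e, l, m, n, _, hl, hm, hn⟩ := hk.exists_lift₃ g h z
  have hnl : ⁅n ≫ k, l ≫ k⁆ = 1 := by rw [hn, hl, ← comp_commutator, hg, MonObj.comp_one]
  have hnm : ⁅n ≫ k, m ≫ k⁆ = 1 := by rw [hn, hm, ← comp_commutator, hh, MonObj.comp_one]
  have hconj : ⁅n * l * n⁻¹, n * m * n⁻¹⁆ = ⁅l, m⁆ := hk.commutator_eq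
    (conj_comp_hom_of_commutator_eq_one hnl) (conj_comp_hom_of_commutator_eq_one hnm)
  rw [← conjugate_commutatorElement, mul_inv_eq_iff_eq_mul] at hconj
  refine (cancel_epi e).mp ?_
  rw [comp_liftedComm, comp_commutator, ← hl, ← hm, ← hn, ← commutator_comp_hom,
    liftedComm_comp, MonObj.comp_one, commutatorElement_eq_one_iff_mul_comm]
  exact hconj.symm

theorem liftedComm_hallWitt (hk : IsCentralExtension k) {T : C} {r s d : T ⟶ G}
    (hrd : ⁅r, d⁆ = 1) :
    hk.liftedComm r ⁅s, d⁆ * hk.liftedComm s d =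
      hk.liftedComm ⁅r, s⁆ ⁅s, d⁆ * hk.liftedComm s d * hk.liftedComm ⁅r, s⁆ d := by
  have := hk.isMonHom
  obtain ⟨T', e, l, m, n, _, hl, hm, hn⟩ := hk.exists_lift₃ r s d
  have hln : ⁅l ≫ k, n ≫ k⁆ = 1 := by rw [hl, hn, ← comp_commutator, hrd, MonObj.comp_one]
  have hconj : ⁅l * m * l⁻¹, l * n * l⁻¹⁆ = ⁅l * m * l⁻¹, n⁆ :=
    hk.commutator_eq rfl (conj_comp_hom_of_commutator_eq_one hln)
  rw [← conjugate_commutatorElement] at hconj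
  refine (cancel_epi e).mp ?_
  simp only [MonObj.comp_mul, comp_liftedComm, comp_commutator, ← hl, ← hm, ← hn,
    ← commutator_comp_hom, liftedComm_comp]
  calc ⁅l, ⁅m, n⁆⁆ * ⁅m, n⁆ = l * ⁅m, n⁆ * l⁻¹ := by
        rw [commutatorElement_def l]; group
    _ = ⁅l * m * l⁻¹, n⁆ := hconj
    _ = _ := by simp only [commutatorElement_def]; group

end IsCentralExtension

end Pairing

section Steinberg

variable {C : Type u} [Category.{v} C] [CartesianMonoidalCategory C]
variable {K : C} [NonUnitalCommRingObj K] {G H : C} [GrpObj G] [GrpObj H] {k : H ⟶ G}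
variable {N : rootsD4 → rootsD4 → ℤ} {x : rootsD4 → (K ⟶ G)}

theorem SteinbergRelations.commutator_one_of_dot_nonneg (hx : SteinbergRelations N x)
    {a b : rootsD4} (hab : 0 ≤ a.1 ⬝ᵥ b.1) {T : C} (p q : T ⟶ K) : ⁅p ≫ x a, q ≫ x b⁆ = 1 :=
  hx.commutator_one a b (root_add_not_mem hab) (root_add_ne_zero hab) p q

theorem SteinbergRelations.isLiftedSteinberg [Regular C] (hx : SteinbergRelations N x)
    (hK : IsWeaklyUnital K) (hN : IsSignSystem N) (hk : IsCentralExtension k) (T : C) :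
    IsLiftedSteinberg N (fun a (p : T ⟶ K) => p ≫ x a) hk.liftedComm where
  signs := hN
  map_add a := hx.map_add a
  commutator_root a b c h p q := hx.commutator_root a b c h p q
  commutator_one _ _ h := hx.commutator_one_of_dot_nonneg h
  br_mul_left := hk.liftedComm_mul_left
  br_swap := hk.liftedComm_swap
  br_hallWitt _ _ _ h := hk.liftedComm_hallWitt h
  br_comm := hk.commutator_liftedComm
  br_central _ _ h := hk.liftedComm_central h
  br_commutator_eq_one _ _ _ := hk.liftedComm_commutator_eq_one
  nonorth a b h p q := by
    obtain ⟨c, d, hcd, hc, hd⟩ := exists_root_decomposition h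
    obtain ⟨T', f, p₁, p₂, _, hp⟩ := hK.exists_mul p
    have hcomm := hx.commutator_root c d a hcd (N c d • p₁) p₂
    rw [smul_mul_assoc, smul_smul, hN.sq (root_dot_of_add hcd), one_smul, ← hp] at hcomm
    refine (cancel_epi f).mp ?_
    rw [hk.comp_liftedComm, MonObj.comp_one, ← Category.assoc, ← hcomm, ← Category.assoc]
    exact hk.liftedComm_commutator_eq_one
      (hx.commutator_one_of_dot_nonneg (by rwa [dotProduct_comm]) _ _)
      (hx.commutator_one_of_dot_nonneg (by rwa [dotProduct_comm]) _ _)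

end Steinberg

section Configurations

/-- The root `e₁ + e₃`. -/
def rootA : rootsD4 := ⟨![1, 0, 1, 0], mem_rootList_iff.mp (by decide)⟩

/-- The root `e₂ - e₃`. -/
def rootA' : rootsD4 := ⟨![0, 1, -1, 0], mem_rootList_iff.mp (by decide)⟩

/-- The root `e₁ + e₄`. -/
def rootB : rootsD4 := ⟨![1, 0, 0, 1], mem_rootList_iff.mp (by decide)⟩

/-- The root `e₂ - e₄`. -/
def rootB' : rootsD4 := ⟨![0, 1, 0, -1], mem_rootList_iff.mp (by decide)⟩

/-- The root `e₁ - e₄`. -/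
def rootC : rootsD4 := ⟨![1, 0, 0, -1], mem_rootList_iff.mp (by decide)⟩

/-- The root `e₂ + e₄`. -/
def rootC' : rootsD4 := ⟨![0, 1, 0, 1], mem_rootList_iff.mp (by decide)⟩

theorem exists_orbit_config (o : Orbit) :
    ∃ s g d, IsA3Chain rootA s d g rootA' ∧ halfSum g.1 rootA'.1 ∈ o.roots ∧
      halfSum rootA.1 d.1 ∈ o.roots := by
  cases o
  · exact ⟨⟨![-1, 1, 0, 0], mem_rootList_iff.mp (by decide)⟩,
      ⟨![0, 1, 1, 0], mem_rootList_iff.mp (by decide)⟩,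
      ⟨![1, 0, -1, 0], mem_rootList_iff.mp (by decide)⟩,
      ⟨by decide, by decide, by decide⟩, by decide, by decide⟩
  · exact ⟨⟨![0, 0, -1, -1], mem_rootList_iff.mp (by decide)⟩, rootC, rootC',
      ⟨by decide, by decide, by decide⟩, by decide, by decide⟩
  · exact ⟨⟨![0, 0, -1, 1], mem_rootList_iff.mp (by decide)⟩, rootB, rootB',
      ⟨by decide, by decide, by decide⟩, by decide, by decide⟩

end Configurations

section Symbols

variable {C : Type u} [Category.{v} C] [CartesianMonoidalCategory C] [Regular C]
variable {K : C} [NonUnitalCommRingObj K] {G H : C} [GrpObj G] [GrpObj H] {k : H ⟶ G}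
variable {N : rootsD4 → rootsD4 → ℤ} {x : rootsD4 → (K ⟶ G)} {hk : IsCentralExtension k}

/-- The morphism `c` expresses the lifted commutators of the root elements with the orthogonal
roots `g` and `t`. -/
structure IsSymbol (hk : IsCentralExtension k) (x : rootsD4 → (K ⟶ G)) (g t : rootsD4)
    (c : K ⟶ H) : Prop where
  liftedComm_eq : ∀ {T : C} (p q : T ⟶ K),
    hk.liftedComm (p ≫ x g) (q ≫ x t) = (p * q) ≫ c
  isCentralInvolutive : ∀ T : C, IsCentralInvolutive fun p : T ⟶ K => p ≫ c

theorem SteinbergRelations.liftedComm_balanced (hx : SteinbergRelations N x)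
    (hK : IsWeaklyUnital K) (hN : IsSignSystem N) {g t : rootsD4} (hgt : g.1 ⬝ᵥ t.1 = 0) {T : C}
    (p e q : T ⟶ K) :
    hk.liftedComm ((p * e) ≫ x g) (q ≫ x t) = hk.liftedComm (p ≫ x g) ((e * q) ≫ x t) := by
  obtain ⟨T₁, f₁, a, b, _, hp⟩ := hK.exists_mul p
  obtain ⟨T₂, f₂, b', c, _, hq⟩ := hK.exists_mul (f₁ ≫ q)
  have hp' : (f₂ ≫ f₁) ≫ p = (f₂ ≫ a) * (f₂ ≫ b) := by rw [Category.assoc, hp, comp_mul_hom]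
  have hq' : (f₂ ≫ f₁) ≫ q = b' * c := by rw [Category.assoc, hq]
  refine (cancel_epi (f₂ ≫ f₁)).mp ?_
  rw [hk.comp_liftedComm, hk.comp_liftedComm]
  simp only [← Category.assoc _ _ (x _), comp_mul_hom, hp', hq']
  have hT := hx.isLiftedSteinberg hK hN hk T₂
  have hright := hT.br_polarize hgt (f₂ ≫ a) (f₂ ≫ b) ((f₂ ≫ f₁) ≫ e * b') c
  have hleft := hT.br_polarize hgt ((f₂ ≫ a) * ((f₂ ≫ f₁) ≫ e)) (f₂ ≫ b) b' c
  rw [mul_assoc (f₂ ≫ a) _ b', ← hright] at hleft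
  have heq := mul_right_cancel hleft
  rwa [mul_right_comm, mul_assoc ((f₂ ≫ f₁) ≫ e)] at heq

theorem isCentralInvolutive_of_liftedComm_eq (hx : SteinbergRelations N x)
    (hK : IsWeaklyUnital K) (hN : IsSignSystem N) {g t : rootsD4} (hgt : g.1 ⬝ᵥ t.1 = 0)
    {c : K ⟶ H} (hadd : IsAddMulHom c)
    (hc : ∀ {T : C} (p q : T ⟶ K), hk.liftedComm (p ≫ x g) (q ≫ x t) = (p * q) ≫ c) (T : C) :
    IsCentralInvolutive fun p : T ⟶ K => p ≫ c where
  map_add := hadd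
  mul_self p := by
    obtain ⟨T₁, f, a, d, _, hp⟩ := hK.exists_pow_eight p
    have hpolarize := (hx.isLiftedSteinberg hK hN hk T₁).br_polarize hgt a
      ((d * d) * (d * d)) ((d * d) * d) d
    have hleft : a * (d * d * (d * d)) * (d * d * d * d) = f ≫ p := by rw [hp]; ac_rfl
    have hright : a * (d * d * d) * (d * d * (d * d) * d) = f ≫ p := by rw [hp]; ac_rfl
    rw [hc, hc, hleft, hright] at hpolarize
    refine (cancel_epi f).mp ?_
    rw [MonObj.comp_mul, ← Category.assoc, MonObj.comp_one, hpolarize]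
  central p z := by
    obtain ⟨T₁, f, a, b, _, hp⟩ := hK.exists_mul p
    refine (cancel_epi f).mp ?_
    rw [MonObj.comp_mul, MonObj.comp_mul, ← Category.assoc, hp, ← hc]
    exact hk.liftedComm_central (hx.commutator_one_of_dot_nonneg hgt.ge _ _) _

theorem exists_isSymbol (hx : SteinbergRelations N x) (hK : IsWeaklyUnital K)
    (hN : IsSignSystem N) (hk : IsCentralExtension k) {g t : rootsD4} (hgt : g.1 ⬝ᵥ t.1 = 0) :
    ∃ c, IsSymbol hk x g t c := by
  let y : K ⊗ K ⟶ H := hk.liftedComm (fst K K ≫ x g) (snd K K ≫ x t)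
  have hy {T : C} (p q : T ⟶ K) : lift p q ≫ y = hk.liftedComm (p ≫ x g) (q ≫ x t) := by
    rw [hk.comp_liftedComm, lift_fst_assoc, lift_snd_assoc]
  obtain ⟨c, hc⟩ := hK.exists_factor_mul y fun p e q => by
    rw [hy, hy, hx.liftedComm_balanced hK hN hgt]
  have hadd : IsAddMulHom c := hK.isAddMulHom_of_factor_mul hc fun {T} a a' b => by
    rw [hy, hy, hy]
    exact (hx.isLiftedSteinberg hK hN hk T).add_left (by omega) a a' b
  have hc' {T : C} (p q : T ⟶ K) : hk.liftedComm (p ≫ x g) (q ≫ x t) = (p * q) ≫ c := by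
    rw [hc, hy]
  exact ⟨c, hc', isCentralInvolutive_of_liftedComm_eq hx hK hN hgt hadd hc'⟩

/-- The lifts of root elements on generalized elements. -/
noncomputable def homRootLift (hk : IsCentralExtension k) (N : rootsD4 → rootsD4 → ℤ)
    (x : rootsD4 → (K ⟶ G)) (T : C) (a b : rootsD4) : (T ⟶ K) → (T ⟶ K) → (T ⟶ H) :=
  IsLiftedSteinberg.rootLift N (fun a (p : T ⟶ K) => p ≫ x a) hk.liftedComm a b

namespace IsSymbol

theorem symm {g t : rootsD4} {c : K ⟶ H} (hc : IsSymbol hk x g t c) : IsSymbol hk x t g c where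
  liftedComm_eq p q := by
    rw [hk.liftedComm_swap, hc.liftedComm_eq, mul_comm,
      inv_eq_of_mul_eq_one_left ((hc.isCentralInvolutive _).mul_self _)]
  isCentralInvolutive := hc.isCentralInvolutive

theorem unique (hK : IsWeaklyUnital K) {g t : rootsD4} {c c' : K ⟶ H} (hc : IsSymbol hk x g t c)
    (hc' : IsSymbol hk x g t c') : c = c' := by
  obtain ⟨T, f, a, b, _, hf⟩ := hK.exists_mul (𝟙 K)
  rw [Category.comp_id] at hf
  rw [← cancel_epi f, hf, ← hc.liftedComm_eq, ← hc'.liftedComm_eq]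

theorem eq_move (hx : SteinbergRelations N x) (hK : IsWeaklyUnital K) (hN : IsSignSystem N)
    {a b a' b' e : rootsD4} {c c' : K ⟶ H} (hc : IsSymbol hk x a b c)
    (hc' : IsSymbol hk x a' b' c') (hab : a.1 ⬝ᵥ b.1 = 0) (ha : a.1 = a'.1 + e.1)
    (hb : b'.1 = e.1 + b.1) (ha'b : a'.1 ⬝ᵥ b.1 = 1) : c = c' := by
  obtain ⟨T, f, p, d, _, hf⟩ := hK.exists_pow_eight (𝟙 K)
  have hmove := (hx.isLiftedSteinberg hK hN hk T).br_move hab ha hb ha'b p ((d * d) * (d * d))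
    ((d * d) * (d * d))
  rw [hc.liftedComm_eq, hc'.liftedComm_eq, smul_mul_assoc, mul_smul_comm,
    (hc.isCentralInvolutive T).map_zsmul (hN.sq (root_dot_of_add ha)),
    (hc'.isCentralInvolutive T).map_zsmul (hN.sq (root_dot_of_add hb)), mul_assoc] at hmove
  rw [Category.comp_id] at hf
  rw [← cancel_epi f, hf, hmove]

theorem hasDefect (hx : SteinbergRelations N x) (hK : IsWeaklyUnital K) (hN : IsSignSystem N)
    {r s d g t : rootsD4} {c : K ⟶ H} (hchain : IsA3Chain r s d g t) (hc : IsSymbol hk x g t c)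
    (T : C) :
    HasDefect (homRootLift hk N x T r t) (homRootLift hk N x T g d) fun p => p ≫ c :=
  (hx.isLiftedSteinberg hK hN hk T).rootLift_triple hchain hc.liftedComm_eq
    (hc.isCentralInvolutive T)

theorem eq_of_isA3Chain (hx : SteinbergRelations N x) (hK : IsWeaklyUnital K)
    (hN : IsSignSystem N) {r s d g t : rootsD4} {c c' : K ⟶ H} (hchain : IsA3Chain r s d g t)
    (hc : IsSymbol hk x g t c) (hc' : IsSymbol hk x r d c') : c = c' := by
  obtain ⟨T, f, a, e, _, hf⟩ := hK.exists_pow_eight (𝟙 K)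
  have hdefect := (hc.hasDefect hx hK hN hchain T).defect_eq
    (hc'.hasDefect hx hK hN hchain.reverse T) (hc'.isCentralInvolutive T)
    (hc.isCentralInvolutive T) a e
  rw [Category.comp_id] at hf
  rw [← cancel_epi f, hf, hdefect]

end IsSymbol

/-- The family `c` expresses the lifted commutators of root elements with orthogonal roots. -/
def IsSymbolFamily (hk : IsCentralExtension k) (x : rootsD4 → (K ⟶ G)) (c : Orbit → (K ⟶ H)) :
    Prop :=
  ∀ (o : Orbit) (g t : rootsD4), g.1 ⬝ᵥ t.1 = 0 → halfSum g.1 t.1 ∈ o.roots →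
    IsSymbol hk x g t (c o)

theorem exists_isSymbolFamily (hx : SteinbergRelations N x) (hK : IsWeaklyUnital K)
    (hN : IsSignSystem N) (hk : IsCentralExtension k) :
    ∃ c : Orbit → (K ⟶ H), IsSymbolFamily hk x c := by
  have : Nonempty (K ⟶ H) := ⟨1⟩
  choose! F hF using fun (g t : rootsD4) (h : g.1 ⬝ᵥ t.1 = 0) => exists_isSymbol hx hK hN hk h
  have of_sum_eq {a b a' b' : rootsD4} (h : a.1 ⬝ᵥ b.1 = 0) (h' : a'.1 ⬝ᵥ b'.1 = 0)
      (hsum : a.1 + b.1 = a'.1 + b'.1) : F a b = F a' b' := by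
    refine eq_of_sum_eq (fun {a b} h => ?_) (fun {a b a' b' c} h ha hb ha'b => ?_) h h' hsum
    · exact (hF a b h).symm.unique hK (hF b a (by rw [dotProduct_comm, h]))
    · refine (hF a b h).eq_move hx hK hN (hF a' b' ?_) h ha hb ha'b
      rw [hb, dotProduct_add, ha'b, root_dot_of_add ha]
      rfl
  have neg_right {a b : rootsD4} (h : a.1 ⬝ᵥ b.1 = 0) : F a b = F a (rootNeg b) := by
    obtain ⟨r, d, g, t, hchain, hgt, hrd⟩ := exists_isA3Chain_add_eq h
    have hneg : a.1 ⬝ᵥ (rootNeg b).1 = 0 := by rw [root_dot_rootNeg, h, neg_zero]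
    rw [of_sum_eq h hchain.dot_gt hgt.symm, of_sum_eq hneg hchain.dot_eq_zero hrd.symm]
    exact (hF g t hchain.dot_gt).eq_of_isA3Chain hx hK hN hchain (hF r d hchain.dot_eq_zero)
  choose s g d hchain hgo _ using exists_orbit_config
  refine ⟨fun o => F (g o) rootA', fun o g' t' h ho => ?_⟩
  have hsymbol := hF g' t' h
  rwa [eq_of_mem_orbit of_sum_eq neg_right h (hchain o).dot_gt ho (hgo o)] at hsymbol

end Symbols

section SymbolRelations

variable {C : Type u} [Category.{v} C] [CartesianMonoidalCategory C] [Regular C]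
variable {K : C} [NonUnitalCommRingObj K] {G H : C} [GrpObj G] [GrpObj H] {k : H ⟶ G}
variable {N : rootsD4 → rootsD4 → ℤ} {x : rootsD4 → (K ⟶ G)}

namespace IsSymbolFamily

variable {hk : IsCentralExtension k} {c : Orbit → (K ⟶ H)}

theorem isCentralInvolutive (hc : IsSymbolFamily hk x c) (o : Orbit) (T : C) :
    IsCentralInvolutive fun p : T ⟶ K => p ≫ c o := by
  obtain ⟨s, g, d, hchain, hg, -⟩ := exists_orbit_config o
  exact (hc o g rootA' hchain.dot_gt hg).isCentralInvolutive T

theorem homRootLift_move_mul (hc : IsSymbolFamily hk x c) (hx : SteinbergRelations N x)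
    (hK : IsWeaklyUnital K) (hN : IsSignSystem N) (o : Orbit) {T : C} (a p q b : T ⟶ K) :
    homRootLift hk N x T rootA rootA' a (p * (q * b)) =
      homRootLift hk N x T rootA rootA' (a * p * q) b *
        ((a * p * q * (q * b)) ≫ c o * (a * p * (p * (q * b))) ≫ c o) := by
  obtain ⟨s, g, d, hchain, hg, hd⟩ := exists_orbit_config o
  exact ((hc o g rootA' hchain.dot_gt hg).hasDefect hx hK hN hchain T).comp
    ((hc o rootA d hchain.dot_eq_zero hd).hasDefect hx hK hN hchain.reverse T) a p q b

theorem map_eps (hc : IsSymbolFamily hk x c) (hx : SteinbergRelations N x)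
    (hK : IsWeaklyUnital K) (hN : IsSignSystem N) (o : Orbit) {T : C} (r p q : T ⟶ K) :
    (r * ((p * p - p) * (q * q - q))) ≫ c o = 1 := by
  obtain ⟨T', f, a, d, _, hr⟩ := hK.exists_pow_eight r
  have heps := map_eps_eq_one (hc.isCentralInvolutive o T')
    (hc.homRootLift_move_mul hx hK hN o) a d (f ≫ p) (f ≫ q)
  rw [← hr] at heps
  refine (cancel_epi f).mp ?_
  rw [MonObj.comp_one, ← Category.assoc, ← heps]
  simp only [comp_mul_hom, AddGrpObj.comp_sub]

theorem map_ideal (hc : IsSymbolFamily hk x c) (hx : SteinbergRelations N x)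
    (hK : IsWeaklyUnital K) (hN : IsSignSystem N) (o o' : Orbit) {T : C} (r p : T ⟶ K) :
    (r * (p * p - p)) ≫ c o = (r * (p * p - p)) ≫ c o' := by
  obtain ⟨T', f, a, d, _, hr⟩ := hK.exists_pow_eight r
  have hideal := map_ideal_eq (hc.isCentralInvolutive o T') (hc.isCentralInvolutive o' T')
    (hc.homRootLift_move_mul hx hK hN o) (hc.homRootLift_move_mul hx hK hN o') a d (f ≫ p)
  rw [← hr] at hideal
  refine (cancel_epi f).mp ?_
  rw [← Category.assoc, ← Category.assoc]
  simpa only [comp_mul_hom, AddGrpObj.comp_sub] using hideal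

theorem map_square (hc : IsSymbolFamily hk x c) (hx : SteinbergRelations N x)
    (hK : IsWeaklyUnital K) (hN : IsSignSystem N) {T : C} (p : T ⟶ K) :
    ((p * p) ≫ c .zero) * ((p * p) ≫ c .plus) * ((p * p) ≫ c .minus) = 1 := by
  obtain ⟨T', f, a, d, _, hp⟩ := hK.exists_pow_eight p
  have hBA : IsSymbol hk x rootB rootA' (c .minus) := hc _ _ _ (by decide) (by decide)
  have hCA : IsSymbol hk x rootC rootA' (c .plus) := hc _ _ _ (by decide) (by decide)
  have hBC : IsSymbol hk x rootB' rootC' (c .zero) := hc _ _ _ (by decide) (by decide)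
  have chainAB : IsA3Chain rootA ⟨![0, 0, -1, 1], mem_rootList_iff.mp (by decide)⟩ rootB' rootB
      rootA' := ⟨by decide, by decide, by decide⟩
  have chainAC : IsA3Chain rootA ⟨![0, 0, -1, -1], mem_rootList_iff.mp (by decide)⟩ rootC' rootC
      rootA' := ⟨by decide, by decide, by decide⟩
  have chainCB : IsA3Chain rootC ⟨![-1, 1, 0, 0], mem_rootList_iff.mp (by decide)⟩ rootB rootB'
      rootC' := ⟨by decide, by decide, by decide⟩
  have defectCB : HasDefect (homRootLift hk N x T' rootC rootC')
      (fun a b => homRootLift hk N x T' rootB rootB' b a) fun p => p ≫ c .zero := by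
    intro a b e
    rw [hBC.hasDefect hx hK hN chainCB T']
    congr 1
    exact (hx.isLiftedSteinberg hK hN hk T').rootLift_swap (by decide) _ _
  have htriangle := map_triangle (hc.isCentralInvolutive .zero T')
    (hc.isCentralInvolutive .plus T') (hBA.hasDefect hx hK hN chainAB T')
    (hCA.hasDefect hx hK hN chainAC T') defectCB
    (fun r p => hc.map_ideal hx hK hN _ _ r p) (a * (d * d * (d * d) * d)) d
  have hp' : a * (d * d * (d * d) * d) * (d * (d * d)) = f ≫ p := by rw [hp]; ac_rfl
  rw [hp', ← comp_mul_hom] at htriangle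
  refine (cancel_epi f).mp ?_
  simpa only [MonObj.comp_mul, MonObj.comp_one, ← Category.assoc] using htriangle

end IsSymbolFamily

end SymbolRelations

section EpsSum

variable {R : Type*} [NonUnitalCommRing R]

/-- The sums of `2 q` and `n` multiples of elements `(p ^ 2 - p) (q ^ 2 - q)`. They form the ideal
generated by these two kinds of elements as soon as every element is a product. -/
def IsEpsSum : ℕ → R → Prop
  | 0, a => ∃ q, a = q + q
  | n + 1, a => ∃ b r p q, IsEpsSum n b ∧ a = b + r * ((p * p - p) * (q * q - q))

namespace IsEpsSum

theorem add_double {n : ℕ} {a : R} (h : IsEpsSum n a) (q : R) : IsEpsSum n (a + (q + q)) := by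
  induction n generalizing a with
  | zero =>
    obtain ⟨p, rfl⟩ := h
    exact ⟨p + q, add_add_add_comm p p q q⟩
  | succ n ih =>
    obtain ⟨b, r, p, s, hb, rfl⟩ := h
    exact ⟨_, r, p, s, ih hb, add_right_comm _ _ _⟩

theorem add {n m : ℕ} {a b : R} (ha : IsEpsSum n a) (hb : IsEpsSum m b) :
    IsEpsSum (n + m) (a + b) := by
  induction m generalizing b with
  | zero =>
    obtain ⟨q, rfl⟩ := hb
    exact ha.add_double q
  | succ m ih =>
    obtain ⟨b, r, p, q, hb, rfl⟩ := hb
    exact ⟨_, r, p, q, ih hb, (add_assoc _ _ _).symm⟩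

theorem mul {n : ℕ} {a : R} (h : IsEpsSum n a) (s : R) : IsEpsSum n (s * a) := by
  induction n generalizing a with
  | zero =>
    obtain ⟨q, rfl⟩ := h
    exact ⟨s * q, mul_add _ _ _⟩
  | succ n ih =>
    obtain ⟨b, r, p, q, hb, rfl⟩ := h
    exact ⟨_, s * r, p, q, ih hb, by rw [mul_add, mul_assoc]⟩

theorem neg {n : ℕ} {a : R} (h : IsEpsSum n a) : IsEpsSum n (-a) := by
  induction n generalizing a with
  | zero =>
    obtain ⟨q, rfl⟩ := h
    exact ⟨-q, neg_add _ _⟩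
  | succ n ih =>
    obtain ⟨b, r, p, q, hb, rfl⟩ := h
    exact ⟨_, -r, p, q, ih hb, by rw [neg_add, neg_mul]⟩

theorem map {S F : Type*} [NonUnitalCommRing S] [FunLike F R S] [NonUnitalRingHomClass F R S]
    (f : F) {n : ℕ} {a : R} (h : IsEpsSum n a) : IsEpsSum n (f a) := by
  induction n generalizing a with
  | zero =>
    obtain ⟨q, rfl⟩ := h
    exact ⟨f q, map_add f q q⟩
  | succ n ih =>
    obtain ⟨b, r, p, q, hb, rfl⟩ := h
    exact ⟨_, f r, f p, f q, ih hb, by simp only [map_add, map_mul, map_sub]⟩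

end IsEpsSum

theorem mul_mul_self_sub (p d : R) :
    p * d * (p * d) - p * d = d * d * (p * p - p) + p * (d * d - d) := by
  have hsq : p * d * (p * d) = d * d * (p * p) := by ac_rfl
  have hcross : p * (d * d) = d * d * p := by ac_rfl
  rw [hsq, mul_sub, mul_sub, hcross, sub_add_sub_cancel]

theorem isEpsSum_relator (p d q : R) :
    IsEpsSum 2 ((p * d * (p * d) - p * d) * (q * q - q)) := by
  refine ⟨_, p, d, q, ⟨_, d * d, p, q, ⟨0, rfl⟩, rfl⟩, ?_⟩
  rw [mul_mul_self_sub, add_mul, mul_assoc (d * d), mul_assoc p, add_zero, zero_add]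

end EpsSum

section Homs

variable {C : Type u} [Category.{v} C] [CartesianMonoidalCategory C]

/-- Precomposition, as a homomorphism between the rings of generalized elements. -/
def homPrecomp (R : C) [NonUnitalCommRingObj R] {S T : C} (f : S ⟶ T) :
    (T ⟶ R) →ₙ+* (S ⟶ R) where
  toFun a := f ≫ a
  map_mul' := comp_mul_hom f
  map_zero' := AddMonObj.comp_zero f
  map_add' := AddMonObj.comp_add f

namespace IsRingObjHom

variable {R S : C} [NonUnitalCommRingObj R] [NonUnitalCommRingObj S] {f : R ⟶ S}

theorem map_sub (hf : IsRingObjHom f) {T : C} (a b : T ⟶ R) : (a - b) ≫ f = a ≫ f - b ≫ f := by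
  rw [eq_sub_iff_add_eq, ← hf.map_add, sub_add_cancel]

end IsRingObjHom

theorem comp_eq_comp_of_sub {A G : C} [AddGrpObj A] [GrpObj G] {f : A ⟶ G} (hf : IsAddMulHom f)
    {T : C} {p q : T ⟶ A} (h : (p - q) ≫ f = 1) : p ≫ f = q ≫ f := by
  rw [← sub_add_cancel p q, hf, h, one_mul]

end Homs

section EpsIdeal

variable {C : Type u} [Category.{v} C] [CartesianMonoidalCategory C]
variable (K : C) [NonUnitalCommRingObj K]

variable {K} in
/-- The universal sum of an element parametrized by `φ` and of a multiple of
`(p ^ 2 - p) (q ^ 2 - q)`. -/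
def epsStep {D : C} (φ : D ⟶ K) : (D ⊗ K) ⊗ (K ⊗ K) ⟶ K :=
  let p := snd (D ⊗ K) (K ⊗ K) ≫ fst _ _
  let q := snd (D ⊗ K) (K ⊗ K) ≫ snd _ _
  fst _ _ ≫ fst _ _ ≫ φ + (fst _ _ ≫ snd _ _) * ((p * p - p) * (q * q - q))

/-- The object of parameters of the sums in `IsEpsSum n`. -/
def epsSumObj : ℕ → C
  | 0 => K
  | n + 1 => (epsSumObj n ⊗ K) ⊗ (K ⊗ K)

/-- The universal element satisfying `IsEpsSum n`. -/
def epsSumHom : ∀ n, epsSumObj K n ⟶ K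
  | 0 => 𝟙 K + 𝟙 K
  | n + 1 => epsStep (epsSumHom n)

variable {K}

theorem lift_comp_epsStep {D T : C} (φ : D ⟶ K) (y : T ⟶ D) (r p q : T ⟶ K) :
    lift (lift y r) (lift p q) ≫ epsStep φ = y ≫ φ + r * ((p * p - p) * (q * q - q)) := by
  simp only [epsStep, AddMonObj.comp_add, AddGrpObj.comp_sub, comp_mul_hom, lift_fst_assoc,
    lift_snd_assoc, lift_fst, lift_snd]

theorem IsEpsSum.comp {S T : C} (f : S ⟶ T) {n : ℕ} {a : T ⟶ K} (h : IsEpsSum n a) :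
    IsEpsSum n (f ≫ a) :=
  h.map (homPrecomp K f)

theorem isEpsSum_epsSumHom (n : ℕ) : IsEpsSum n (epsSumHom K n) := by
  induction n with
  | zero => exact ⟨𝟙 K, rfl⟩
  | succ n ih => exact ⟨_, _, _, _, (ih.comp _).comp _, rfl⟩

theorem IsEpsSum.exists_comp_epsSumHom_eq {T : C} {n : ℕ} {a : T ⟶ K} (h : IsEpsSum n a) :
    ∃ y : T ⟶ epsSumObj K n, y ≫ epsSumHom K n = a := by
  induction n generalizing a with
  | zero =>
    obtain ⟨q, rfl⟩ := h
    refine ⟨q, (AddMonObj.comp_add q (𝟙 K) (𝟙 K)).trans ?_⟩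
    rw [Category.comp_id]
  | succ n ih =>
    obtain ⟨b, r, p, q, hb, rfl⟩ := h
    obtain ⟨y, rfl⟩ := ih hb
    exact ⟨_, lift_comp_epsStep (epsSumHom K n) y r p q⟩

variable [Regular C] [HasUniversalCountableCoproducts C]

variable (K) in
/-- The ideal generated by the relators `2 p` and `(p ^ 2 - p) (q ^ 2 - q)`, as the union over `n`
of the images of the sums in `IsEpsSum n`. -/
noncomputable def epsIdeal : Subobject K :=
  imageSubobject (Sigma.desc (epsSumHom K))

theorem IsEpsSum.epsIdeal_factors {T : C} {n : ℕ} {a : T ⟶ K} (h : IsEpsSum n a) :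
    (epsIdeal K).Factors a := by
  obtain ⟨y, rfl⟩ := h.exists_comp_epsSumHom_eq
  rw [← Sigma.ι_desc (epsSumHom K) n, ← Category.assoc]
  exact imageSubobject_factors_comp_self _ _

theorem factors_of_epsIdeal_factors {T Y : C} {a : T ⟶ K} {J : Subobject Y} {b : T ⟶ Y}
    (ha : (epsIdeal K).Factors a)
    (h : ∀ {T' : C} (f : T' ⟶ T) (n : ℕ), IsEpsSum n (f ≫ a) → J.Factors (f ≫ b)) :
    J.Factors b :=
  factors_of_imageSubobject_sigmaDesc_factors (epsSumHom K) ha fun f n y hy =>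
    h f n (hy ▸ (isEpsSum_epsSumHom n).comp y)

theorem isIdeal_epsIdeal : IsIdeal (epsIdeal K) where
  zero_mem := (show IsEpsSum 0 _ from ⟨0, (add_zero 0).symm⟩).epsIdeal_factors
  add_mem a b ha hb := by
    refine factors_of_epsIdeal_factors ha fun f n hn => ?_
    refine factors_of_epsIdeal_factors (Subobject.factors_of_factors_right f hb) fun g m hm => ?_
    rw [AddMonObj.comp_add, AddMonObj.comp_add]
    exact ((hn.comp g).add hm).epsIdeal_factors
  neg_mem a ha := by
    refine factors_of_epsIdeal_factors ha fun f n hn => ?_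
    rw [AddGrpObj.comp_neg]
    exact hn.neg.epsIdeal_factors
  mul_mem r a ha := by
    refine factors_of_epsIdeal_factors ha fun f n hn => ?_
    rw [comp_mul_hom]
    exact (hn.mul _).epsIdeal_factors

theorem TwoEpsRelator.epsIdeal_factors (hK : IsWeaklyUnital K) {T : C} {a : T ⟶ K}
    (ha : TwoEpsRelator T a) : (epsIdeal K).Factors a := by
  obtain ⟨p, rfl⟩ | ⟨p, q, rfl⟩ := ha
  · exact (show IsEpsSum 0 _ from ⟨p, rfl⟩).epsIdeal_factors
  · obtain ⟨T', f, p', d, _, hp⟩ := hK.exists_mul p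
    refine factors_of_cover f ?_
    simp only [comp_mul_hom, AddGrpObj.comp_sub, hp]
    exact (isEpsSum_relator p' d (f ≫ q)).epsIdeal_factors

theorem IsQuotientBySpan.factors_of_comp_eq_zero (hK : IsWeaklyUnital K) {K2e : C}
    [NonUnitalCommRingObj K2e] {π : K ⟶ K2e} (hπ : IsQuotientBySpan TwoEpsRelator π)
    {X : Subobject K} (hX : ∀ {T : C} (n : ℕ) (a : T ⟶ K), IsEpsSum n a → X.Factors a)
    {T : C} {a : T ⟶ K} (ha : a ≫ π = 0) : X.Factors a :=
  factors_of_epsIdeal_factors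
    (hπ.ker_le _ isIdeal_epsIdeal (fun _ _ h => h.epsIdeal_factors hK) a ha)
    fun _ n => hX n _

end EpsIdeal

section Descent

variable {C : Type u} [Category.{v} C] [CartesianMonoidalCategory C]
variable {K : C} [NonUnitalCommRingObj K] {G H : C} [GrpObj G] {k : H ⟶ G}
variable {N : rootsD4 → rootsD4 → ℤ} {x : rootsD4 → (K ⟶ G)}
variable {M : C} {i : M ⟶ H} {K2e : C} [NonUnitalCommRingObj K2e] {π : K ⟶ K2e}

theorem mono_of_isPullback_one (hi : IsPullback i (toUnit M) k η[G]) : Mono i :=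
  ⟨fun _ _ h => hi.hom_ext h (toUnit_unique _ _)⟩

theorem exists_lift_of_isPullback_one (hi : IsPullback i (toUnit M) k η[G]) {T : C} {h : T ⟶ H}
    (hh : h ≫ k = 1) : ∃ m : T ⟶ M, m ≫ i = h :=
  ⟨hi.lift h (toUnit T) (by rw [hh]; rfl), hi.lift_fst _ _ _⟩

variable [GrpObj H]

theorem isAddMulHom_of_comp [Regular C] [GrpObj M] [IsMonHom i] [Mono i] (hπ : IsRingObjHom π)
    [IsRegularEpi π] {c : K2e ⟶ M} (hc : IsAddMulHom (π ≫ c ≫ i)) : IsAddMulHom c := by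
  intro T p q
  obtain ⟨T', e, p', q', _, hp, hq⟩ := exists_local_lift₂ π π p q
  have hsum : (p' + q') ≫ π = e ≫ (p + q) := by rw [hπ.map_add, hp, hq, AddMonObj.comp_add]
  have hcomp := hc p' q'
  simp only [← Category.assoc, hp, hq, hsum] at hcomp
  rw [← cancel_mono i, ← cancel_epi e, MonObj.mul_comp, MonObj.comp_mul]
  simpa only [Category.assoc] using hcomp

namespace IsSymbolFamily

variable [Regular C] {hk : IsCentralExtension k} {c : Orbit → (K ⟶ H)}

theorem map_add (hc : IsSymbolFamily hk x c) (o : Orbit) : IsAddMulHom (c o) := fun {T} p q =>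
  (hc.isCentralInvolutive o T).map_add p q

theorem map_isEpsSum (hc : IsSymbolFamily hk x c) (hx : SteinbergRelations N x)
    (hK : IsWeaklyUnital K) (hN : IsSignSystem N) (o : Orbit) {T : C} {n : ℕ} {a : T ⟶ K}
    (ha : IsEpsSum n a) : a ≫ c o = 1 := by
  induction n generalizing a with
  | zero =>
    obtain ⟨q, rfl⟩ := ha
    rw [hc.map_add, (hc.isCentralInvolutive o T).mul_self]
  | succ n ih =>
    obtain ⟨b, r, p, q, hb, rfl⟩ := ha
    rw [hc.map_add, ih hb, hc.map_eps hx hK hN, one_mul]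

theorem comp_eq_one (hc : IsSymbolFamily hk x c) (hx : SteinbergRelations N x)
    (hK : IsWeaklyUnital K) (o : Orbit) : c o ≫ k = 1 := by
  obtain ⟨s, g, d, hchain, ho, -⟩ := exists_orbit_config o
  obtain ⟨T, f, p, q, _, hf⟩ := hK.exists_mul (𝟙 K)
  have hcomm : (p * q) ≫ c o ≫ k = 1 := by
    rw [← Category.assoc, ← (hc o g rootA' hchain.dot_gt ho).liftedComm_eq,
      hk.liftedComm_comp_hom, hx.commutator_one_of_dot_nonneg hchain.dot_gt.ge]
  rw [Category.comp_id] at hf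
  rw [← cancel_epi f, hf, hcomm, MonObj.comp_one]

variable [HasUniversalCountableCoproducts C]

theorem exists_desc (hc : IsSymbolFamily hk x c) (hx : SteinbergRelations N x)
    (hK : IsWeaklyUnital K) (hN : IsSignSystem N) (hπ : IsQuotientBySpan TwoEpsRelator π)
    (o : Orbit) : ∃ c' : K2e ⟶ H, π ≫ c' = c o := by
  have := hπ.isRegularEpi
  refine exists_desc_of_cover π (c o) fun p q hpq => comp_eq_comp_of_sub (hc.map_add o) ?_
  have hker : (equalizerSubobject (c o) 1).Factors (p - q) :=
    hπ.factors_of_comp_eq_zero hK (fun n a ha => equalizerSubobject_factors _ _ _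
      (by rw [hc.map_isEpsSum hx hK hN o ha, MonObj.comp_one]))
      (by rw [hπ.isHom.map_sub, hpq, sub_self])
  rwa [equalizerSubobject_factors_iff, MonObj.comp_one] at hker

theorem exists_orbitHom (hc : IsSymbolFamily hk x c) (hx : SteinbergRelations N x)
    (hK : IsWeaklyUnital K) (hN : IsSignSystem N) (hπ : IsQuotientBySpan TwoEpsRelator π)
    [GrpObj M] (hM : IsMonHom i) (hi : IsPullback i (toUnit M) k η[G]) (o : Orbit) :
    ∃ c' : K2e ⟶ M, π ≫ c' ≫ i = c o ∧ IsOrbitHom x k i π o c' := by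
  have := mono_of_isPullback_one hi
  have := hπ.isRegularEpi
  obtain ⟨d, hd⟩ := hc.exists_desc hx hK hN hπ o
  have hdk : d ≫ k = 1 := by
    rw [← cancel_epi π, ← Category.assoc, hd, hc.comp_eq_one hx hK o, MonObj.comp_one]
  obtain ⟨c', rfl⟩ := exists_lift_of_isPullback_one hi hdk
  refine ⟨c', hd, isAddMulHom_of_comp hπ.isHom (hd ▸ hc.map_add o), ?_⟩
  intro a b hab ho T p q g h hg hh
  rw [hd, ← (hc o a b hab ho).liftedComm_eq, ← hg, ← hh, hk.liftedComm_comp]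

end IsSymbolFamily

theorem IsOrbitHom.unique [Regular C] (hK : IsWeaklyUnital K) (hk : IsCentralExtension k)
    [IsRegularEpi π] [GrpObj M] [Mono i] {o : Orbit} {c₁ c₂ : K2e ⟶ M}
    (h₁ : IsOrbitHom x k i π o c₁) (h₂ : IsOrbitHom x k i π o c₂) : c₁ = c₂ := by
  obtain ⟨s, g, d, hchain, ho, -⟩ := exists_orbit_config o
  obtain ⟨T, f, p, q, _, hf⟩ := hK.exists_mul (𝟙 K)
  obtain ⟨T', e, l, m, _, hl, hm⟩ := hk.exists_lift₂ (p ≫ x g) (q ≫ x rootA')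
  rw [← Category.assoc] at hl hm
  have hcomm := (h₁.commutator_eq g rootA' hchain.dot_gt ho _ _ l m hl hm).symm.trans
    (h₂.commutator_eq g rootA' hchain.dot_gt ho _ _ l m hl hm)
  rw [Category.comp_id] at hf
  rw [← comp_mul_hom, ← hf] at hcomm
  exact (cancel_mono i).mp ((cancel_epi π).mp ((cancel_epi (e ≫ f)).mp hcomm))

end Descent

section BooleanQuotient

theorem add_mul_self_of_two_torsion {R : Type*} [NonUnitalCommRing R] (h : ∀ p : R, p + p = 0)
    (p q : R) : (p + q) * (p + q) = p * p + q * q := by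
  rw [mul_add, add_mul, add_mul, mul_comm q p, add_assoc, ← add_assoc (p * q), h,
    zero_add]

variable {C : Type u} [Category.{v} C] [CartesianMonoidalCategory C] [Regular C]
variable {K : C} [NonUnitalCommRingObj K]
variable {K2e : C} [NonUnitalCommRingObj K2e] {π : K ⟶ K2e}

namespace IsQuotientBySpan

theorem two_torsion (hπ : IsQuotientBySpan TwoEpsRelator π) {T : C} (p : T ⟶ K2e) :
    p + p = 0 := by
  have := hπ.isRegularEpi
  obtain ⟨T', e, p', _, hp⟩ := exists_local_lift π p
  refine (cancel_epi e).mp ?_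
  rw [AddMonObj.comp_add, ← hp, ← hπ.isHom.map_add, hπ.relation _ (.inl ⟨p', rfl⟩),
    AddMonObj.comp_zero]

theorem eps_relation (hπ : IsQuotientBySpan TwoEpsRelator π) {T : C} (p q : T ⟶ K2e) :
    (p * p - p) * (q * q - q) = 0 := by
  have := hπ.isRegularEpi
  obtain ⟨T', e, p', q', _, hp, hq⟩ := exists_local_lift₂ π π p q
  refine (cancel_epi e).mp ?_
  simp only [comp_mul_hom, AddGrpObj.comp_sub, ← hp, ← hq, ← hπ.isHom.map_mul,
    ← hπ.isHom.map_sub]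
  rw [hπ.relation _ (.inr ⟨p', q', rfl⟩), AddMonObj.comp_zero]

variable {K2 : C} [NonUnitalCommRingObj K2] {ρ : K2e ⟶ K2}

omit [Regular C] in
theorem mul_self_comp (hρ : IsQuotientBySpan BooleanRelator ρ) {T : C} (p : T ⟶ K2e) :
    (p * p) ≫ ρ = p ≫ ρ := by
  rw [← sub_eq_zero, ← hρ.isHom.map_sub]
  exact hρ.relation _ (.inr ⟨p, rfl⟩)

/-- The elements with zero squares form an ideal, which contains all `p ^ 2 - p`. -/
theorem mul_self_eq_zero (hπ : IsQuotientBySpan TwoEpsRelator π)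
    (hρ : IsQuotientBySpan BooleanRelator ρ) {T : C} {p : T ⟶ K2e} (hp : p ≫ ρ = 0) :
    p * p = 0 := by
  have factors_iff {T : C} (a : T ⟶ K2e) :
      (equalizerSubobject (𝟙 K2e * 𝟙 K2e) 0).Factors a ↔ a * a = 0 := by
    rw [equalizerSubobject_factors_iff, comp_mul_hom, Category.comp_id, AddMonObj.comp_zero]
  refine (factors_iff p).mp (hρ.ker_le _ ⟨?_, ?_, ?_, ?_⟩ ?_ p hp)
  · intro T
    rw [factors_iff, mul_zero]
  · intro T a b ha hb
    rw [factors_iff] at ha hb ⊢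
    rw [add_mul_self_of_two_torsion hπ.two_torsion, ha, hb, add_zero]
  · intro T a ha
    rw [factors_iff] at ha ⊢
    rw [neg_mul_neg, ha]
  · intro T r a ha
    rw [factors_iff] at ha ⊢
    rw [mul_mul_mul_comm, ha, mul_zero]
  · rintro T a (⟨q, rfl⟩ | ⟨q, rfl⟩)
    · rw [factors_iff, hπ.two_torsion, mul_zero]
    · rw [factors_iff, hπ.eps_relation]

theorem exists_comp_eq_mul_self (hπ : IsQuotientBySpan TwoEpsRelator π)
    (hρ : IsQuotientBySpan BooleanRelator ρ) :
    ∃ s : K2 ⟶ K2e, ∀ {T : C} (p : T ⟶ K2e), (p ≫ ρ) ≫ s = p * p := by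
  have := hρ.isRegularEpi
  obtain ⟨s, hs⟩ := exists_desc_of_cover ρ (𝟙 K2e * 𝟙 K2e) fun {T} p q hpq => by
    have hsq : (p - q) * (p - q) = 0 :=
      hπ.mul_self_eq_zero hρ (by rw [hρ.isHom.map_sub, hpq, sub_self])
    have hadd := add_mul_self_of_two_torsion hπ.two_torsion (p - q) q
    rw [sub_add_cancel, hsq, zero_add] at hadd
    rw [comp_mul_hom, comp_mul_hom, Category.comp_id, Category.comp_id, hadd]
  exact ⟨s, fun p => by rw [Category.assoc, hs, comp_mul_hom, Category.comp_id]⟩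

theorem exists_section (hπ : IsQuotientBySpan TwoEpsRelator π)
    (hρ : IsQuotientBySpan BooleanRelator ρ) :
    ∃ s : K2 ⟶ K2e, IsRingObjHom s ∧ s ≫ ρ = 𝟙 K2 ∧ ρ ≫ s = 𝟙 K2e * 𝟙 K2e := by
  have := hρ.isRegularEpi
  obtain ⟨s, hs⟩ := hπ.exists_comp_eq_mul_self hρ
  have hs_id : ρ ≫ s = 𝟙 K2e * 𝟙 K2e := by rw [← hs, Category.id_comp]
  refine ⟨s, ⟨fun {T} a b => ?_, fun {T} a b => ?_⟩, ?_, hs_id⟩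
  · obtain ⟨T', e, a', b', _, ha, hb⟩ := exists_local_lift₂ ρ ρ a b
    refine (cancel_epi e).mp ?_
    simp only [AddMonObj.comp_add, ← Category.assoc, ← ha, ← hb, ← hρ.isHom.map_add, hs]
    exact add_mul_self_of_two_torsion hπ.two_torsion a' b'
  · obtain ⟨T', e, a', b', _, ha, hb⟩ := exists_local_lift₂ ρ ρ a b
    refine (cancel_epi e).mp ?_
    simp only [comp_mul_hom, ← Category.assoc, ← ha, ← hb, ← hρ.isHom.map_mul, hs]
    exact mul_mul_mul_comm a' b' a' b'
  · rw [← cancel_epi ρ, ← Category.assoc, hs_id, hρ.mul_self_comp, Category.comp_id,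
      Category.id_comp]

/-- An element `q d` of the kernel of `ρ` has zero square, hence equals `(q d) ^ 2 - q d`. -/
theorem exists_local_eq_of_comp_eq_zero (hπ : IsQuotientBySpan TwoEpsRelator π)
    (hρ : IsQuotientBySpan BooleanRelator ρ) (hK : IsWeaklyUnital K) {T : C} {p : T ⟶ K2e}
    (hp : p ≫ ρ = 0) : ∃ (T' : C) (e : T' ⟶ T) (q d : T' ⟶ K), IsRegularEpi e ∧
      e ≫ p = (d * d * (q * q - q)) ≫ π + (q * (d * d - d)) ≫ π := by
  have := hπ.isRegularEpi
  obtain ⟨T₁, e₁, p₁, _, hp₁⟩ := exists_local_lift π p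
  obtain ⟨T₂, e₂, q, d, _, hqd⟩ := hK.exists_mul p₁
  refine ⟨T₂, e₂ ≫ e₁, q, d, inferInstance, ?_⟩
  have hlift : (q * d) ≫ π = (e₂ ≫ e₁) ≫ p := by rw [← hqd, Category.assoc, Category.assoc, hp₁]
  rw [← hπ.isHom.map_add, ← mul_mul_self_sub, hπ.isHom.map_sub, hπ.isHom.map_mul, hlift,
    ← comp_mul_hom, hπ.mul_self_eq_zero hρ hp, AddMonObj.comp_zero, zero_sub]
  exact eq_neg_of_add_eq_zero_left (hπ.two_torsion _)

theorem comp_eq_of_ideal (hπ : IsQuotientBySpan TwoEpsRelator π)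
    (hρ : IsQuotientBySpan BooleanRelator ρ) (hK : IsWeaklyUnital K) {M : C} [GrpObj M]
    {c c' : K2e ⟶ M} (hc : IsAddMulHom c) (hc' : IsAddMulHom c')
    (h : ∀ {T : C} (r p : T ⟶ K), (r * (p * p - p)) ≫ π ≫ c = (r * (p * p - p)) ≫ π ≫ c')
    {T : C} {p : T ⟶ K2e} (hp : p ≫ ρ = 0) : p ≫ c = p ≫ c' := by
  obtain ⟨T', e, q, d, _, hqd⟩ := hπ.exists_local_eq_of_comp_eq_zero hρ hK hp
  refine (cancel_epi e).mp ?_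
  rw [← Category.assoc, ← Category.assoc, hqd, hc, hc']
  simp only [Category.assoc, h]

end IsQuotientBySpan

end BooleanQuotient

section SteinbergSection

variable {C : Type u} [Category.{v} C] [CartesianMonoidalCategory C] [Regular C]
variable {K : C} [NonUnitalCommRingObj K] {G H : C} [GrpObj G] [GrpObj H] {k : H ⟶ G}
variable {N : rootsD4 → rootsD4 → ℤ} {x : rootsD4 → (K ⟶ G)} {hk : IsCentralExtension k}

theorem comp_homRootLift {S T : C} (f : S ⟶ T) (a b : rootsD4) (p q : T ⟶ K) :
    f ≫ homRootLift hk N x T a b p q = homRootLift hk N x S a b (f ≫ p) (f ≫ q) := by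
  have hsmul : f ≫ (N a b • p) = N a b • (f ≫ p) := map_zsmul (homPrecomp K f) _ _
  rw [homRootLift, homRootLift, IsLiftedSteinberg.rootLift, IsLiftedSteinberg.rootLift,
    hk.comp_liftedComm, ← Category.assoc, ← Category.assoc, hsmul]

/-- The lifted commutators of root elements with orthogonal roots are trivial. -/
def HasTrivialSymbols (hk : IsCentralExtension k) (x : rootsD4 → (K ⟶ G)) : Prop :=
  ∀ g t : rootsD4, g.1 ⬝ᵥ t.1 = 0 → ∀ {T : C} (p q : T ⟶ K),
    hk.liftedComm (p ≫ x g) (q ≫ x t) = 1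

namespace HasTrivialSymbols

theorem homRootLift_of_isA3Chain (h : HasTrivialSymbols hk x) (hx : SteinbergRelations N x)
    (hK : IsWeaklyUnital K) (hN : IsSignSystem N) {r s d g t : rootsD4}
    (hchain : IsA3Chain r s d g t) {T : C} (p q u : T ⟶ K) :
    homRootLift hk N x T r t p (q * u) = homRootLift hk N x T g d (p * q) u := by
  have hdefect := (hx.isLiftedSteinberg hK hN hk T).rootLift_triple hchain (P := fun _ => 1)
    (h g t hchain.dot_gt) ⟨fun _ _ => (one_mul 1).symm, fun _ => one_mul 1,
      fun _ => Commute.one_left⟩ p q u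
  rwa [mul_one] at hdefect

theorem homRootLift_balanced (h : HasTrivialSymbols hk x) (hx : SteinbergRelations N x)
    (hK : IsWeaklyUnital K) (hN : IsSignSystem N) {r t : rootsD4} (hrt : r.1 ⬝ᵥ t.1 = -1) {T : C}
    (a b c : T ⟶ K) :
    homRootLift hk N x T r t (a * b) c = homRootLift hk N x T r t a (b * c) := by
  obtain ⟨s, d, g, hchain⟩ := exists_isA3Chain_of_dot_eq_neg_one hrt
  obtain ⟨T', f, b₁, b₂, _, hb⟩ := hK.exists_mul b
  refine (cancel_epi f).mp ?_
  rw [comp_homRootLift, comp_homRootLift, comp_mul_hom, comp_mul_hom, hb, mul_assoc b₁,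
    h.homRootLift_of_isA3Chain hx hK hN hchain,
    h.homRootLift_of_isA3Chain hx hK hN hchain.reverse, mul_assoc (f ≫ a)]

theorem exists_comp_eq_homRootLift (h : HasTrivialSymbols hk x) (hx : SteinbergRelations N x)
    (hK : IsWeaklyUnital K) (hN : IsSignSystem N) {a b : rootsD4} (hab : a.1 ⬝ᵥ b.1 = -1) :
    ∃ z : K ⟶ H, IsAddMulHom z ∧
      ∀ {T : C} (p q : T ⟶ K), (p * q) ≫ z = homRootLift hk N x T a b p q := by
  let y : K ⊗ K ⟶ H := homRootLift hk N x (K ⊗ K) a b (fst K K) (snd K K)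
  have hy {T : C} (p q : T ⟶ K) : lift p q ≫ y = homRootLift hk N x T a b p q := by
    rw [comp_homRootLift, lift_fst, lift_snd]
  obtain ⟨z, hz⟩ := hK.exists_factor_mul y fun p q u => by
    rw [hy, hy, h.homRootLift_balanced hx hK hN hab]
  refine ⟨z, hK.isAddMulHom_of_factor_mul hz fun {T} p p' q => ?_, fun p q => by rw [hz, hy]⟩
  rw [hy, hy, hy]
  exact (hx.isLiftedSteinberg hK hN hk T).rootLift_add_left hab p p' q

theorem exists_rootHom (h : HasTrivialSymbols hk x) (hx : SteinbergRelations N x)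
    (hK : IsWeaklyUnital K) (hN : IsSignSystem N) (c : rootsD4) :
    ∃ z : K ⟶ H, IsAddMulHom z ∧ ∀ a b : rootsD4, c.1 = a.1 + b.1 → ∀ {T : C} (p q : T ⟶ K),
      (p * q) ≫ z = homRootLift hk N x T a b p q := by
  have : Nonempty (K ⟶ H) := ⟨1⟩
  choose! F hFadd hF using fun (a b : rootsD4) (hab : a.1 ⬝ᵥ b.1 = -1) =>
    h.exists_comp_eq_homRootLift hx hK hN hab
  have hFeq {a b a' b' : rootsD4} (hc : c.1 = a.1 + b.1) (hc' : c.1 = a'.1 + b'.1) :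
      F a b = F a' b' := by
    obtain ⟨T, f, u, d, _, hf⟩ := hK.exists_pow_eight (𝟙 K)
    rw [Category.comp_id] at hf
    refine eq_of_decomposition (fun {a b} hab => ?_) (fun {r s d g t} hchain => ?_) hc hc'
    · rw [← cancel_epi f, hf, hF a b hab, mul_comm u, hF b a (by rw [dotProduct_comm, hab])]
      exact ((hx.isLiftedSteinberg hK hN hk T).rootLift_swap hab _ _).symm
    · rw [← cancel_epi f, hf, hF r t hchain.dot_rt, ← mul_assoc u, hF g d hchain.dot_gd,
        h.homRootLift_of_isA3Chain hx hK hN hchain]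
  obtain ⟨a, b, hc⟩ := exists_eq_root_add c
  refine ⟨F a b, hFadd a b (root_dot_of_add hc), fun a' b' hc' T p q => ?_⟩
  rw [hFeq hc hc', hF a' b' (root_dot_of_add hc')]

theorem exists_section (h : HasTrivialSymbols hk x) (hx : SteinbergRelations N x)
    (hK : IsWeaklyUnital K) (hN : IsSignSystem N) :
    ∃ z : rootsD4 → (K ⟶ H), SteinbergRelations N z ∧ ∀ a, z a ≫ k = x a := by
  choose z hadd hz using h.exists_rootHom hx hK hN
  have hzk (c : rootsD4) : z c ≫ k = x c := by
    obtain ⟨a, b, hc⟩ := exists_eq_root_add c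
    have := hK.isRegularEpi_mul
    rw [← cancel_epi (fst K K * snd K K), ← Category.assoc, hz c a b hc]
    refine (hk.liftedComm_comp_hom _ _).trans ?_
    rw [hx.commutator_root a b c hc, smul_mul_assoc, smul_smul, hN.sq (root_dot_of_add hc),
      one_smul]
  have hcomm (a b : rootsD4) {T : C} (p q : T ⟶ K) :
      ⁅p ≫ z a, q ≫ z b⁆ = hk.liftedComm (p ≫ x a) (q ≫ x b) := by
    rw [← hk.liftedComm_comp, Category.assoc, Category.assoc, hzk, hzk]
  refine ⟨z, ⟨hadd, fun a b c hc T p q => ?_, fun a b hab hab' T p q => ?_⟩, hzk⟩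
  · rw [hcomm, ← smul_mul_assoc, hz c a b hc, homRootLift, IsLiftedSteinberg.rootLift, smul_smul,
      hN.sq (root_dot_of_add hc), one_smul]
  · have hdot := neg_two_le_root_dot a b
    have h_neg_one : a.1 ⬝ᵥ b.1 ≠ -1 := fun hdot => hab (root_add_mem hdot)
    have h_neg_two : a.1 ⬝ᵥ b.1 ≠ -2 := fun hdot => hab' (root_add_eq_zero hdot)
    rw [hcomm]
    obtain hpos | horth : 0 < a.1 ⬝ᵥ b.1 ∨ a.1 ⬝ᵥ b.1 = 0 := by omega
    · exact (hx.isLiftedSteinberg hK hN hk T).nonorth a b hpos p q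
    · exact h a b horth p q

end HasTrivialSymbols

end SteinbergSection

section Quotient

variable {C : Type u} [Category.{v} C] [CartesianMonoidalCategory C]

theorem isMonHom_of_map_mul {G H : C} [GrpObj G] [GrpObj H] {f : G ⟶ H}
    (h : ∀ {T : C} (a b : T ⟶ G), (a * b) ≫ f = (a ≫ f) * (b ≫ f)) : IsMonHom f where
  one_hom := by
    have h_one := h (1 : 𝟙_ C ⟶ G) 1
    rw [one_mul, left_eq_mul] at h_one
    simpa only [Hom.one_def, toUnit_unit, Category.id_comp] using h_one
  mul_hom := by
    simpa only [Hom.mul_def, lift_fst_snd, Category.id_comp, lift_fst_comp_snd_comp] using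
      h (fst G G) (snd G G)

theorem exists_grpObj_of_left_axioms {B : C} (m : B ⊗ B ⟶ B) (e : 𝟙_ C ⟶ B) (n : B ⟶ B)
    (assoc : ∀ {T : C} (a b c : T ⟶ B),
      lift (lift a b ≫ m) c ≫ m = lift a (lift b c ≫ m) ≫ m)
    (one_mul : ∀ {T : C} (b : T ⟶ B), lift (toUnit T ≫ e) b ≫ m = b)
    (inv_mul : ∀ {T : C} (b : T ⟶ B), lift (b ≫ n) b ≫ m = toUnit T ≫ e) :
    ∃ g : GrpObj B, g.mul = m := by
  let group (T : C) : Group (T ⟶ B) :=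
    letI : Mul (T ⟶ B) := ⟨fun a b => lift a b ≫ m⟩
    letI : One (T ⟶ B) := ⟨toUnit T ≫ e⟩
    letI : Inv (T ⟶ B) := ⟨fun b => b ≫ n⟩
    Group.ofLeftAxioms assoc one_mul inv_mul
  let F : Cᵒᵖ ⥤ GrpCat :=
    { obj T := GrpCat.of (T.unop ⟶ B)
      map f := GrpCat.ofHom (MonoidHom.mk' (fun b => f.unop ≫ b) fun a b =>
        comp_lift_assoc f.unop a b m) }
  let α : (F ⋙ forget GrpCat).RepresentableBy B :=
    { homEquiv := Equiv.refl _
      homEquiv_comp _ _ := rfl }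
  refine ⟨GrpObj.ofRepresentableBy B F α, ?_⟩
  change lift (fst B B) (snd B B) ≫ m = m
  rw [lift_fst_snd, Category.id_comp]

variable {G H B : C} [GrpObj G] [GrpObj H]

theorem exists_comp_eq_inv_comp (q : H ⟶ B) [IsRegularEpi q]
    (hq : ∀ {T : C} (a b a' b' : T ⟶ H), a ≫ q = a' ≫ q → b ≫ q = b' ≫ q →
      (a * b) ≫ q = (a' * b') ≫ q) :
    ∃ n : B ⟶ B, ∀ {T : C} (a : T ⟶ H), (a ≫ q) ≫ n = a⁻¹ ≫ q := by
  obtain ⟨n, hn⟩ := exists_desc_of_cover q ((𝟙 H)⁻¹ ≫ q) fun a b hab => by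
    rw [← Category.assoc, ← Category.assoc, GrpObj.comp_inv, GrpObj.comp_inv, Category.comp_id,
      Category.comp_id]
    have hq_inv := hq a⁻¹ (b * b⁻¹) a⁻¹ (a * b⁻¹) rfl (hq b b⁻¹ a b⁻¹ hab.symm rfl)
    simpa only [mul_inv_cancel, mul_one, inv_mul_cancel_left] using hq_inv
  refine ⟨n, fun a => ?_⟩
  rw [Category.assoc, hn, ← Category.assoc, GrpObj.comp_inv, Category.comp_id]

variable [Regular C]

theorem exists_lift_comp_eq_mul_comp (q : H ⟶ B) [IsRegularEpi q]
    (hq : ∀ {T : C} (a b a' b' : T ⟶ H), a ≫ q = a' ≫ q → b ≫ q = b' ≫ q →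
      (a * b) ≫ q = (a' * b') ≫ q) :
    ∃ m : B ⊗ B ⟶ B, ∀ {T : C} (a b : T ⟶ H), lift (a ≫ q) (b ≫ q) ≫ m = (a * b) ≫ q := by
  have := isRegularEpi_tensorHom q q
  obtain ⟨m, hm⟩ := exists_desc_of_cover (q ⊗ₘ q) ((fst H H * snd H H) ≫ q) fun u v huv => by
    rw [← Category.assoc, ← Category.assoc, MonObj.comp_mul, MonObj.comp_mul]
    refine hq _ _ _ _ ?_ ?_
    · simpa only [Category.assoc, tensorHom_fst] using congrArg (· ≫ fst B B) huv
    · simpa only [Category.assoc, tensorHom_snd] using congrArg (· ≫ snd B B) huv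
  refine ⟨m, fun a b => ?_⟩
  rw [← lift_map, Category.assoc, hm, ← Category.assoc, MonObj.comp_mul, lift_fst, lift_snd]

theorem exists_grpObj_of_isRegularEpi (q : H ⟶ B) [IsRegularEpi q]
    (hq : ∀ {T : C} (a b a' b' : T ⟶ H), a ≫ q = a' ≫ q → b ≫ q = b' ≫ q →
      (a * b) ≫ q = (a' * b') ≫ q) : ∃ _ : GrpObj B, IsMonHom q := by
  obtain ⟨m, hm⟩ := exists_lift_comp_eq_mul_comp q hq
  obtain ⟨n, hn⟩ := exists_comp_eq_inv_comp q hq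
  have h_one (T : C) : toUnit T ≫ η[H] ≫ q = (1 : T ⟶ H) ≫ q := by
    rw [Hom.one_def, Category.assoc]
  obtain ⟨g, rfl⟩ := exists_grpObj_of_left_axioms m (η[H] ≫ q) n
    (fun a b c => by
      obtain ⟨T₁, e₁, a', b', _, ha, hb⟩ := exists_local_lift₂ q q a b
      obtain ⟨T₂, e₂, c', _, hc⟩ := exists_local_lift q (e₁ ≫ c)
      refine (cancel_epi (e₂ ≫ e₁)).mp ?_
      simp only [comp_lift_assoc, Category.assoc, ← ha, ← hb, ← hc]
      simp only [← Category.assoc, hm, mul_assoc])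
    (fun b => by
      obtain ⟨T', e, b', _, hb⟩ := exists_local_lift q b
      refine (cancel_epi e).mp ?_
      rw [comp_lift_assoc, comp_toUnit_assoc, h_one, ← hb, hm, one_mul])
    (fun b => by
      obtain ⟨T', e, b', _, hb⟩ := exists_local_lift q b
      refine (cancel_epi e).mp ?_
      rw [comp_lift_assoc, comp_toUnit_assoc, h_one, ← Category.assoc, ← hb, hn, hm,
        inv_mul_cancel])
  exact ⟨g, isMonHom_of_map_mul fun a b => (hm a b).symm⟩

theorem isMonHom_of_comp [GrpObj B] {q : H ⟶ B} [IsMonHom q] [IsRegularEpi q] {d : B ⟶ G}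
    (hqd : IsMonHom (q ≫ d)) : IsMonHom d := by
  refine isMonHom_of_map_mul fun a b => ?_
  obtain ⟨T', e, a', b', _, ha, hb⟩ := exists_local_lift₂ q q a b
  refine (cancel_epi e).mp ?_
  rw [MonObj.comp_mul, ← Category.assoc, ← Category.assoc, ← Category.assoc, MonObj.comp_mul,
    ← ha, ← hb, ← MonObj.mul_comp, Category.assoc, Category.assoc, Category.assoc,
    MonObj.mul_comp]

theorem IsCentralExtension.exists_desc {k : H ⟶ G} (hk : IsCentralExtension k) [GrpObj B]
    (q : H ⟶ B) [IsMonHom q] [IsRegularEpi q]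
    (hqk : ∀ {T : C} (a : T ⟶ H), a ≫ q = 1 → a ≫ k = 1) :
    ∃ d : B ⟶ G, IsCentralExtension d ∧ q ≫ d = k := by
  have := hk.isMonHom
  obtain ⟨d, rfl⟩ := exists_desc_of_cover q k fun a b hab => by
    rw [← div_eq_one, ← GrpObj.div_comp]
    exact hqk _ (by rw [GrpObj.div_comp, hab, div_self'])
  have := hk.isRegularEpi
  refine ⟨d, ⟨isMonHom_of_comp hk.isMonHom, isRegularEpi_of_comp q d, fun z h hz => ?_⟩, rfl⟩
  obtain ⟨T', e, z', h', _, hz', hh'⟩ := exists_local_lift₂ q q z h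
  refine (cancel_epi e).mp ?_
  have hzk : z' ≫ q ≫ d = 1 := by rw [reassoc_of% hz', hz, MonObj.comp_one]
  rw [MonObj.comp_mul, MonObj.comp_mul, ← hz', ← hh', ← MonObj.mul_comp, hk.central z' h' hzk,
    MonObj.mul_comp]

end Quotient

section CentralSubgroups

/-- The generalized elements that factor through `m` form central subgroups of the groups
`T ⟶ H`. The morphism `m` is not required to be a monomorphism, so that this notion applies to
the parametrization of a subgroup by a product. -/
structure IsCentralSubgroup {C : Type u} [Category.{v} C] [CartesianMonoidalCategory C]
    {W H : C} [GrpObj H] (m : W ⟶ H) : Prop where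
  one : ∀ T : C, ∃ u : T ⟶ W, u ≫ m = 1
  mul : ∀ {T : C} (v w : T ⟶ W), ∃ u : T ⟶ W, u ≫ m = (v ≫ m) * (w ≫ m)
  inv : ∀ {T : C} (v : T ⟶ W), ∃ u : T ⟶ W, u ≫ m = (v ≫ m)⁻¹
  central : ∀ {T : C} (v : T ⟶ W) (h : T ⟶ H), Commute (v ≫ m) h

variable {C : Type u} [Category.{v} C] [CartesianMonoidalCategory C]

theorem IsAddMulHom.isCentralSubgroup {A H : C} [AddGrpObj A] [GrpObj H] {f : A ⟶ H}
    (hf : IsAddMulHom f) (hcentral : ∀ {T : C} (a : T ⟶ A) (h : T ⟶ H), Commute (a ≫ f) h) :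
    IsCentralSubgroup f := by
  have map_zero (T : C) : (0 : T ⟶ A) ≫ f = 1 := by
    have hzero := hf (0 : T ⟶ A) 0
    rwa [add_zero, left_eq_mul] at hzero
  exact ⟨fun T => ⟨0, map_zero T⟩, fun v w => ⟨v + w, hf v w⟩,
    fun v => ⟨-v, by rw [eq_inv_iff_mul_eq_one, ← hf, neg_add_cancel, map_zero]⟩, hcentral⟩

namespace IsCentralSubgroup

variable {H : C} [GrpObj H]

theorem prod {A B : C} {f : A ⟶ H} {g : B ⟶ H} (hf : IsCentralSubgroup f)
    (hg : IsCentralSubgroup g) : IsCentralSubgroup ((fst A B ≫ f) * (snd A B ≫ g)) := by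
  have comp_eq {T : C} (v : T ⟶ A ⊗ B) : v ≫ ((fst A B ≫ f) * (snd A B ≫ g)) =
      ((v ≫ fst A B) ≫ f) * ((v ≫ snd A B) ≫ g) := by
    rw [MonObj.comp_mul, Category.assoc, Category.assoc]
  have exists_of {T : C} {a b : T ⟶ H} (ha : ∃ u, u ≫ f = a) (hb : ∃ u, u ≫ g = b) :
      ∃ u, u ≫ ((fst A B ≫ f) * (snd A B ≫ g)) = a * b := by
    obtain ⟨u, rfl⟩ := ha
    obtain ⟨v, rfl⟩ := hb
    exact ⟨lift u v, by rw [comp_eq, lift_fst, lift_snd]⟩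
  refine ⟨fun T => ?_, fun v w => ?_, fun v => ?_, fun v h => ?_⟩
  · simpa only [one_mul] using exists_of (hf.one T) (hg.one T)
  · rw [comp_eq, comp_eq, (hf.central (w ≫ fst A B) _).symm.mul_mul_mul_comm]
    exact exists_of (hf.mul _ _) (hg.mul _ _)
  · rw [comp_eq, (hf.central _ _).mul_inv]
    exact exists_of (hf.inv _) (hg.inv _)
  · rw [comp_eq]
    exact (hf.central _ h).mul_left (hg.central _ h)

variable {W : C} {m : W ⟶ H}

theorem of_comp [Regular C] {X : C} (e : X ⟶ W) [IsRegularEpi e] [Mono m]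
    (h : IsCentralSubgroup (e ≫ m)) : IsCentralSubgroup m := by
  refine ⟨fun T => ?_, fun v w => ?_, fun v => ?_, fun v z => ?_⟩
  · obtain ⟨u, hu⟩ := h.one T
    exact ⟨u ≫ e, by rw [Category.assoc, hu]⟩
  · obtain ⟨T', t, v', w', _, hv, hw⟩ := exists_local_lift₂ e e v w
    obtain ⟨u, hu⟩ := h.mul v' w'
    refine exists_lift_of_cover t m _ (u ≫ e) ?_
    rw [Category.assoc, hu, reassoc_of% hv, reassoc_of% hw, MonObj.comp_mul]
  · obtain ⟨T', t, v', _, hv⟩ := exists_local_lift e v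
    obtain ⟨u, hu⟩ := h.inv v'
    refine exists_lift_of_cover t m _ (u ≫ e) ?_
    rw [Category.assoc, hu, reassoc_of% hv, GrpObj.comp_inv]
  · obtain ⟨T', t, v', _, hv⟩ := exists_local_lift e v
    refine (cancel_epi t).mp ?_
    rw [MonObj.comp_mul, MonObj.comp_mul, ← reassoc_of% hv, (h.central v' (t ≫ z)).eq]

theorem isEquivalenceRelation [HasPullbacks C] [Mono m] (h : IsCentralSubgroup m) :
    IsEquivalenceRelation (fst H W) (fst H W * (snd H W ≫ m)) := by
  let p := fst H W
  let q := fst H W * (snd H W ≫ m)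
  have comp_q {T : C} (r : T ⟶ H ⊗ W) : r ≫ q = (r ≫ fst H W) * (r ≫ snd H W ≫ m) :=
    MonObj.comp_mul _ _ _
  obtain ⟨e, he⟩ := h.one H
  obtain ⟨n, hn⟩ := h.inv (snd H W)
  obtain ⟨u, hu⟩ := h.mul (pullback.fst q p ≫ snd H W) (pullback.snd q p ≫ snd H W)
  refine EquivalenceRelation.isEquivalenceRelation
    { right_cancellation := fun Y a b hab hab' => ?_
      r := lift (𝟙 H) e
      reflexivity₁ := lift_fst _ _
      reflexivity₂ := by
        rw [comp_q, lift_fst, lift_snd_assoc, he, mul_one]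
      s := lift q n
      symmetry₁ := lift_fst _ _
      symmetry₂ := by
        rw [comp_q, lift_fst, lift_snd_assoc, hn, mul_inv_cancel_right]
      c := pullback.cone q p
      isLimit := pullback.isLimit q p
      t := lift (pullback.fst q p ≫ p) u
      transitivity₁ := lift_fst _ _
      transitivity₂ := ?_ }
  · refine CartesianMonoidalCategory.hom_ext _ _ hab ((cancel_mono m).mp ?_)
    rw [comp_q, comp_q, show a ≫ fst H W = b ≫ fst H W from hab] at hab'
    simpa only [Category.assoc] using mul_left_cancel hab'
  · have condition : pullback.snd q p ≫ fst H W = pullback.fst q p ≫ q :=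
      (pullback.condition (f := q) (g := p)).symm
    change lift (pullback.fst q p ≫ p) u ≫ q = pullback.snd q p ≫ q
    rw [comp_q, comp_q, lift_fst, lift_snd_assoc, hu, condition, comp_q, mul_assoc,
      Category.assoc, Category.assoc]

theorem exists_quotient [Regular C] [HasEffectiveEquivalenceRelations C] [Mono m]
    (h : IsCentralSubgroup m) :
    ∃ (B : C) (_ : GrpObj B) (q : H ⟶ B), IsMonHom q ∧ IsRegularEpi q ∧
      ∀ {T : C} (a : T ⟶ H), a ≫ q = 1 ↔ ∃ w : T ⟶ W, w ≫ m = a := by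
  obtain ⟨⟨E⟩⟩ := HasEffectiveEquivalenceRelations.isEffective _ _ h.isEquivalenceRelation
  have comp_eq_iff {T : C} (a b : T ⟶ H) : a ≫ E.π = b ≫ E.π ↔ ∃ w : T ⟶ W, b = a * (w ≫ m) := by
    constructor
    · intro hab
      obtain ⟨r, rfl, rfl⟩ := E.isKernelPair.exists_lift a b hab
      exact ⟨r ≫ snd H W, by rw [MonObj.comp_mul, Category.assoc]⟩
    · rintro ⟨w, rfl⟩
      simpa only [← Category.assoc, MonObj.comp_mul, lift_fst, lift_snd_assoc, lift_snd] using
        congrArg (lift a w ≫ ·) E.isKernelPair.w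
  obtain ⟨g, hg⟩ := exists_grpObj_of_isRegularEpi E.π fun a b a' b' ha hb => by
    rw [comp_eq_iff] at ha hb ⊢
    obtain ⟨v, rfl⟩ := ha
    obtain ⟨w, rfl⟩ := hb
    obtain ⟨u, hu⟩ := h.mul v w
    exact ⟨u, by rw [hu, (h.central v b).mul_mul_mul_comm]⟩
  refine ⟨E.B, g, E.π, hg, inferInstance, fun a => ?_⟩
  rw [← MonObj.one_comp E.π, eq_comm, comp_eq_iff]
  simp only [one_mul, eq_comm]

end IsCentralSubgroup

end CentralSubgroups

section Generation

variable {C : Type u} [Category.{v} C] [CartesianMonoidalCategory C]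
variable {K G H : C} [GrpObj G] [GrpObj H] {k : H ⟶ G} {x : rootsD4 → (K ⟶ G)}

theorem IsUniversalCentralExtension.eq_comp_of_section (hk : IsUniversalCentralExtension k) {B : C}
    [GrpObj B] {q : H ⟶ B} [IsMonHom q] {d : B ⟶ G} (hd : IsCentralExtension d) (hqd : q ≫ d = k)
    {f : G ⟶ B} [IsMonHom f] (hfd : f ≫ d = 𝟙 G) : q = k ≫ f := by
  have := hk.isCentralExtension.isMonHom
  exact (hk.existsUnique_hom d hd).unique ⟨inferInstance, hqd⟩
    ⟨inferInstance, by rw [Category.assoc, hfd, Category.comp_id]⟩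

variable [Regular C]

theorem HasTrivialSymbols.of_comp {B : C} [GrpObj B] {q : H ⟶ B} [IsMonHom q] {d : B ⟶ G}
    (hqd : IsCentralExtension (q ≫ d)) (hd : IsCentralExtension d)
    (h : ∀ a b : rootsD4, a.1 ⬝ᵥ b.1 = 0 → ∀ {T : C} (p p' : T ⟶ K) (g g' : T ⟶ H),
      g ≫ q ≫ d = p ≫ x a → g' ≫ q ≫ d = p' ≫ x b → ⁅g, g'⁆ ≫ q = 1) :
    HasTrivialSymbols hd x := by
  intro a b hab T p p'
  obtain ⟨T', e, g, g', _, hg, hg'⟩ := hqd.exists_lift₂ (p ≫ x a) (p' ≫ x b)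
  refine (cancel_epi e).mp ?_
  rw [hd.comp_liftedComm, ← hg, ← hg', ← Category.assoc, ← Category.assoc, hd.liftedComm_comp,
    ← commutator_comp_hom, MonObj.comp_one]
  rw [← Category.assoc] at hg hg'
  exact h a b hab (e ≫ p) (e ≫ p') g g' (by simpa only [Category.assoc] using hg)
    (by simpa only [Category.assoc] using hg')

variable [NonUnitalCommRingObj K] {N : rootsD4 → rootsD4 → ℤ}

theorem HasTrivialSymbols.exists_hom_section {hk : IsCentralExtension k}
    (h : HasTrivialSymbols hk x) (hx : IsSteinbergGroup N x) (hK : IsWeaklyUnital K)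
    (hN : IsSignSystem N) : ∃ f : G ⟶ H, IsMonHom f ∧ f ≫ k = 𝟙 G := by
  have := hk.isMonHom
  obtain ⟨z, hz, hzk⟩ := h.exists_section hx.relations hK hN
  obtain ⟨f, ⟨hf, hxf⟩, -⟩ := hx.existsUnique_hom z hz
  exact ⟨f, hf, (hx.existsUnique_hom x hx.relations).unique
    ⟨inferInstance, fun a => by rw [← Category.assoc, hxf, hzk]⟩
    ⟨inferInstance, fun a => Category.comp_id _⟩⟩

/-- The quotient of the universal central extension by the subgroup is a central extension with
trivial symbols. Hence it splits, and by universality the kernel of `k` dies in it. -/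
theorem IsUniversalCentralExtension.exists_comp_eq_of_comp_eq_one
    [HasEffectiveEquivalenceRelations C] (hk : IsUniversalCentralExtension k)
    (hx : IsSteinbergGroup N x) (hK : IsWeaklyUnital K) (hN : IsSignSystem N) {W : C} {m : W ⟶ H}
    [Mono m] (hm : IsCentralSubgroup m) (hmk : m ≫ k = 1)
    (h : ∀ a b : rootsD4, a.1 ⬝ᵥ b.1 = 0 → ∀ {T : C} (p p' : T ⟶ K) (g g' : T ⟶ H),
      g ≫ k = p ≫ x a → g' ≫ k = p' ≫ x b → ∃ w : T ⟶ W, w ≫ m = ⁅g, g'⁆)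
    {T : C} {z : T ⟶ H} (hz : z ≫ k = 1) : ∃ w : T ⟶ W, w ≫ m = z := by
  have hkc := hk.isCentralExtension
  obtain ⟨B, _, q, _, _, hq⟩ := hm.exists_quotient
  obtain ⟨d, hd, rfl⟩ := hkc.exists_desc q fun a ha => by
    have := hkc.isMonHom
    obtain ⟨w, rfl⟩ := (hq a).mp ha
    rw [Category.assoc, hmk, MonObj.comp_one]
  have htrivial : HasTrivialSymbols hd x :=
    .of_comp hkc hd fun a b hab T p p' g g' hg hg' => (hq _).mpr (h a b hab p p' g g' hg hg')
  obtain ⟨f, _, hfd⟩ := htrivial.exists_hom_section hx hK hN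
  refine (hq z).mp ?_
  rw [hk.eq_comp_of_section hd rfl hfd, ← Category.assoc, hz, MonObj.one_comp]

end Generation

section OrbitProduct

/-- The product `(a, b, c) ↦ f₀(a) f₊(b) f₋(c)` of a family of morphisms indexed by the orbits,
whose image is the product of the images of the family. -/
def orbitProd {C : Type u} [Category.{v} C] [CartesianMonoidalCategory C] {A G : C} [GrpObj G]
    (f : Orbit → (A ⟶ G)) : A ⊗ (A ⊗ A) ⟶ G :=
  ((fst A (A ⊗ A) ≫ f .zero) * (snd A (A ⊗ A) ≫ fst A A ≫ f .plus)) *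
    (snd A (A ⊗ A) ≫ snd A A ≫ f .minus)

variable {C : Type u} [Category.{v} C] [CartesianMonoidalCategory C]
variable {A G H : C} [GrpObj G] [GrpObj H]

theorem lift_orbitProd (f : Orbit → (A ⟶ G)) {T : C} (a b c : T ⟶ A) :
    lift a (lift b c) ≫ orbitProd f = ((a ≫ f .zero) * (b ≫ f .plus)) * (c ≫ f .minus) := by
  simp only [orbitProd, MonObj.comp_mul, lift_fst_assoc, lift_snd_assoc]

theorem orbitProd_comp (f : Orbit → (A ⟶ G)) (i : G ⟶ H) [IsMonHom i] :
    orbitProd f ≫ i = orbitProd fun o => f o ≫ i := by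
  simp only [orbitProd, MonObj.mul_comp, Category.assoc]

theorem isCentralSubgroup_orbitProd {f : Orbit → (A ⟶ G)} (hf : ∀ o, IsCentralSubgroup (f o)) :
    IsCentralSubgroup (orbitProd f) := by
  have hprod := (hf .zero).prod ((hf .plus).prod (hf .minus))
  rwa [MonObj.comp_mul, ← mul_assoc] at hprod

theorem exists_comp_orbitProd {f : Orbit → (A ⟶ G)} (hf : ∀ o, IsCentralSubgroup (f o))
    (o : Orbit) {T : C} (a : T ⟶ A) : ∃ u, u ≫ orbitProd f = a ≫ f o := by
  choose e he using fun o => (hf o).one T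
  cases o with
  | zero => exact ⟨lift a (lift (e .plus) (e .minus)), by simp only [lift_orbitProd, he, mul_one]⟩
  | plus => exact ⟨lift (e .zero) (lift a (e .minus)), by
      simp only [lift_orbitProd, he, mul_one, one_mul]⟩
  | minus => exact ⟨lift (e .zero) (lift (e .plus) a), by simp only [lift_orbitProd, he, one_mul]⟩

end OrbitProduct

section SchurMultiplier

variable {C : Type u} [Category.{v} C] [CartesianMonoidalCategory C]
variable {K : C} [NonUnitalCommRingObj K] {St H M K2e K2 : C} [GrpObj St] [GrpObj H] [GrpObj M]
variable [NonUnitalCommRingObj K2e] {N : rootsD4 → rootsD4 → ℤ} {x : rootsD4 → (K ⟶ St)}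
variable {k : H ⟶ St} {i : M ⟶ H} {π : K ⟶ K2e}

theorem IsOrbitHom.isCentralSubgroup_comp (hk : IsCentralExtension k) [IsMonHom i]
    (hik : i ≫ k = 1) {o : Orbit} {c : K2e ⟶ M} (hc : IsOrbitHom x k i π o c) :
    IsCentralSubgroup (c ≫ i) := by
  have := hk.isMonHom
  refine IsAddMulHom.isCentralSubgroup (fun p q => ?_) fun a h => hk.central _ _ ?_
  · rw [← Category.assoc, hc.map_add, MonObj.mul_comp, Category.assoc, Category.assoc]
  · rw [Category.assoc, Category.assoc, hik, MonObj.comp_one, MonObj.comp_one]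

theorem IsSchurMultiplier.isRegularEpi_orbitProd [Regular C] [HasEffectiveEquivalenceRelations C]
    (hM : IsSchurMultiplier i k) (hSt : IsSteinbergGroup N x) (hK : IsWeaklyUnital K)
    (hN : IsSignSystem N) {c : Orbit → (K2e ⟶ M)} (hc : ∀ o, IsOrbitHom x k i π o (c o)) :
    IsRegularEpi (orbitProd c) := by
  have hk := hM.isUniversalCentralExtension
  have := hM.isMonHom
  have := hk.isCentralExtension.isMonHom
  have := mono_of_isPullback_one hM.isPullback
  have hik : i ≫ k = 1 := hM.isPullback.w
  have hcentral o := (hc o).isCentralSubgroup_comp hk.isCentralExtension hik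
  let W := image (orbitProd c)
  let e : _ ⟶ W := factorThruImage (orbitProd c)
  let m : W ⟶ M := image.ι (orbitProd c)
  have hem : e ≫ m = orbitProd c := image.fac _
  have hem_comp : e ≫ m ≫ i = orbitProd fun o => c o ≫ i := by
    rw [← Category.assoc, hem, orbitProd_comp]
  have hsubgroup : IsCentralSubgroup (m ≫ i) :=
    .of_comp e (hem_comp ▸ isCentralSubgroup_orbitProd hcentral)
  obtain ⟨w, hw⟩ := hk.exists_comp_eq_of_comp_eq_one hSt hK hN hsubgroup
    (by rw [Category.assoc, hik, MonObj.comp_one])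
    (fun a b hab T p p' g g' hg hg' => by
      obtain ⟨o, ho⟩ := exists_orbit hab
      obtain ⟨u, hu⟩ := exists_comp_orbitProd hcentral o ((p * p') ≫ π)
      refine ⟨u ≫ e, ?_⟩
      rw [Category.assoc, hem_comp, hu, (hc o).commutator_eq a b hab ho p p' g g' hg hg',
        Category.assoc])
    hik
  have hwm : w ≫ m = 𝟙 M := by rw [← cancel_mono i, Category.assoc, hw, Category.id_comp]
  have : IsRegularEpi (w ≫ m) := hwm ▸ inferInstance
  have := isRegularEpi_of_comp w m
  rw [← hem]
  infer_instance

theorem prod_comp_section_eq_one [NonUnitalCommRingObj K2] (hπ : IsRingObjHom π) [IsRegularEpi π]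
    {ρ : K2e ⟶ K2} [IsRegularEpi ρ] {s : K2 ⟶ K2e} (hs : ρ ≫ s = 𝟙 K2e * 𝟙 K2e)
    {c : Orbit → (K2e ⟶ M)}
    (hc : ∀ {T : C} (p : T ⟶ K), ((p * p) ≫ π ≫ c .zero) * ((p * p) ≫ π ≫ c .plus) *
      ((p * p) ≫ π ≫ c .minus) = 1) {T : C} (q : T ⟶ K2) :
    (q ≫ s ≫ c .zero) * (q ≫ s ≫ c .plus) * (q ≫ s ≫ c .minus) = 1 := by
  have hsq : π ≫ ρ ≫ s = (𝟙 K * 𝟙 K) ≫ π := by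
    rw [hs, comp_mul_hom, hπ.map_mul, Category.comp_id, Category.id_comp]
  have hprod : (s ≫ c .zero) * (s ≫ c .plus) * (s ≫ c .minus) = 1 := by
    rw [← cancel_epi ρ, ← cancel_epi π]
    simp only [MonObj.comp_mul, MonObj.comp_one, reassoc_of% hsq, hc]
  rw [← MonObj.comp_mul, ← MonObj.comp_mul, hprod, MonObj.comp_one]

end SchurMultiplier

end SteinbergD4

theorem mainTheorem6_general {C : Type u} [Category.{v} C] [CartesianMonoidalCategory C]
    [Regular C] [HasUniversalCountableCoproducts C] [HasEffectiveEquivalenceRelations C]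
    {K : C} [NonUnitalCommRingObj K] (hK : IsWeaklyUnital K)
    {N : rootsD4 → rootsD4 → ℤ} (hN : IsStructureConstants N)
    {St : C} [GrpObj St] {x : rootsD4 → (K ⟶ St)} (hSt : IsSteinbergGroup N x)
    {H : C} [GrpObj H] {k : H ⟶ St} {M : C} [GrpObj M] {i : M ⟶ H}
    (hM : IsSchurMultiplier i k)
    {K2e : C} [NonUnitalCommRingObj K2e] {π : K ⟶ K2e}
    (hπ : IsQuotientBySpan TwoEpsRelator π)
    {K2 : C} [NonUnitalCommRingObj K2] {ρ : K2e ⟶ K2}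
    (hρ : IsQuotientBySpan BooleanRelator ρ) :
    ∃ c : Orbit → (K2e ⟶ M),
      (∀ o, IsOrbitHom x k i π o (c o)) ∧
      (∀ o (c' : K2e ⟶ M), IsOrbitHom x k i π o c' → c' = c o) ∧
      IsRegularEpi (orbitProd c) ∧
      (∀ {T : C} (p : T ⟶ K2e), p ≫ ρ = 0 →
        p ≫ c .zero = p ≫ c .plus ∧ p ≫ c .plus = p ≫ c .minus) ∧
      ∃ s : K2 ⟶ K2e, IsRingObjHom s ∧ s ≫ ρ = 𝟙 K2 ∧ ρ ≫ s = 𝟙 K2e * 𝟙 K2e ∧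
        ∀ {T : C} (q : T ⟶ K2),
          (q ≫ s ≫ c .zero) * (q ≫ s ≫ c .plus) * (q ≫ s ≫ c .minus) = 1 := by
  have hk := hM.isUniversalCentralExtension.isCentralExtension
  have hsigns := hN.isSignSystem
  have hx := hSt.relations
  have := hπ.isRegularEpi
  have := hρ.isRegularEpi
  have := hM.isMonHom
  have := mono_of_isPullback_one hM.isPullback
  obtain ⟨F, hF⟩ := exists_isSymbolFamily hx hK hsigns hk
  choose c hcF hc using hF.exists_orbitHom hx hK hsigns hπ hM.isMonHom hM.isPullback
  have hideal (o o' : Orbit) {T : C} {p : T ⟶ K2e} (hp : p ≫ ρ = 0) : p ≫ c o = p ≫ c o' :=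
    hπ.comp_eq_of_ideal hρ hK (hc o).map_add (hc o').map_add (fun r p => by
      simpa only [← cancel_mono i, Category.assoc, hcF] using hF.map_ideal hx hK hsigns o o' r p) hp
  obtain ⟨s, hs, hsρ, hρs⟩ := hπ.exists_section hρ
  refine ⟨c, hc, fun o c' hc' => hc'.unique hK hk (hc o),
    hM.isRegularEpi_orbitProd hSt hK hsigns hc, fun p hp => ⟨hideal _ _ hp, hideal _ _ hp⟩,
    s, hs, hsρ, hρs, prod_comp_section_eq_one hπ.isHom hρs fun p => ?_⟩
  simpa only [← cancel_mono i, MonObj.mul_comp, MonObj.one_comp, Category.assoc, hcF] using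
    hF.map_square hx hK hsigns p

theorem mainTheorem6 {C : Type u} [Category.{v} C] [CartesianMonoidalCategory C]
    [InfinitaryPretopos C]
    {K : C} [NonUnitalCommRingObj K] (hK : IsWeaklyUnital K)
    {N : rootsD4 → rootsD4 → ℤ} (hN : IsStructureConstants N)
    {St : C} [GrpObj St] {x : rootsD4 → (K ⟶ St)} (hSt : IsSteinbergGroup N x)
    {H : C} [GrpObj H] {k : H ⟶ St} {M : C} [GrpObj M] {i : M ⟶ H}
    (hM : IsSchurMultiplier i k)
    {K2e : C} [NonUnitalCommRingObj K2e] {π : K ⟶ K2e}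
    (hπ : IsQuotientBySpan TwoEpsRelator π)
    {K2 : C} [NonUnitalCommRingObj K2] {ρ : K2e ⟶ K2}
    (hρ : IsQuotientBySpan BooleanRelator ρ) :
    ∃ c : Orbit → (K2e ⟶ M),
      -- the homomorphisms are the ones given by commutators, and these are unique
      (∀ o, IsOrbitHom x k i π o (c o)) ∧
      (∀ o (c' : K2e ⟶ M), IsOrbitHom x k i π o c' → c' = c o) ∧
      -- the Schur multiplier is the product of the three images
      IsRegularEpi (((fst K2e (K2e ⊗ K2e) ≫ c .zero) *
        (snd K2e (K2e ⊗ K2e) ≫ fst K2e K2e ≫ c .plus)) *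
          (snd K2e (K2e ⊗ K2e) ≫ snd K2e K2e ≫ c .minus)) ∧
      -- they agree on the ideal `I`, the kernel of `K2e ⟶ K2`
      (∀ {T : C} (p : T ⟶ K2e), p ≫ ρ = 0 →
        p ≫ c .zero = p ≫ c .plus ∧ p ≫ c .plus = p ≫ c .minus) ∧
      -- `K2` is embedded in `K2e` by squares, and their product is trivial on `K2`
      ∃ s : K2 ⟶ K2e, IsRingObjHom s ∧ s ≫ ρ = 𝟙 K2 ∧ ρ ≫ s = 𝟙 K2e * 𝟙 K2e ∧
        ∀ {T : C} (q : T ⟶ K2),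
          (q ≫ s ≫ c .zero) * (q ≫ s ≫ c .plus) * (q ≫ s ≫ c .minus) = 1 :=
  mainTheorem6_general hK hN hSt hM hπ hρ
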